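/- Let $N\ge 0$, $T\in\mathbb R$, and let $\mathbf m:(T,\infty)\times\mathbb R\to\mathbb S^2\subset\mathbb R^3$ be a (classical) rational solution, with simple poles, of the half-wave maps equation $$\partial_t\mathbf m=\mathbf m\times|\nabla|\mathbf m,\qquad |\nabla|\mathbf m=\mathcal H(\partial_x\mathbf m),\qquad \mathcal H f(x)=\frac1\pi\,\mathrm{p.v.}\!\int_{\mathbb R}\frac{f(y)}{x-y}\,dy ,$$ that is, for all $t>T$ and $x\in\mathbb R$, $$\mathbf m(t,x)=\mathbf m_0+\sum_{j=1}^N\frac{\mathbf s_j(t)}{x-x_j(t)}+\sum_{j=1}^N\frac{\overline{\mathbf s_j(t)}}{x-\overline{x_j(t)}},$$ where $\mathbf m_0\in\mathbb R^3$, the functions $\mathbf s_j:(T,\infty)\to\mathbb C^3\setminus\{0\}$ and $x_j:(T,\infty)\to\{\operatorname{Im}>0\}$ are differentiable, and $x_1(t),\dots,x_N(t)$ are pairwise distinct for every $t>T$. Put $$S(t)=\max_j|\mathbf s_j(t)|,\qquad \nu(t)=\min_{j\ne k}|\operatorname{Re}\dot x_j(t)-\operatorname{Re}\dot x_k(t)|,\qquad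 D(t)=\min_{j\neq k}|\operatorname{Re}x_j(t)-\operatorname{Re}x_k(t)|$$ (minima over the empty set are $+\infty$). Suppose that for some $t_0>T$ $$\alpha(t_0)=D(t_0)-\frac{2^4\,N\,S(t_0)}{\nu(t_0)}>0$$ (in particular $\nu(t_0)>0$; if $N\le 1$ the condition is regarded as satisfied). Then there are pairwise distinct $v_1,\dots,v_N\in\mathbb R$, vectors $\mathbf a_1,\dots,\mathbf a_N\in\mathbb C^3$ and $b_1,\dots,b_N\in\mathbb C$ with $\operatorname{Im}b_j>0$ such that, with $$g(t,x)=\mathbf m_0+\sum_{j=1}^N\frac{\mathbf a_j}{x-v_jt-b_j}+\sum_{j=1}^N\frac{\overline{\mathbf a_j}}{x-v_jt-\overline{b_j}},$$ the solution $\mathbf m$ scatters to $g$ in every Sobolev norm, i.e. $\|\mathbf m(t,\cdot)-g(t,\cdot)\|_{H^\sigma(\mathbb R)}\to0$ as $t\to+\infty$ for every $\sigma\ge0$. Moreover, for every $j$, $x_j(t)-v_jt\to b_j$ and $\mathbf s_j(t)\to\mathbf a_j$ as $t\to+\infty$. -/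

import Mathlib

open MeasureTheory Filter Topology
open scoped ENNReal Matrix FourierTransform ComplexConjugate

noncomputable section

namespace HalfWave

/-- Real three-space with its Euclidean norm. -/
abbrev R3 : Type := EuclideanSpace ℝ (Fin 3)

/-- Complex three-space with its Hermitian norm. -/
abbrev C3 : Type := EuclideanSpace ℂ (Fin 3)

/-- The inclusion of real vectors into complex vectors. -/
def toC (u : R3) : C3 := WithLp.toLp 2 fun i => (u i : ℂ)

/-- Componentwise complex conjugation. -/
def conjC (a : C3) : C3 := WithLp.toLp 2 fun i => conj (a i)

/-- The cross product of real three-space. -/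
def cross (u w : R3) : R3 := WithLp.toLp 2 (u.ofLp ⨯₃ w.ofLp)

/-- `h` is the value at `y` of the Hilbert transform of `f`, that is, of the principal value
`(1 / π) p.v. ∫ f(z) / (y - z) dz`. -/
def HasHilbertTransformAt (f : ℝ → R3) (h : R3) (y : ℝ) : Prop :=
  (∀ ε : ℝ, 0 < ε → IntegrableOn (fun z => (y - z)⁻¹ • f z) {z | ε < |y - z|}) ∧
    Tendsto (fun ε : ℝ => Real.pi⁻¹ • ∫ z in {z | ε < |y - z|}, (y - z)⁻¹ • f z)
      (𝓝[>] 0) (𝓝 h)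

/-- `m` is a classical solution, with values in the unit sphere, of the half-wave maps equation
`∂ₜ m = m × |∇| m`, `|∇| m = H (∂ₓ m)`, for the times `t ∈ I`; the set `I` is meant to be open. -/
structure IsHalfWaveMap (I : Set ℝ) (m : ℝ → ℝ → R3) : Prop where
  sphere : ∀ t ∈ I, ∀ y, ‖m t y‖ = 1
  differentiable : ∀ t ∈ I, Differentiable ℝ (m t)
  equation : ∀ t ∈ I, ∀ y, ∃ h : R3, HasHilbertTransformAt (deriv (m t)) h y ∧
    HasDerivAt (fun τ => m τ y) (cross (m t y) h) t

/-- The rational function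
`y ↦ m₀ + ∑ⱼ aⱼ / (y - pⱼ) + ∑ⱼ conj aⱼ / (y - conj pⱼ)`. -/
def rationalProfile {N : ℕ} (m₀ : R3) (a : Fin N → C3) (p : Fin N → ℂ) (y : ℝ) : C3 :=
  toC m₀ + ∑ j, ((y : ℂ) - p j)⁻¹ • a j + ∑ j, ((y : ℂ) - conj (p j))⁻¹ • conjC (a j)

/-- `m` is a rational solution of the half-wave maps equation for the times `t ∈ I`, with
background `m₀`, spins `s j` and (simple) poles `x j`, `1 ≤ j ≤ N`. -/
structure IsRationalSolution {N : ℕ} (I : Set ℝ) (m : ℝ → ℝ → R3) (m₀ : R3)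
    (s : Fin N → ℝ → C3) (x : Fin N → ℝ → ℂ) : Prop where
  halfWaveMap : IsHalfWaveMap I m
  im_pos : ∀ t ∈ I, ∀ j, 0 < (x j t).im
  poles_distinct : ∀ t ∈ I, Function.Injective fun j => x j t
  spin_ne_zero : ∀ t ∈ I, ∀ j, s j t ≠ 0
  differentiableAt_spin : ∀ t ∈ I, ∀ j, DifferentiableAt ℝ (s j) t
  differentiableAt_pole : ∀ t ∈ I, ∀ j, DifferentiableAt ℝ (x j) t
  representation : ∀ t ∈ I, ∀ y,
    toC (m t y) = rationalProfile m₀ (fun j => s j t) (fun j => x j t) y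

/-- `S(t) = maxⱼ |sⱼ(t)|`. -/
def spinSize {N : ℕ} (s : Fin N → ℝ → C3) (t : ℝ) : ℝ≥0∞ :=
  ⨆ j, ENNReal.ofReal ‖s j t‖

/-- `ν(t) = min_{j ≠ k} |Re xⱼ'(t) - Re xₖ'(t)|`, a minimum over no pair being `∞`. -/
def velocityGap {N : ℕ} (x : Fin N → ℝ → ℂ) (t : ℝ) : ℝ≥0∞ :=
  ⨅ (j : Fin N) (k : Fin N) (_ : j ≠ k),
    ENNReal.ofReal |(deriv (x j) t).re - (deriv (x k) t).re|

/-- `D(t) = min_{j ≠ k} |Re xⱼ(t) - Re xₖ(t)|`, a minimum over no pair being `∞`. -/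
def poleGap {N : ℕ} (x : Fin N → ℝ → ℂ) (t : ℝ) : ℝ≥0∞ :=
  ⨅ (j : Fin N) (k : Fin N) (_ : j ≠ k), ENNReal.ofReal |(x j t).re - (x k t).re|

/-- The positive part of `α(t) = D(t) - 2⁴ N S(t) / ν(t)`. Division is that of `[0, ∞]`, so that
`ν(t) = 0` makes the subtracted term infinite as soon as `S(t) ≠ 0`. -/
def alpha {N : ℕ} (s : Fin N → ℝ → C3) (x : Fin N → ℝ → ℂ) (t : ℝ) : ℝ≥0∞ :=
  poleGap x t - 2 ^ 4 * (N : ℝ≥0∞) * spinSize s t / velocityGap x t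

open Classical in
/-- The norm of the Sobolev space `H^σ(ℝ; ℂ³)`, `σ ≥ 0`:
`‖f‖² = ∫ (1 + ξ²)^σ |f̂(ξ)|² dξ` with the unitary Fourier transform
`f̂(ξ) = (2π)^(-1/2) ∫ e^(-i y ξ) f(y) dy` of `L²`, written in the frequency variable `ξ / (2π)`;
it is `∞` for functions outside `L²`. -/
def sobolevNorm (σ : ℝ) (f : ℝ → C3) : ℝ≥0∞ :=
  if h : MemLp f 2 (volume : Measure ℝ) then
    eLpNorm (fun ξ : ℝ => ((1 + (2 * Real.pi * ξ) ^ 2) ^ (σ / 2) : ℝ) • (𝓕 (h.toLp f)) ξ) 2 volume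
  else ⊤

/-- `m` scatters to `g` as `t → +∞`, in every Sobolev norm `H^σ`, `σ ≥ 0` (these dominate the
homogeneous ones). -/
def ScattersTo (m : ℝ → ℝ → R3) (g : ℝ → ℝ → C3) : Prop :=
  ∀ σ : ℝ, 0 ≤ σ →
    Tendsto (fun t => sobolevNorm σ fun y => toC (m t y) - g t y) atTop (𝓝 0)

end HalfWave

end

noncomputable section

namespace HalfWave

/-! ### Partial fractions -/

/-! Replace a vector `u` by its Pauli matrix `u · σ`. The sphere condition becomes `M ^ 2 = 1` and
the half-wave maps equation becomes a commutator equation between rational matrix functions.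
Comparing partial fractions over all poles, upper and conjugate, gives the equations of motion
(`IsRationalSolution.isPoleSystem`). Let `B_j` be the regular part of `M` at `x_j`. The residue
`S_j` squares to zero, anticommutes with `B_j`, satisfies `x_j' S_j = S_j B_j`, and `S_j'` is a
commutator. One more differentiation gives `x_j'' S_j = -2 ∑ S_j S_k S_j / (x_j - x_k) ^ 3`, in
which the interaction between upper and lower poles has cancelled. This is a spin Calogero–Moser
system in the upper half plane.

Being nilpotent, `S_j` factors as `e_j f_jᵀ`. The Lax matrix `L`, with diagonal `x_j'` and
off-diagonal entries `-(f_j · e_k) / (x_j - x_k)`, linearises the flow: the poles at time `t₁` are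
the eigenvalues of `X + (t₁ - t₀) L`, where `X = diag (x_j(t₀))` and `L` is taken at `t₀`
(`IsRationalSolution.prod_sub_pole`). So the set of the `x_j(t) / t` approaches the spectrum of `L`.
That spectrum is real and semisimple, because `L` is self-adjoint for the Gram matrix of the
functions `e_j / (y - x_j)` in the Hardy space (`gramMatrix_definite`,
`gramMatrix_mul_laxMatrix_isHermitian`). It is simple because `α(t₀) > 0` makes suitably weighted
Gershgorin discs disjoint (`exists_injective_det_eq_prod`). Hence the poles separate linearly in
time and `Im x_j = o(t)` (`IsRationalSolution.poles_separate`).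

The anticommutation relation bounds `|s_j|` by a multiple of `Im x_j (1 + ∑ |s_k| / |x_j - x_k|)`,
so the spins are `o(t)`. The spin equation gives a Riccati inequality whose solutions of size `o(t)`
are bounded (`exists_bound_of_riccati`). Then `s_j' = O(t⁻²)` and `x_j'' = O(t⁻³)`, and integration
gives the limits. The limit spins do not vanish, by a Gronwall argument, and are bounded by a
multiple of `Im b_j`, so `Im b_j > 0`.

Finally `(y - p)⁻¹` has an exponential on a half line as Fourier transform. The transform of `m - g`
is therefore bounded by a quantity tending to zero times `(1 + 2π|ξ|) exp (-c|ξ|)`, which controls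
every Sobolev norm. -/

theorem sub_ne_zero_of_im_ne_zero {p : ℂ} (hp : p.im ≠ 0) (y : ℝ) : (y : ℂ) - p ≠ 0 := by
  intro h
  apply hp
  have := congrArg Complex.im h
  simpa using this

/-- After clearing denominators a polynomial vanishes on the whole real line, hence identically; its
values at the poles isolate the coefficients. -/
theorem partialFraction_eq_zero {ι : Type*} [Fintype ι] [DecidableEq ι] {z : ι → ℂ}
    (hz : Function.Injective z) (hzi : ∀ a, (z a).im ≠ 0) {c : ℂ} {α β : ι → ℂ}
    (h : ∀ y : ℝ, c + ∑ a, (((y : ℂ) - z a)⁻¹ * α a + ((y : ℂ) - z a)⁻¹ ^ 2 * β a) = 0) :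
    c = 0 ∧ (∀ a, α a = 0) ∧ ∀ a, β a = 0 := by
  have hroot : ∀ P : Polynomial ℂ, (∀ y : ℝ, P.eval (y : ℂ) = 0) → P = 0 := by
    intro P hP
    refine Polynomial.eq_zero_of_infinite_isRoot P ?_
    refine Set.Infinite.mono (s := Set.range (fun y : ℝ => (y : ℂ))) ?_
      (Set.infinite_range_of_injective Complex.ofReal_injective)
    rintro _ ⟨y, rfl⟩
    exact hP y
  have hne : ∀ (y : ℝ) a, (y : ℂ) - z a ≠ 0 := fun y a => sub_ne_zero_of_im_ne_zero (hzi a) y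
  have hprod : ∀ a, ∏ b ∈ Finset.univ.erase a, (z a - z b) ≠ 0 := by
    intro a
    refine Finset.prod_ne_zero_iff.2 fun b hb => sub_ne_zero.2 fun hab => ?_
    exact (Finset.ne_of_mem_erase hb) (hz hab).symm
  have hβ : ∀ a, β a = 0 := by
    -- With all factors squared, only the term of `β a` survives at `z a`.
    have hP := hroot (Polynomial.C c * ∏ a, (Polynomial.X - Polynomial.C (z a)) ^ 2 +
      ∑ a, (Polynomial.C (α a) * (Polynomial.X - Polynomial.C (z a)) + Polynomial.C (β a)) *
        ∏ b ∈ Finset.univ.erase a, (Polynomial.X - Polynomial.C (z b)) ^ 2) (by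
      intro y
      have h1 := congrArg (· * ∏ a, ((y : ℂ) - z a) ^ 2) (h y)
      simp only [zero_mul, add_mul, Finset.sum_mul] at h1
      simp only [Polynomial.eval_add, Polynomial.eval_mul, Polynomial.eval_C,
        Polynomial.eval_prod, Polynomial.eval_pow, Polynomial.eval_sub, Polynomial.eval_X,
        Polynomial.eval_finsetSum]
      rw [← h1]
      congr 1
      refine Finset.sum_congr rfl fun a _ => ?_
      rw [← Finset.mul_prod_erase _ _ (Finset.mem_univ a)]
      have := hne y a
      field_simp)
    intro a
    have h2 := congrArg (Polynomial.eval (z a)) hP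
    simp only [Polynomial.eval_add, Polynomial.eval_mul, Polynomial.eval_C,
        Polynomial.eval_prod, Polynomial.eval_pow, Polynomial.eval_sub, Polynomial.eval_X,
        Polynomial.eval_finsetSum, Polynomial.eval_zero] at h2
    rw [Finset.prod_eq_zero (Finset.mem_univ a) (by simp),
      Finset.sum_eq_single a (fun b _ hb => by
        rw [Finset.prod_eq_zero (Finset.mem_erase.2 ⟨hb.symm, Finset.mem_univ a⟩) (by simp)]
        simp) (by simp)] at h2
    simp only [mul_zero, sub_self, zero_add, Finset.prod_pow] at h2
    exact (mul_eq_zero.1 h2).resolve_right (pow_ne_zero _ (hprod a))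
  have hα : ∀ a, α a = 0 := by
    -- Now that `β` vanishes, simple factors suffice, and `z a` isolates `α a`.
    have hP := hroot (Polynomial.C c * ∏ a, (Polynomial.X - Polynomial.C (z a)) +
      ∑ a, Polynomial.C (α a) *
        ∏ b ∈ Finset.univ.erase a, (Polynomial.X - Polynomial.C (z b))) (by
      intro y
      have h1 := congrArg (· * ∏ a, ((y : ℂ) - z a)) (h y)
      simp only [zero_mul, add_mul, Finset.sum_mul] at h1
      simp only [Polynomial.eval_add, Polynomial.eval_mul, Polynomial.eval_C,
        Polynomial.eval_prod, Polynomial.eval_sub, Polynomial.eval_X,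
        Polynomial.eval_finsetSum]
      rw [← h1]
      congr 1
      refine Finset.sum_congr rfl fun a _ => ?_
      rw [← Finset.mul_prod_erase _ _ (Finset.mem_univ a), hβ a]
      have := hne y a
      field_simp
      simp only [add_zero]
      ring)
    intro a
    have h2 := congrArg (Polynomial.eval (z a)) hP
    simp only [Polynomial.eval_add, Polynomial.eval_mul, Polynomial.eval_C,
        Polynomial.eval_prod, Polynomial.eval_sub, Polynomial.eval_X,
        Polynomial.eval_finsetSum, Polynomial.eval_zero] at h2
    rw [Finset.prod_eq_zero (Finset.mem_univ a) (by simp),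
      Finset.sum_eq_single a (fun b _ hb => by
        rw [Finset.prod_eq_zero (Finset.mem_erase.2 ⟨hb.symm, Finset.mem_univ a⟩) (by simp)]
        simp) (by simp)] at h2
    simp only [mul_zero, zero_add] at h2
    exact (mul_eq_zero.1 h2).resolve_right (hprod a)
  refine ⟨?_, hα, hβ⟩
  simpa [hα, hβ] using h 0

/-! ### The Hilbert transform of a rational function -/

theorem tendsto_log_sub_atTop (p : ℂ) :
    Tendsto (fun z : ℝ => Complex.log ((z : ℂ) - p) - (Real.log z : ℂ)) atTop (𝓝 0) := by
  have h1 : Tendsto (fun z : ℝ => 1 - p / (z : ℂ)) atTop (𝓝 1) := by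
    have : Tendsto (fun z : ℝ => p * ((z⁻¹ : ℝ) : ℂ)) atTop (𝓝 (p * ((0 : ℝ) : ℂ))) :=
      ((Complex.continuous_ofReal.tendsto 0).comp tendsto_inv_atTop_zero).const_mul p
    have h := this.const_sub 1
    simpa [div_eq_mul_inv] using h
  have h2 : Tendsto (fun z : ℝ => Complex.log (1 - p / (z : ℂ))) atTop (𝓝 0) := by
    have := (continuousAt_clog (x := 1) (by simp)).tendsto.comp h1
    simpa [Function.comp_def] using this
  refine h2.congr' ?_
  filter_upwards [eventually_gt_atTop 0, h1.eventually_ne one_ne_zero] with z hz hz1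
  have hz' : (z : ℂ) ≠ 0 := by exact_mod_cast hz.ne'
  have : (z : ℂ) - p = (z : ℂ) * (1 - p / z) := by field_simp
  rw [this, Complex.log_ofReal_mul hz hz1]
  ring

/-- `Real.log z` is `log |z|`, so the difference tends to `i` times the limiting argument of `z -
p`, which is `π` or `-π` according to the side of the cut. This half turn is where the sign of the
imaginary part of a pole enters the Hilbert transform. -/
theorem tendsto_log_sub_atBot {p : ℂ} (hp : p.im ≠ 0) :
    Tendsto (fun z : ℝ => Complex.log ((z : ℂ) - p) - (Real.log z : ℂ)) atBot
      (𝓝 (-(SignType.sign p.im : ℝ) * (Real.pi * Complex.I))) := by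
  rw [← map_neg_atTop, tendsto_map'_iff]
  have h1 : Tendsto (fun z : ℝ => -1 - p / (z : ℂ)) atTop (𝓝 (-1)) := by
    have : Tendsto (fun z : ℝ => p * ((z⁻¹ : ℝ) : ℂ)) atTop (𝓝 (p * ((0 : ℝ) : ℂ))) :=
      ((Complex.continuous_ofReal.tendsto 0).comp tendsto_inv_atTop_zero).const_mul p
    have h := this.const_sub (-1)
    simpa [div_eq_mul_inv] using h
  have him : ∀ z : ℝ, (-1 - p / (z : ℂ)).im = - p.im / z := by
    intro z
    simp [Complex.div_ofReal_im, neg_div]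
  have h2 : Tendsto (fun z : ℝ => Complex.log (-1 - p / (z : ℂ))) atTop
      (𝓝 (-(SignType.sign p.im : ℝ) * (Real.pi * Complex.I))) := by
    rcases lt_or_gt_of_ne hp with h | h
    · have := (Complex.tendsto_log_nhdsWithin_im_nonneg_of_re_neg_of_im_zero
        (z := -1) (by simp) (by simp)).comp (tendsto_nhdsWithin_iff.2 ⟨h1, by
          filter_upwards [eventually_gt_atTop 0] with z hz
          rw [him]
          exact div_nonneg (by linarith) hz.le⟩)
      simpa [sign_neg h, Function.comp_def] using this
    · have := (Complex.tendsto_log_nhdsWithin_im_neg_of_re_neg_of_im_zero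
        (z := -1) (by simp) (by simp)).comp (tendsto_nhdsWithin_iff.2 ⟨h1, by
          filter_upwards [eventually_gt_atTop 0] with z hz
          rw [him]
          exact div_neg_of_neg_of_pos (by linarith) hz⟩)
      simpa [sign_pos h, Function.comp_def] using this
  refine h2.congr' ?_
  filter_upwards [eventually_gt_atTop 0, h1.eventually_ne (by norm_num : (-1 : ℂ) ≠ 0)] with z hz hz1
  have hz' : (z : ℂ) ≠ 0 := by exact_mod_cast hz.ne'
  have : ((-z : ℝ) : ℂ) - p = (z : ℂ) * (-1 - p / z) := by push_cast; field_simp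
  simp only [Function.comp_apply]
  rw [this, Complex.log_ofReal_mul hz hz1, Real.log_neg_eq_log]
  ring

/-- A primitive of `z ↦ (y - z)⁻¹ (z - p)⁻²`. -/
def hilbertPrimitive (y : ℝ) (p : ℂ) (z : ℝ) : ℂ :=
  ((y : ℂ) - p)⁻¹ ^ 2 * (Complex.log ((z : ℂ) - p) - (Real.log (z - y) : ℂ)) -
    ((y : ℂ) - p)⁻¹ * ((z : ℂ) - p)⁻¹

theorem hasDerivAt_hilbertPrimitive {y : ℝ} {p : ℂ} (hp : p.im ≠ 0) {z : ℝ} (hz : z ≠ y) :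
    HasDerivAt (hilbertPrimitive y p) (((y : ℂ) - z)⁻¹ * ((z : ℂ) - p)⁻¹ ^ 2) z := by
  have hne := sub_ne_zero_of_im_ne_zero hp z
  have hne' := sub_ne_zero_of_im_ne_zero hp y
  have hlin : HasDerivAt (fun z : ℝ => (z : ℂ) - p) 1 z :=
    (Complex.ofRealCLM.hasDerivAt (x := z)).sub_const p
  have hslit : (z : ℂ) - p ∈ Complex.slitPlane := by
    right
    simpa using hp
  have h1 : HasDerivAt (fun z : ℝ => Complex.log ((z : ℂ) - p)) (1 / ((z : ℂ) - p)) z :=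
    hlin.clog_real hslit
  have h2 : HasDerivAt (fun z : ℝ => (Real.log (z - y) : ℂ)) (((z - y)⁻¹ : ℝ) : ℂ) z := by
    have := ((hasDerivAt_id z).sub_const y).log (sub_ne_zero.2 hz)
    simpa using this.ofReal_comp
  have h3 : HasDerivAt (fun z : ℝ => ((z : ℂ) - p)⁻¹) (-1 / ((z : ℂ) - p) ^ 2) z :=
    hlin.fun_inv hne
  have h := ((h1.sub h2).const_mul (((y : ℂ) - p)⁻¹ ^ 2)).sub (h3.const_mul (((y : ℂ) - p)⁻¹))
  refine h.congr_deriv ?_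
  have hyz : (y : ℂ) - z ≠ 0 := by
    rw [← Complex.ofReal_sub]
    exact_mod_cast sub_ne_zero.2 hz.symm
  have hzy : (z : ℂ) - y ≠ 0 := by
    rw [← Complex.ofReal_sub]
    exact_mod_cast sub_ne_zero.2 hz
  push_cast
  rw [show ((z : ℂ) - y)⁻¹ = -((y : ℂ) - z)⁻¹ by rw [← inv_neg, neg_sub]]
  field_simp
  ring

theorem tendsto_inv_sub_atTop (p : ℂ) :
    Tendsto (fun z : ℝ => ((z : ℂ) - p)⁻¹) atTop (𝓝 0) := by
  refine tendsto_inv₀_cobounded.comp ?_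
  refine Tendsto.comp (tendsto_sub_const_cobounded p) ?_
  exact RCLike.tendsto_ofReal_atTop_cobounded ℂ

theorem tendsto_inv_sub_atBot (p : ℂ) :
    Tendsto (fun z : ℝ => ((z : ℂ) - p)⁻¹) atBot (𝓝 0) := by
  refine tendsto_inv₀_cobounded.comp ?_
  refine Tendsto.comp (tendsto_sub_const_cobounded p) ?_
  exact RCLike.tendsto_ofReal_atBot_cobounded ℂ

theorem tendsto_hilbertPrimitive_atTop (y : ℝ) (p : ℂ) :
    Tendsto (hilbertPrimitive y p) atTop (𝓝 0) := by
  have h1 := tendsto_log_sub_atTop p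
  have h2 := tendsto_log_sub_atTop (y : ℂ)
  have h2' : Tendsto (fun z : ℝ => (Real.log (z - y) : ℂ) - (Real.log z : ℂ)) atTop (𝓝 0) := by
    refine h2.congr' ?_
    filter_upwards [eventually_gt_atTop y] with z hz
    rw [← Complex.ofReal_sub, Complex.ofReal_log (x := z - y) (by linarith)]
  have h := ((h1.sub h2').const_mul (((y : ℂ) - p)⁻¹ ^ 2)).sub
    ((tendsto_inv_sub_atTop p).const_mul (((y : ℂ) - p)⁻¹))
  simp only [sub_zero, mul_zero] at h
  refine h.congr fun z => ?_
  simp [hilbertPrimitive]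

theorem tendsto_hilbertPrimitive_atBot (y : ℝ) {p : ℂ} (hp : p.im ≠ 0) :
    Tendsto (hilbertPrimitive y p) atBot
      (𝓝 (((y : ℂ) - p)⁻¹ ^ 2 * (-(SignType.sign p.im : ℝ) * (Real.pi * Complex.I)))) := by
  have h1 := tendsto_log_sub_atBot hp
  have h2' : Tendsto (fun z : ℝ => (Real.log (z - y) : ℂ) - (Real.log z : ℂ)) atBot (𝓝 0) := by
    rw [← map_neg_atTop, tendsto_map'_iff]
    refine (tendsto_log_sub_atTop (-y : ℂ)).congr' ?_
    filter_upwards [eventually_gt_atTop (-y)] with z hz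
    simp only [Function.comp_apply]
    rw [Real.log_neg_eq_log, show -z - y = -(z + y) by ring, Real.log_neg_eq_log,
      Complex.ofReal_log (x := z + y) (by linarith)]
    push_cast
    ring_nf
  have h := ((h1.sub h2').const_mul (((y : ℂ) - p)⁻¹ ^ 2)).sub
    ((tendsto_inv_sub_atBot p).const_mul (((y : ℂ) - p)⁻¹))
  simp only [sub_zero, mul_zero] at h
  refine h.congr fun z => ?_
  simp [hilbertPrimitive]

/-- The cancellation of the principal value: `log |ε|` occurs at both ends and drops out, leaving a
continuous function of `ε` that vanishes at zero. -/
theorem tendsto_hilbertPrimitive_sub (y : ℝ) {p : ℂ} (hp : p.im ≠ 0) :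
    Tendsto (fun ε : ℝ => hilbertPrimitive y p (y - ε) - hilbertPrimitive y p (y + ε))
      (𝓝[>] 0) (𝓝 0) := by
  have hne : ∀ z : ℝ, (z : ℂ) - p ≠ 0 := sub_ne_zero_of_im_ne_zero hp
  have hslit : ∀ z : ℝ, (z : ℂ) - p ∈ Complex.slitPlane := by
    intro z
    right
    simpa using hp
  have hc : Continuous (fun z : ℝ => ((y : ℂ) - p)⁻¹ ^ 2 * Complex.log ((z : ℂ) - p) -
      ((y : ℂ) - p)⁻¹ * ((z : ℂ) - p)⁻¹) := by
    refine Continuous.sub (continuous_const.mul ?_) (continuous_const.mul ?_)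
    · exact Continuous.clog (by fun_prop) hslit
    · exact Continuous.inv₀ (by fun_prop) hne
  have hc2 : Continuous (fun ε : ℝ => (((y : ℂ) - p)⁻¹ ^ 2 * Complex.log (((y - ε : ℝ) : ℂ) - p) -
      ((y : ℂ) - p)⁻¹ * (((y - ε : ℝ) : ℂ) - p)⁻¹) -
      (((y : ℂ) - p)⁻¹ ^ 2 * Complex.log (((y + ε : ℝ) : ℂ) - p) -
      ((y : ℂ) - p)⁻¹ * (((y + ε : ℝ) : ℂ) - p)⁻¹)) :=
    (hc.comp (continuous_const.sub continuous_id)).sub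
      (hc.comp (continuous_const.add continuous_id))
  have h := (hc2.tendsto 0).mono_left (nhdsWithin_le_nhds (s := Set.Ioi 0))
  simp only [sub_zero, add_zero, sub_self] at h
  refine h.congr fun ε => ?_
  simp only [hilbertPrimitive, sub_sub_cancel_left, add_sub_cancel_left, Real.log_neg_eq_log]
  ring

/-- The fundamental theorem of calculus is applied on the two half lines. The boundary terms at `y ±
ε` cancel in the limit and the one at `+∞` is zero, so only the one at `-∞` remains. -/
theorem tendsto_integral_rational {E : Type*} [NormedAddCommGroup E] [NormedSpace ℂ E]
    [CompleteSpace E] {ι : Type*} [Fintype ι] {p : ι → ℂ} (hp : ∀ a, (p a).im ≠ 0) (c : ι → E)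
    (y : ℝ) {u : ℝ → E} (hu : ∀ z : ℝ, u z = ∑ a, ((z : ℂ) - p a)⁻¹ ^ 2 • c a)
    (hint : ∀ ε : ℝ, 0 < ε → IntegrableOn (fun z => (y - z)⁻¹ • u z) {z | ε < |y - z|}) :
    Tendsto (fun ε : ℝ => ∫ z in {z | ε < |y - z|}, (y - z)⁻¹ • u z) (𝓝[>] 0)
      (𝓝 (∑ a, (((y : ℂ) - p a)⁻¹ ^ 2 *
        ((SignType.sign (p a).im : ℝ) * (Real.pi * Complex.I))) • c a)) := by
  set F : ℝ → E := fun z => ∑ a, hilbertPrimitive y (p a) z • c a with hF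
  have hderiv : ∀ z, z ≠ y → HasDerivAt F ((y - z)⁻¹ • u z) z := by
    intro z hz
    have : HasDerivAt F (∑ a, (((y : ℂ) - z)⁻¹ * ((z : ℂ) - p a)⁻¹ ^ 2) • c a) z :=
      HasDerivAt.fun_sum fun a _ => (hasDerivAt_hilbertPrimitive (hp a) hz).smul_const (c a)
    convert this using 1
    rw [hu, Finset.smul_sum]
    refine Finset.sum_congr rfl fun a _ => ?_
    rw [← smul_smul, ← Complex.ofReal_sub, ← Complex.ofReal_inv, Complex.coe_smul]
  have htop : Tendsto F atTop (𝓝 0) := by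
    have := tendsto_finsetSum Finset.univ
      fun a _ => (tendsto_hilbertPrimitive_atTop y (p a)).smul_const (c a)
    simpa using this
  have hbot := tendsto_finsetSum Finset.univ
      fun a _ => (tendsto_hilbertPrimitive_atBot y (hp a)).smul_const (c a)
  have hset : ∀ ε : ℝ, 0 < ε →
      {z : ℝ | ε < |y - z|} = Set.Iio (y - ε) ∪ Set.Ioi (y + ε) := by
    intro ε hε
    ext z
    simp only [Set.mem_ofPred_eq, Set.mem_union, Set.mem_Iio, Set.mem_Ioi, lt_abs]
    constructor
    · rintro (h | h)
      · left; linarith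
      · right; linarith
    · rintro (h | h)
      · left; linarith
      · right; linarith
  have hval : ∀ ε : ℝ, 0 < ε → ∫ z in {z | ε < |y - z|}, (y - z)⁻¹ • u z =
      ∑ a, (hilbertPrimitive y (p a) (y - ε) - hilbertPrimitive y (p a) (y + ε)) • c a -
        ∑ a, (((y : ℂ) - p a)⁻¹ ^ 2 *
          (-(SignType.sign (p a).im : ℝ) * (Real.pi * Complex.I))) • c a := by
    intro ε hε
    have hi := hint ε hε
    rw [hset ε hε] at hi ⊢
    have hi1 := hi.mono_set (Set.subset_union_left)
    have hi2 := hi.mono_set (Set.subset_union_right)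
    rw [setIntegral_union (Set.disjoint_left.2 fun z hz hz' => by
      simp only [Set.mem_Iio, Set.mem_Ioi] at hz hz'; linarith) measurableSet_Ioi hi1 hi2,
      integral_Ioi_of_hasDerivAt_of_tendsto'
        (fun z hz => hderiv z (by simp only [Set.mem_Ici] at hz; intro h; linarith)) hi2 htop,
      ← integral_Iic_eq_integral_Iio,
      integral_Iic_of_hasDerivAt_of_tendsto'
        (fun z hz => hderiv z (by simp only [Set.mem_Iic] at hz; intro h; linarith))
        ((integrableOn_Iic_iff_integrableOn_Iio).2 hi1) hbot]
    simp only [hF, sub_smul, Finset.sum_sub_distrib]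
    abel
  have hlim := (tendsto_finsetSum Finset.univ
    fun a _ => (tendsto_hilbertPrimitive_sub y (hp a)).smul_const (c a)).sub_const
      (∑ a, (((y : ℂ) - p a)⁻¹ ^ 2 *
        (-(SignType.sign (p a).im : ℝ) * (Real.pi * Complex.I))) • c a)
  simp only [zero_smul, Finset.sum_const_zero, zero_sub, neg_mul, mul_neg, neg_smul,
    Finset.sum_neg_distrib, neg_neg] at hlim
  refine hlim.congr' ?_
  filter_upwards [self_mem_nhdsWithin] with ε hε
  rw [hval ε hε]
  simp

/-! ### Products of rational functions with values in an algebra -/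

section Algebra

variable {ι : Type*} [Fintype ι] {𝔸 : Type*} [Ring 𝔸] [Algebra ℂ 𝔸]

/-- The regular part at the pole `z a` of `M₀ + ∑ b, S b / (y - z b)`. -/
def regularPart (M₀ : 𝔸) (z : ι → ℂ) (S : ι → 𝔸) (a : ι) : 𝔸 :=
  M₀ + ∑ b, (z a - z b)⁻¹ • S b

/-- The sum `∑ b, w b S b / (z a - z b) ^ 2` over the `b` with `z b ≠ z a`. -/
def weightedSquareSum (w : ι → ℂ) (z : ι → ℂ) (S : ι → 𝔸) (a : ι) : 𝔸 :=
  ∑ b, (w b * (z a - z b)⁻¹ ^ 2) • S b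

theorem inv_mul_inv_of_ne {y a b : ℂ} (ha : y - a ≠ 0) (hb : y - b ≠ 0) (hab : a ≠ b) :
    (y - a)⁻¹ * (y - b)⁻¹ = (a - b)⁻¹ * ((y - a)⁻¹ - (y - b)⁻¹) := by
  have := sub_ne_zero.2 hab
  field_simp
  ring

theorem inv_mul_inv_sq_of_ne {y a b : ℂ} (ha : y - a ≠ 0) (hb : y - b ≠ 0) (hab : a ≠ b) :
    (y - a)⁻¹ * (y - b)⁻¹ ^ 2 =
      (a - b)⁻¹ ^ 2 * ((y - a)⁻¹ - (y - b)⁻¹) - (a - b)⁻¹ * (y - b)⁻¹ ^ 2 := by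
  have := sub_ne_zero.2 hab
  field_simp
  ring

/-- Products at distinct poles split by partial fractions; equal indices give the double poles. The
convention `0⁻¹ = 0` removes the term `b = a` from `regularPart`. -/
theorem rational_mul_self (M₀ : 𝔸) {z : ι → ℂ} (hz : Function.Injective z) (S : ι → 𝔸) {y : ℂ}
    (hy : ∀ a, y - z a ≠ 0) :
    (M₀ + ∑ a, (y - z a)⁻¹ • S a) * (M₀ + ∑ a, (y - z a)⁻¹ • S a) =
      M₀ * M₀ + ∑ a, ((y - z a)⁻¹ • (S a * regularPart M₀ z S a + regularPart M₀ z S a * S a) +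
        (y - z a)⁻¹ ^ 2 • (S a * S a)) := by
  classical
  have key : (∑ a, (y - z a)⁻¹ • S a) * (∑ a, (y - z a)⁻¹ • S a) =
      ∑ a, ((y - z a)⁻¹ • ∑ b, (z a - z b)⁻¹ • (S a * S b + S b * S a) +
        (y - z a)⁻¹ ^ 2 • (S a * S a)) := by
    have h1 : ∀ a b, ((y - z a)⁻¹ • S a) * ((y - z b)⁻¹ • S b) =
        (if a = b then (y - z a)⁻¹ ^ 2 • (S a * S b) else 0) +
        (((y - z a)⁻¹ * (z a - z b)⁻¹) • (S a * S b) +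
          ((y - z b)⁻¹ * (z b - z a)⁻¹) • (S a * S b)) := by
      intro a b
      rw [smul_mul_smul_comm]
      by_cases hab : a = b
      · subst hab
        simp [pow_two]
      · rw [inv_mul_inv_of_ne (hy a) (hy b) (hz.ne hab), if_neg hab, ← add_smul, zero_add,
          ← neg_sub (z a) (z b), inv_neg]
        ring_nf
    rw [Finset.sum_mul_sum]
    simp only [h1, Finset.sum_add_distrib]
    rw [Finset.sum_comm (f := fun a b => ((y - z b)⁻¹ * (z b - z a)⁻¹) • (S a * S b))]
    simp only [Finset.sum_ite_eq, Finset.mem_univ, if_true, smul_add, Finset.smul_sum, smul_smul,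
      Finset.sum_add_distrib]
    abel
  rw [add_mul, mul_add, mul_add, key]
  simp only [regularPart, mul_add, add_mul, smul_add, Finset.sum_add_distrib, Finset.mul_sum,
    Finset.sum_mul, mul_smul_comm, smul_mul_assoc]
  abel

/-- No triple pole appears, since `S a` commutes with itself. The remaining products split by
partial fractions, and renaming the indices collects everything at the pole `z a`. -/
theorem rational_commutator (M₀ : 𝔸) {z : ι → ℂ} (hz : Function.Injective z) (r : ι → ℂ)
    (S : ι → 𝔸) {y : ℂ} (hy : ∀ a, y - z a ≠ 0) :
    (M₀ + ∑ a, (y - z a)⁻¹ • S a) * (∑ b, (r b * (y - z b)⁻¹ ^ 2) • S b) -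
      (∑ b, (r b * (y - z b)⁻¹ ^ 2) • S b) * (M₀ + ∑ a, (y - z a)⁻¹ • S a) =
      ∑ a, ((y - z a)⁻¹ • (S a * (r a • weightedSquareSum 1 z S a + weightedSquareSum r z S a) -
          (r a • weightedSquareSum 1 z S a + weightedSquareSum r z S a) * S a) +
        (y - z a)⁻¹ ^ 2 • r a • (regularPart M₀ z S a * S a - S a * regularPart M₀ z S a)) := by
  have key : (∑ a, (y - z a)⁻¹ • S a) * (∑ b, (r b * (y - z b)⁻¹ ^ 2) • S b) -
      (∑ b, (r b * (y - z b)⁻¹ ^ 2) • S b) * (∑ a, (y - z a)⁻¹ • S a) =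
      ∑ a, ∑ b, (((y - z a)⁻¹ * (r a + r b) * (z a - z b)⁻¹ ^ 2) • (S a * S b - S b * S a) +
        ((y - z a)⁻¹ ^ 2 * r a * (z a - z b)⁻¹) • (S b * S a - S a * S b)) := by
    have h1 : ∀ a b, ((y - z a)⁻¹ • S a) * ((r b * (y - z b)⁻¹ ^ 2) • S b) -
        ((r b * (y - z b)⁻¹ ^ 2) • S b) * ((y - z a)⁻¹ • S a) =
        ((y - z a)⁻¹ * r b * (z a - z b)⁻¹ ^ 2) • (S a * S b - S b * S a) +
        (((y - z b)⁻¹ * r b * (z b - z a)⁻¹ ^ 2) • (S b * S a - S a * S b) +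
          ((y - z b)⁻¹ ^ 2 * r b * (z b - z a)⁻¹) • (S a * S b - S b * S a)) := by
      intro a b
      rw [smul_mul_smul_comm, smul_mul_smul_comm, mul_comm (r b * (y - z b)⁻¹ ^ 2) (y - z a)⁻¹,
        ← smul_sub]
      by_cases hab : a = b
      · subst hab
        simp
      · rw [show (y - z a)⁻¹ * (r b * (y - z b)⁻¹ ^ 2) = r b * ((y - z a)⁻¹ * (y - z b)⁻¹ ^ 2) by
          ring, inv_mul_inv_sq_of_ne (hy a) (hy b) (hz.ne hab), ← neg_sub (z a) (z b), inv_neg,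
          ← neg_sub (S a * S b), smul_neg, ← neg_smul, ← add_smul, ← add_smul]
        ring_nf
    rw [Finset.sum_mul_sum, Finset.sum_mul_sum, Finset.sum_comm
      (f := fun i j => (r i * (y - z i)⁻¹ ^ 2) • S i * (y - z j)⁻¹ • S j)]
    simp only [← Finset.sum_sub_distrib, h1]
    simp only [Finset.sum_add_distrib]
    rw [Finset.sum_comm (f := fun a b =>
      ((y - z b)⁻¹ * r b * (z b - z a)⁻¹ ^ 2) • (S b * S a - S a * S b)),
      Finset.sum_comm (f := fun a b =>
      ((y - z b)⁻¹ ^ 2 * r b * (z b - z a)⁻¹) • (S a * S b - S b * S a)), ← add_assoc]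
    congr 1
    simp only [← Finset.sum_add_distrib, ← add_smul]
    refine Finset.sum_congr rfl fun a _ => Finset.sum_congr rfl fun b _ => ?_
    congr 1
    ring
  rw [add_mul, mul_add, add_sub_add_comm, key]
  simp only [regularPart, weightedSquareSum, Pi.one_apply, mul_add, add_mul, smul_add, smul_sub,
    Finset.sum_add_distrib, Finset.sum_sub_distrib, Finset.mul_sum, Finset.smul_sum,
    Finset.sum_mul, mul_smul_comm, smul_mul_assoc, smul_smul, add_smul, mul_add, one_mul]
  ring_nf
  simp only [mul_comm, mul_left_comm, mul_assoc]
  abel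

end Algebra

/-! ### Pauli matrices -/

/-- The matrix `u · σ` of a complex three-vector `u`, with `σ` the Pauli matrices. -/
def pauli : C3 →ₗ[ℂ] Matrix (Fin 2) (Fin 2) ℂ where
  toFun u := !![u 2, u 0 - Complex.I * u 1; u 0 + Complex.I * u 1, -u 2]
  map_add' u w := by
    ext i j
    fin_cases i <;> fin_cases j <;> simp <;> ring
  map_smul' c u := by
    ext i j
    fin_cases i <;> fin_cases j <;> simp <;> ring

theorem pauli_apply (u : C3) :
    pauli u = !![u 2, u 0 - Complex.I * u 1; u 0 + Complex.I * u 1, -u 2] := rfl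

theorem pauli_injective : Function.Injective pauli := by
  rw [injective_iff_map_eq_zero]
  intro u hu
  rw [pauli_apply] at hu
  have h00 := congrFun (congrFun hu 0) 0
  have h01 := congrFun (congrFun hu 0) 1
  have h10 := congrFun (congrFun hu 1) 0
  simp at h00 h01 h10
  have h0 : u 0 = 0 := by linear_combination (h01 + h10) / 2
  have h1 : Complex.I * u 1 = 0 := by linear_combination (h10 - h01) / 2
  have h1' : u 1 = 0 := (mul_eq_zero.1 h1).resolve_left Complex.I_ne_zero
  ext i
  fin_cases i <;> simp [h00, h0, h1']

theorem pauli_conjC (u : C3) : pauli (conjC u) = (pauli u)ᴴ := by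
  ext i j
  fin_cases i <;> fin_cases j <;> simp [pauli_apply, conjC, Matrix.conjTranspose_apply]
  ring

theorem pauli_mul_self (u : C3) :
    pauli u * pauli u = (u 0 ^ 2 + u 1 ^ 2 + u 2 ^ 2) • (1 : Matrix (Fin 2) (Fin 2) ℂ) := by
  ext i j
  fin_cases i <;> fin_cases j <;>
    simp [pauli_apply, Matrix.mul_apply, Fin.sum_univ_two] <;>
    ring_nf <;> simp only [Complex.I_sq] <;> ring

theorem pauli_toC_mul_self (u : R3) :
    pauli (toC u) * pauli (toC u) = ((‖u‖ : ℂ) ^ 2) • (1 : Matrix (Fin 2) (Fin 2) ℂ) := by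
  rw [pauli_mul_self]
  congr 1
  have := EuclideanSpace.real_norm_sq_eq u
  rw [Fin.sum_univ_three] at this
  rw [← Complex.ofReal_pow, this]
  simp [toC]

/-- This is `[u · σ, w · σ] = 2i (u × w) · σ`. -/
theorem pauli_toC_cross (u w : R3) :
    pauli (toC (cross u w)) =
      (-(Complex.I / 2)) • (pauli (toC u) * pauli (toC w) - pauli (toC w) * pauli (toC u)) := by
  ext i j
  fin_cases i <;> fin_cases j <;>
    simp [pauli_apply, toC, cross, cross_apply] <;>
    ring_nf <;> simp only [Complex.I_sq] <;> ring_nf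

/-- `toC` as a continuous linear map. -/
def toCL : R3 →L[ℝ] C3 :=
  LinearMap.toContinuousLinearMap
    { toFun := toC
      map_add' := fun u w => by ext i; simp [toC]
      map_smul' := fun c u => by ext i; simp [toC] }

theorem toCL_apply (u : R3) : toCL u = toC u := rfl

/-- `conjC` as a continuous linear map. -/
def conjL : C3 →L[ℝ] C3 :=
  LinearMap.toContinuousLinearMap
    { toFun := conjC
      map_add' := fun u w => by ext i; simp [conjC]
      map_smul' := fun c u => by ext i; simp [conjC] }

theorem conjL_apply (u : C3) : conjL u = conjC u := rfl

theorem conjC_ne_zero {u : C3} (hu : u ≠ 0) : conjC u ≠ 0 := by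
  contrapose! hu
  ext i
  have := congrArg (fun w : C3 => w i) hu
  simpa [conjC] using this

/-! ### The poles and spins of a rational solution as a single family -/

/-- The poles `x j` and their conjugates. -/
def allPoles {N : ℕ} (x : Fin N → ℝ → ℂ) : Fin N ⊕ Fin N → ℝ → ℂ :=
  Sum.elim x fun j t => conj (x j t)

/-- The spins `s j` and their conjugates. -/
def allSpins {N : ℕ} (s : Fin N → ℝ → C3) : Fin N ⊕ Fin N → ℝ → C3 :=
  Sum.elim s fun j t => conjC (s j t)

/-- The sign of the imaginary part of the poles. -/
def poleSign {N : ℕ} : Fin N ⊕ Fin N → ℂ := Sum.elim 1 (-1)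

theorem rationalProfile_eq_sum {N : ℕ} (m₀ : R3) (s : Fin N → ℝ → C3) (x : Fin N → ℝ → ℂ)
    (t y : ℝ) :
    rationalProfile m₀ (fun j => s j t) (fun j => x j t) y =
      toC m₀ + ∑ a, ((y : ℂ) - allPoles x a t)⁻¹ • allSpins s a t := by
  simp [rationalProfile, Fintype.sum_sum_type, allPoles, allSpins, add_assoc]

theorem hasDerivAt_inv_sub {p : ℂ} (hp : p.im ≠ 0) (y : ℝ) :
    HasDerivAt (fun z : ℝ => ((z : ℂ) - p)⁻¹) (-((y : ℂ) - p)⁻¹ ^ 2) y := by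
  have hlin : HasDerivAt (fun z : ℝ => (z : ℂ) - p) 1 y :=
    (Complex.ofRealCLM.hasDerivAt (x := y)).sub_const p
  refine (hlin.fun_inv (sub_ne_zero_of_im_ne_zero hp y)).congr_deriv ?_
  rw [inv_pow, neg_div, one_div]

namespace IsRationalSolution

variable {N : ℕ} {I : Set ℝ} {m : ℝ → ℝ → R3} {m₀ : R3} {s : Fin N → ℝ → C3}
  {x : Fin N → ℝ → ℂ}

theorem allPoles_im_ne_zero (hm : IsRationalSolution I m m₀ s x) {t : ℝ} (ht : t ∈ I)
    (a : Fin N ⊕ Fin N) : (allPoles x a t).im ≠ 0 := by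
  rcases a with j | j
  · exact (hm.im_pos t ht j).ne'
  · simpa [allPoles] using (hm.im_pos t ht j).ne'

theorem sign_allPoles_im (hm : IsRationalSolution I m m₀ s x) {t : ℝ} (ht : t ∈ I)
    (a : Fin N ⊕ Fin N) : (((SignType.sign (allPoles x a t).im : ℝ)) : ℂ) = poleSign a := by
  rcases a with j | j
  · simp [allPoles, poleSign, sign_pos (hm.im_pos t ht j)]
  · simp [allPoles, poleSign, Left.sign_neg, sign_pos (hm.im_pos t ht j)]

theorem allPoles_injective (hm : IsRationalSolution I m m₀ s x) {t : ℝ} (ht : t ∈ I) :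
    Function.Injective fun a => allPoles x a t := by
  have hinj := hm.poles_distinct t ht
  rintro (j | j) (k | k) h
  · exact congrArg _ (hinj h)
  · have h1 := hm.im_pos t ht j
    have h2 := hm.im_pos t ht k
    have := congrArg Complex.im h
    simp [allPoles] at this
    linarith
  · have h1 := hm.im_pos t ht j
    have h2 := hm.im_pos t ht k
    have := congrArg Complex.im h
    simp [allPoles] at this
    linarith
  · refine congrArg _ (hinj ?_)
    exact (starRingEnd ℂ).injective h

theorem allSpins_ne_zero (hm : IsRationalSolution I m m₀ s x) {t : ℝ} (ht : t ∈ I)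
    (a : Fin N ⊕ Fin N) : allSpins s a t ≠ 0 := by
  rcases a with j | j
  · exact hm.spin_ne_zero t ht j
  · exact conjC_ne_zero (hm.spin_ne_zero t ht j)

theorem differentiableAt_allPoles (hm : IsRationalSolution I m m₀ s x) {t : ℝ} (ht : t ∈ I)
    (a : Fin N ⊕ Fin N) : DifferentiableAt ℝ (allPoles x a) t := by
  rcases a with j | j
  · exact hm.differentiableAt_pole t ht j
  · exact (Complex.conjCLE.toContinuousLinearMap.hasFDerivAt.comp_hasDerivAt t
      (hm.differentiableAt_pole t ht j).hasDerivAt).differentiableAt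

theorem differentiableAt_allSpins (hm : IsRationalSolution I m m₀ s x) {t : ℝ} (ht : t ∈ I)
    (a : Fin N ⊕ Fin N) : DifferentiableAt ℝ (allSpins s a) t := by
  rcases a with j | j
  · exact hm.differentiableAt_spin t ht j
  · exact (conjL.hasFDerivAt.comp_hasDerivAt t
      (hm.differentiableAt_spin t ht j).hasDerivAt).differentiableAt

theorem toC_eq (hm : IsRationalSolution I m m₀ s x) {t : ℝ} (ht : t ∈ I) (y : ℝ) :
    toC (m t y) = toC m₀ + ∑ a, ((y : ℂ) - allPoles x a t)⁻¹ • allSpins s a t := by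
  rw [hm.representation t ht y, rationalProfile_eq_sum]

theorem toC_deriv (hm : IsRationalSolution I m m₀ s x) {t : ℝ} (ht : t ∈ I) (y : ℝ) :
    toC (deriv (m t) y) =
      ∑ a, ((y : ℂ) - allPoles x a t)⁻¹ ^ 2 • (-allSpins s a t) := by
  have h1 : HasDerivAt (fun y => toC (m t y)) (toC (deriv (m t) y)) y :=
    toCL.hasFDerivAt.comp_hasDerivAt y (hm.halfWaveMap.differentiable t ht y).hasDerivAt
  have h2 : HasDerivAt (fun y : ℝ => toC m₀ + ∑ a, ((y : ℂ) - allPoles x a t)⁻¹ • allSpins s a t)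
      (∑ a, (-((y : ℂ) - allPoles x a t)⁻¹ ^ 2) • allSpins s a t) y :=
    (HasDerivAt.fun_sum fun a _ =>
      (hasDerivAt_inv_sub (hm.allPoles_im_ne_zero ht a) y).smul_const _).const_add _
  rw [show (fun y => toC (m t y)) = _ from funext fun y => hm.toC_eq ht y] at h1
  rw [h1.unique h2]
  simp

/-- The Hilbert transform multiplies the part of the derivative with upper poles by `i` and the part
with lower poles by `-i`; the remaining minus sign is that of `-allSpins` in `toC_deriv`. -/
theorem toC_hilbertTransform (hm : IsRationalSolution I m m₀ s x) {t : ℝ} (ht : t ∈ I) {y : ℝ}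
    {h : R3} (hh : HasHilbertTransformAt (deriv (m t)) h y) :
    toC h = (-Complex.I) • ∑ a, (poleSign a * ((y : ℂ) - allPoles x a t)⁻¹ ^ 2) •
      allSpins s a t := by
  have hint : ∀ ε : ℝ, 0 < ε →
      IntegrableOn (fun z => (y - z)⁻¹ • toC (deriv (m t) z)) {z | ε < |y - z|} := by
    intro ε hε
    have := toCL.integrable_comp (hh.1 ε hε)
    simpa only [map_smul, toCL_apply] using! this
  have h1 := (tendsto_integral_rational (hm.allPoles_im_ne_zero ht) (fun a => -allSpins s a t) y
    (fun z => hm.toC_deriv ht z) hint).const_smul (Real.pi⁻¹)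
  have h2 := (toCL.continuous.tendsto h).comp hh.2
  have h3 : Tendsto (fun ε : ℝ =>
      Real.pi⁻¹ • ∫ z in {z | ε < |y - z|}, (y - z)⁻¹ • toC (deriv (m t) z)) (𝓝[>] 0)
      (𝓝 (toC h)) := by
    refine h2.congr' ?_
    filter_upwards [self_mem_nhdsWithin] with ε hε
    simp only [Function.comp_apply, map_smul]
    rw [← toCL.integral_comp_comm (hh.1 ε hε)]
    simp only [map_smul, toCL_apply]
  rw [tendsto_nhds_unique h3 h1, Finset.smul_sum, Finset.smul_sum]
  refine Finset.sum_congr rfl fun a _ => ?_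
  rw [hm.sign_allPoles_im ht, ← Complex.coe_smul, smul_smul, smul_smul, smul_neg, ← neg_smul]
  congr 1
  have : (Real.pi : ℂ) ≠ 0 := by exact_mod_cast Real.pi_ne_zero
  push_cast
  field_simp

/-- The time side of the equation: pole velocities sit at the double poles, spin derivatives at the
simple ones. -/
theorem toC_cross (hm : IsRationalSolution I m m₀ s x) {t : ℝ} (ht : t ∈ I) (hI : IsOpen I)
    {y : ℝ} {w : R3} (hw : HasDerivAt (fun τ => m τ y) w t) :
    toC w = ∑ a, (((y : ℂ) - allPoles x a t)⁻¹ • deriv (allSpins s a) t +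
      (((y : ℂ) - allPoles x a t)⁻¹ ^ 2 * deriv (allPoles x a) t) • allSpins s a t) := by
  have h1 : HasDerivAt (fun τ => toC (m τ y)) (toC w) t := toCL.hasFDerivAt.comp_hasDerivAt t hw
  have h2 : HasDerivAt (fun τ : ℝ => toC m₀ +
      ∑ a, ((y : ℂ) - allPoles x a τ)⁻¹ • allSpins s a τ)
      (∑ a, (((y : ℂ) - allPoles x a t)⁻¹ • deriv (allSpins s a) t +
      (((y : ℂ) - allPoles x a t)⁻¹ ^ 2 * deriv (allPoles x a) t) • allSpins s a t)) t := by
    refine (HasDerivAt.fun_sum fun a _ => ?_).const_add _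
    have hp := ((hm.differentiableAt_allPoles ht a).hasDerivAt.const_sub (y : ℂ)).fun_inv
      (sub_ne_zero_of_im_ne_zero (hm.allPoles_im_ne_zero ht a) y)
    refine (hp.smul (hm.differentiableAt_allSpins ht a).hasDerivAt).congr_deriv ?_
    congr 2
    rw [neg_neg, div_eq_mul_inv, inv_pow, mul_comm]
  refine h1.unique (h2.congr_of_eventuallyEq ?_)
  filter_upwards [hI.mem_nhds ht] with τ hτ using hm.toC_eq hτ y

end IsRationalSolution

/-! ### The equations of motion of the poles and spins -/

/-- The poles `z a` (with sign `r a = ± 1`) and residues `S a` of a solution of the half-wave maps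
equation in an algebra, together with their equations of motion. -/
structure IsPoleSystem {ι : Type*} [Fintype ι] {𝔸 : Type*} [NormedRing 𝔸] [NormedAlgebra ℂ 𝔸]
    (I : Set ℝ) (M₀ : 𝔸) (r : ι → ℂ) (z : ι → ℝ → ℂ) (S : ι → ℝ → 𝔸) : Prop where
  sign_sq : ∀ a, r a * r a = 1
  injective : ∀ t ∈ I, Function.Injective fun a => z a t
  ne_zero : ∀ t ∈ I, ∀ a, S a t ≠ 0
  mul_self : ∀ t ∈ I, ∀ a, S a t * S a t = 0
  anticommute : ∀ t ∈ I, ∀ a, S a t * regularPart M₀ (fun b => z b t) (fun b => S b t) a +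
    regularPart M₀ (fun b => z b t) (fun b => S b t) a * S a t = 0
  differentiableAt : ∀ t ∈ I, ∀ a, DifferentiableAt ℝ (z a) t
  pole_equation : ∀ t ∈ I, ∀ a, deriv (z a) t • S a t =
    r a • (S a t * regularPart M₀ (fun b => z b t) (fun b => S b t) a)
  spin_equation : ∀ t ∈ I, ∀ a, HasDerivAt (S a)
    ((1 / 2 : ℂ) •
      ((r a • weightedSquareSum 1 (fun b => z b t) (fun b => S b t) a +
          weightedSquareSum r (fun b => z b t) (fun b => S b t) a) * S a t -
        S a t * (r a • weightedSquareSum 1 (fun b => z b t) (fun b => S b t) a +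
          weightedSquareSum r (fun b => z b t) (fun b => S b t) a))) t

theorem partialFraction_matrix_eq_zero {ι : Type*} [Fintype ι] [DecidableEq ι] {n : Type*}
    {z : ι → ℂ} (hz : Function.Injective z) (hzi : ∀ a, (z a).im ≠ 0) {c : Matrix n n ℂ}
    {α β : ι → Matrix n n ℂ}
    (h : ∀ y : ℝ, c + ∑ a, (((y : ℂ) - z a)⁻¹ • α a + ((y : ℂ) - z a)⁻¹ ^ 2 • β a) = 0) :
    c = 0 ∧ (∀ a, α a = 0) ∧ ∀ a, β a = 0 := by
  have key := fun p q => partialFraction_eq_zero hz hzi (c := c p q) (α := fun a => α a p q)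
    (β := fun a => β a p q) (fun y => by
      have := congrFun (congrFun (h y) p) q
      simpa [Matrix.sum_apply] using this)
  refine ⟨?_, fun a => ?_, fun a => ?_⟩
  · ext p q; exact (key p q).1
  · ext p q; exact (key p q).2.1 a
  · ext p q; exact (key p q).2.2 a

section

attribute [local instance] Matrix.linftyOpNormedRing Matrix.linftyOpNormedAlgebra

/-- The map `pauli` as a continuous real-linear map. -/
def pauliL : C3 →L[ℝ] Matrix (Fin 2) (Fin 2) ℂ :=
  (LinearMap.toContinuousLinearMap pauli).restrictScalars ℝ

/-- In `M ^ 2 = 1` the double poles give nilpotency and the simple poles give anticommutation. In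
the evolution equation the double poles give the velocities and the simple poles give the spin
equation. -/
theorem IsRationalSolution.isPoleSystem {N : ℕ} {I : Set ℝ} {m : ℝ → ℝ → R3} {m₀ : R3}
    {s : Fin N → ℝ → C3} {x : Fin N → ℝ → ℂ} (hm : IsRationalSolution I m m₀ s x)
    (hI : IsOpen I) :
    IsPoleSystem I (pauli (toC m₀)) poleSign (allPoles x) (fun a t => pauli (allSpins s a t)) := by
  have hne : ∀ t ∈ I, ∀ (y : ℝ) a, (y : ℂ) - allPoles x a t ≠ 0 := fun t ht y a =>
    sub_ne_zero_of_im_ne_zero (hm.allPoles_im_ne_zero ht a) y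
  have hM : ∀ t ∈ I, ∀ y : ℝ, pauli (toC (m t y)) = pauli (toC m₀) +
      ∑ a, ((y : ℂ) - allPoles x a t)⁻¹ • pauli (allSpins s a t) := by
    intro t ht y
    rw [hm.toC_eq ht y, map_add, map_sum]
    simp only [map_smul]
  have hsq : ∀ t ∈ I, (∀ a, pauli (allSpins s a t) * regularPart (pauli (toC m₀))
        (fun b => allPoles x b t) (fun b => pauli (allSpins s b t)) a +
      regularPart (pauli (toC m₀)) (fun b => allPoles x b t)
        (fun b => pauli (allSpins s b t)) a * pauli (allSpins s a t) = 0) ∧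
      ∀ a, pauli (allSpins s a t) * pauli (allSpins s a t) = 0 := by
    intro t ht
    refine (partialFraction_matrix_eq_zero (c := pauli (toC m₀) * pauli (toC m₀) - 1)
      (hm.allPoles_injective ht) (hm.allPoles_im_ne_zero ht) fun y => ?_).2
    have h1 := pauli_toC_mul_self (m t y)
    rw [hm.halfWaveMap.sphere t ht y, hM t ht y, rational_mul_self _ (hm.allPoles_injective ht) _
      (hne t ht y)] at h1
    rw [sub_add_eq_add_sub, h1]
    simp
  have hev : ∀ t ∈ I, (∀ a, pauli (deriv (allSpins s a) t) - (1 / 2 : ℂ) •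
      ((poleSign a • weightedSquareSum 1 (fun b => allPoles x b t)
            (fun b => pauli (allSpins s b t)) a +
          weightedSquareSum poleSign (fun b => allPoles x b t)
            (fun b => pauli (allSpins s b t)) a) * pauli (allSpins s a t) -
        pauli (allSpins s a t) * (poleSign a • weightedSquareSum 1 (fun b => allPoles x b t)
            (fun b => pauli (allSpins s b t)) a +
          weightedSquareSum poleSign (fun b => allPoles x b t)
            (fun b => pauli (allSpins s b t)) a)) = 0) ∧
      ∀ a, deriv (allPoles x a) t • pauli (allSpins s a t) - (1 / 2 : ℂ) • poleSign a •
        (pauli (allSpins s a t) * regularPart (pauli (toC m₀))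
          (fun b => allPoles x b t) (fun b => pauli (allSpins s b t)) a -
        regularPart (pauli (toC m₀)) (fun b => allPoles x b t)
          (fun b => pauli (allSpins s b t)) a * pauli (allSpins s a t)) = 0 := by
    intro t ht
    refine (partialFraction_matrix_eq_zero (c := 0)
      (hm.allPoles_injective ht) (hm.allPoles_im_ne_zero ht) fun y => ?_).2
    obtain ⟨h, hh, hd⟩ := hm.halfWaveMap.equation t ht y
    have h1 := congrArg pauli (hm.toC_cross ht hI hd)
    rw [pauli_toC_cross, hm.toC_hilbertTransform ht hh, map_smul, map_sum, hM t ht y] at h1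
    simp only [map_smul] at h1
    rw [mul_smul_comm, smul_mul_assoc, ← smul_sub, smul_smul,
      rational_commutator _ (hm.allPoles_injective ht) _ _ (hne t ht y),
      -- The factor `-i/2` comes from the cross product and `-i` from the Hilbert transform.
      show -(Complex.I / 2) * -Complex.I = -(1 / 2) by
        linear_combination (1 / 2 : ℂ) * Complex.I_sq, map_sum, Finset.smul_sum] at h1
    rw [zero_add, ← sub_eq_zero.2 h1.symm, ← Finset.sum_sub_distrib]
    refine Finset.sum_congr rfl fun a _ => ?_
    rw [map_add, map_smul, map_smul]
    module
  refine ⟨?_, fun t ht => hm.allPoles_injective ht,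
    fun t ht a h => hm.allSpins_ne_zero ht a (pauli_injective (by rw [h, map_zero])),
    fun t ht => (hsq t ht).2, fun t ht => (hsq t ht).1,
    fun t ht => hm.differentiableAt_allPoles ht, fun t ht a => ?_, fun t ht a => ?_⟩
  · rintro (a | a) <;> simp [poleSign]
  -- Anticommutation turns the commutator with the regular part into twice a product, which absorbs
  -- the factor `1/2`.
  · rw [sub_eq_zero.1 ((hev t ht).2 a), eq_neg_of_add_eq_zero_right ((hsq t ht).1 a)]
    module
  · have h1 : HasDerivAt (fun t => pauli (allSpins s a t)) (pauli (deriv (allSpins s a) t)) t :=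
      pauliL.hasFDerivAt.comp_hasDerivAt t (hm.differentiableAt_allSpins ht a).hasDerivAt
    exact h1.congr_deriv (sub_eq_zero.1 ((hev t ht).1 a))

end

/-! ### The second derivative of the poles -/

section Algebra

variable {ι : Type*} [Fintype ι]

/-- Only the part of `κ` with the same symmetry as `T` contributes. Double sums of commutators (`ε =
-1`) or anticommutators (`ε = 1`) can thus be compared through scalar identities for each pair of
indices. -/
theorem sum_sum_smul_congr_of_symm {E : Type*} [AddCommGroup E] [Module ℂ E] (ε : ℂ)
    {T : ι → ι → E} (hT : ∀ b c, T c b = ε • T b c) (hT0 : ∀ b, T b b = 0) {κ κ' : ι → ι → ℂ}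
    (h : ∀ b c, b ≠ c → κ b c + ε * κ c b = κ' b c + ε * κ' c b) :
    ∑ b, ∑ c, κ b c • T b c = ∑ b, ∑ c, κ' b c • T b c := by
  have key : ∀ κ : ι → ι → ℂ, (2 : ℂ) • ∑ b, ∑ c, κ b c • T b c =
      ∑ b, ∑ c, (κ b c + ε * κ c b) • T b c := by
    intro κ
    have h1 : ∑ b, ∑ c, κ b c • T b c = ∑ b, ∑ c, (ε * κ c b) • T b c := by
      rw [Finset.sum_comm]
      refine Finset.sum_congr rfl fun b _ => Finset.sum_congr rfl fun c _ => ?_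
      rw [hT, smul_smul, mul_comm]
    rw [two_smul]
    nth_rewrite 2 [h1]
    simp only [add_smul, Finset.sum_add_distrib]
  refine smul_right_injective E (two_ne_zero : (2 : ℂ) ≠ 0) ?_
  simp only
  rw [key, key]
  refine Finset.sum_congr rfl fun b _ => Finset.sum_congr rfl fun c _ => ?_
  by_cases hbc : b = c
  · subst hbc
    simp [hT0]
  · rw [h b c hbc]

variable {𝔸 : Type*} [Ring 𝔸] [Algebra ℂ 𝔸] {M₀ : 𝔸} {z : ι → ℂ} {S : ι → 𝔸}

/-- Subtracting the vanishing anticommutator of `S b` with its own regular part eliminates `M₀`. In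
the double sum that is left, the terms with three distinct poles cancel, and the row `b = a`
remains. -/
theorem anticommutator_weightedSquareSum (hz : Function.Injective z)
    (hsq : ∀ a, S a * S a = 0)
    (hac : ∀ a, S a * regularPart M₀ z S a + regularPart M₀ z S a * S a = 0) (a : ι) :
    weightedSquareSum 1 z S a * regularPart M₀ z S a +
      regularPart M₀ z S a * weightedSquareSum 1 z S a =
      ∑ b, (z a - z b)⁻¹ ^ 3 • (S a * S b + S b * S a) := by
  classical
  have h1 : ∀ b, S b * regularPart M₀ z S a + regularPart M₀ z S a * S b =
      ∑ c, ((z a - z c)⁻¹ - (z b - z c)⁻¹) • (S b * S c + S c * S b) := by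
    intro b
    rw [← sub_zero (S b * regularPart M₀ z S a + regularPart M₀ z S a * S b), ← hac b]
    simp only [regularPart, mul_add, add_mul, Finset.mul_sum, Finset.sum_mul, mul_smul_comm,
      smul_mul_assoc, sub_smul, Finset.sum_sub_distrib, smul_add, Finset.sum_add_distrib]
    abel
  have h2 : weightedSquareSum 1 z S a * regularPart M₀ z S a +
      regularPart M₀ z S a * weightedSquareSum 1 z S a =
      ∑ b, ∑ c, ((z a - z b)⁻¹ ^ 2 * ((z a - z c)⁻¹ - (z b - z c)⁻¹)) •
        (S b * S c + S c * S b) := by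
    simp only [← smul_smul, ← Finset.smul_sum, ← h1]
    simp only [weightedSquareSum, Finset.mul_sum, Finset.sum_mul, mul_smul_comm, smul_mul_assoc,
      Pi.one_apply, one_mul, smul_add, Finset.sum_add_distrib]
  rw [h2, sum_sum_smul_congr_of_symm 1 (fun b c => by rw [one_smul, add_comm])
    (fun b => by rw [hsq, add_zero]) (κ' := fun b c => if b = a then (z a - z c)⁻¹ ^ 3 else 0)]
  · simp only [ite_smul, zero_smul]
    rw [Finset.sum_eq_single a (fun b _ hb => by simp [hb]) (by simp)]
    simp
  · intro b c hbc
    have hbc' := sub_ne_zero.2 (hz.ne hbc)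
    have hcb' := sub_ne_zero.2 (hz.ne hbc.symm)
    by_cases hb : b = a
    · subst hb
      simp only [sub_self, inv_zero, if_neg hbc.symm, if_true]
      rw [← neg_sub (z b) (z c), inv_neg]
      ring
    · by_cases hc : c = a
      · subst hc
        simp only [sub_self, inv_zero, if_neg hbc, if_true]
        rw [← neg_sub (z b) (z c), inv_neg]
        ring
      · have hab' := sub_ne_zero.2 (hz.ne (Ne.symm hb))
        have hac' := sub_ne_zero.2 (hz.ne (Ne.symm hc))
        simp only [if_neg hb, if_neg hc]
        rw [← neg_sub (z b) (z c)]
        field_simp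
        ring

/-- The left side is the time derivative of the regular part along the flow. Each `D b • S b` is
half a commutator with the regular part at `b`; trading that for the regular part at `a` leaves a
sum of commutators whose three-pole terms cancel. -/
theorem regularPart_derivative (hz : Function.Injective z) {r : ι → ℂ}
    (hac : ∀ a, S a * regularPart M₀ z S a + regularPart M₀ z S a * S a = 0) {D : ι → ℂ}
    (hD : ∀ a, D a • S a = r a • (S a * regularPart M₀ z S a)) (a : ι) :
    ∑ b, ((z a - z b)⁻¹ • (1 / 2 : ℂ) •
        ((r b • weightedSquareSum 1 z S b + weightedSquareSum r z S b) * S b -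
          S b * (r b • weightedSquareSum 1 z S b + weightedSquareSum r z S b)) +
        (-((z a - z b)⁻¹ ^ 2 * (D a - D b))) • S b) =
      (1 / 2 : ℂ) • (weightedSquareSum r z S a * regularPart M₀ z S a -
        regularPart M₀ z S a * weightedSquareSum r z S a) - D a • weightedSquareSum 1 z S a +
      ∑ b, ((r a / 2 + r b) * (z a - z b)⁻¹ ^ 3) • (S a * S b - S b * S a) := by
  classical
  have h0 : ∀ b, D b • S b = (r b / 2) • (S b * regularPart M₀ z S b -
      regularPart M₀ z S b * S b) := by
    intro b
    rw [hD, eq_neg_of_add_eq_zero_right (hac b)]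
    module
  have h1 : ∀ b, D b • S b = (r b / 2) • (S b * regularPart M₀ z S a -
      regularPart M₀ z S a * S b) +
      ∑ c, (r b / 2 * ((z b - z c)⁻¹ - (z a - z c)⁻¹)) • (S b * S c - S c * S b) := by
    intro b
    rw [h0]
    simp only [regularPart, mul_add, add_mul, Finset.mul_sum, Finset.sum_mul, mul_smul_comm,
      smul_mul_assoc, sub_smul, Finset.sum_sub_distrib, smul_add, smul_sub,
      mul_sub, ← smul_smul, ← Finset.smul_sum]
    abel
  have h2 : ∀ b, (z a - z b)⁻¹ • (1 / 2 : ℂ) •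
        ((r b • weightedSquareSum 1 z S b + weightedSquareSum r z S b) * S b -
          S b * (r b • weightedSquareSum 1 z S b + weightedSquareSum r z S b)) =
      ∑ c, (-((z a - z b)⁻¹ * (r b + r c) / 2 * (z b - z c)⁻¹ ^ 2)) • (S b * S c - S c * S b) := by
    intro b
    simp only [weightedSquareSum, mul_add, add_mul, Finset.mul_sum, Finset.sum_mul,
      mul_smul_comm, smul_mul_assoc, Finset.smul_sum, smul_smul, ← Finset.sum_add_distrib,
      ← Finset.sum_sub_distrib, Pi.one_apply]
    refine Finset.sum_congr rfl fun c _ => ?_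
    module
  have h3 : ∀ b, (-((z a - z b)⁻¹ ^ 2 * (D a - D b))) • S b =
      -(D a • ((z a - z b)⁻¹ ^ 2 • S b)) + (z a - z b)⁻¹ ^ 2 • (D b • S b) := by
    intro b
    module
  have h4 := sum_sum_smul_congr_of_symm (-1) (T := fun b c => S b * S c - S c * S b)
    (fun b c => by simp) (fun b => sub_self _)
    (κ := fun b c => -((z a - z b)⁻¹ * (r b + r c) / 2 * (z b - z c)⁻¹ ^ 2) +
      (z a - z b)⁻¹ ^ 2 * (r b / 2 * ((z b - z c)⁻¹ - (z a - z c)⁻¹)))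
    (κ' := fun b c => if b = a then (r a / 2 + r c) * (z a - z c)⁻¹ ^ 3 else 0) (by
      intro b c hbc
      have hbc' := sub_ne_zero.2 (hz.ne hbc)
      by_cases hb : b = a
      · subst hb
        simp only [sub_self, inv_zero, if_neg hbc.symm, if_true]
        rw [← neg_sub (z b) (z c), inv_neg]
        ring
      · by_cases hc : c = a
        · subst hc
          simp only [sub_self, inv_zero, if_neg hbc, if_true]
          rw [← neg_sub (z b) (z c), inv_neg]
          ring
        · have hab' := sub_ne_zero.2 (hz.ne (Ne.symm hb))
          have hac' := sub_ne_zero.2 (hz.ne (Ne.symm hc))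
          simp only [if_neg hb, if_neg hc]
          rw [← neg_sub (z b) (z c)]
          field_simp
          ring)
  have h5 : ∑ b, ∑ c, (if b = a then (r a / 2 + r c) * (z a - z c)⁻¹ ^ 3 else 0) •
      (S b * S c - S c * S b) =
      ∑ b, ((r a / 2 + r b) * (z a - z b)⁻¹ ^ 3) • (S a * S b - S b * S a) := by
    simp only [ite_smul, zero_smul]
    rw [Finset.sum_eq_single a (fun b _ hb => by simp [hb]) (by simp)]
    simp
  rw [← h5, ← h4]
  simp only [h2, h3, h1]
  simp only [add_smul, Finset.sum_add_distrib, smul_add, ← smul_smul, ← Finset.smul_sum,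
    Finset.sum_neg_distrib]
  have h6 : (1 / 2 : ℂ) • (weightedSquareSum r z S a * regularPart M₀ z S a -
        regularPart M₀ z S a * weightedSquareSum r z S a) =
      ∑ b, (z a - z b)⁻¹ ^ 2 • (r b / 2) • (S b * regularPart M₀ z S a -
        regularPart M₀ z S a * S b) := by
    simp only [weightedSquareSum, Finset.mul_sum, Finset.sum_mul, mul_smul_comm, smul_mul_assoc,
      Finset.smul_sum, ← Finset.sum_sub_distrib]
    refine Finset.sum_congr rfl fun c _ => ?_
    module
  have h7 : weightedSquareSum 1 z S a = ∑ b, (z a - z b)⁻¹ ^ 2 • S b := by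
    simp [weightedSquareSum]
  rw [h6, h7]
  abel

/-- Here `B` is the regular part, `P` and `R` are the sums of inverse squares with weights `1` and
`r`, `U` and `W` those of inverse cubes, `Z` is the acceleration, and `r * q` the velocity.
Differentiating `x' S = r S B` and using `S ^ 2 = 0` and `S B = q S`, every term cancels except `S U
S` and `S W S`. -/
theorem acceleration_algebra {S B P R U W S' B' : 𝔸} {r q Z : ℂ} (hS : S * S = 0)
    (hSB : S * B = q • S) (hPB : P * B + B * P = S * U + U * S)
    (hS' : S' = (1 / 2 : ℂ) • ((r • P + R) * S - S * (r • P + R)))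
    (hB' : B' = (1 / 2 : ℂ) • (R * B - B * R) - (r * q) • P + (r / 2) • (S * U - U * S) +
      (S * W - W * S))
    (hZ : Z • S + (r * q) • S' = r • (S' * B + S * B')) (hr : r * r = 1) :
    Z • S = -(S * (U * S)) - r • (S * (W * S)) := by
  have hSBX : ∀ X, S * (B * X) = q • (S * X) := fun X => by
    rw [← mul_assoc, hSB, smul_mul_assoc]
  have hSSX : ∀ X, S * (S * X) = 0 := fun X => by rw [← mul_assoc, hS, zero_mul]
  have hPB' : S * (P * B) = S * (U * S) - q • (S * P) := by
    have := congrArg (S * ·) hPB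
    simp only [mul_add, hSBX, hSSX, zero_add] at this
    rw [← this]
    abel
  have h1 : S' * B + S * B' = q • S' + (-r) • (S * (U * S)) - S * (W * S) := by
    rw [hS', hB']
    simp only [mul_add, add_mul, mul_sub, sub_mul, smul_mul_assoc, mul_smul_comm, mul_assoc, hSB,
      hSBX, hSSX, hPB', smul_sub, smul_add, smul_zero]
    module
  have h2 : (r * Z) • S = (-r) • (S * (U * S)) - S * (W * S) := by
    have hZ' := congrArg (r • ·) hZ
    simp only [h1, smul_add, smul_smul, ← mul_assoc, hr, one_mul] at hZ'
    have := sub_eq_zero.2 hZ'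
    rw [← sub_eq_zero, ← this]
    simp only [mul_assoc]
    module
  have h4 := congrArg (r • ·) h2
  simp only [smul_smul, ← mul_assoc, hr, one_mul, smul_sub, mul_neg] at h4
  rw [h4, neg_one_smul, mul_assoc, mul_assoc]

end Algebra

namespace IsPoleSystem

variable {ι : Type*} [Fintype ι] {𝔸 : Type*} [NormedRing 𝔸] [NormedAlgebra ℂ 𝔸] {I : Set ℝ}
  {M₀ : 𝔸} {r : ι → ℂ} {z : ι → ℝ → ℂ} {S : ι → ℝ → 𝔸}

theorem hasDerivAt_regularPart (h : IsPoleSystem I M₀ r z S) {t : ℝ} (ht : t ∈ I) (a : ι) :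
    HasDerivAt (fun τ => regularPart M₀ (fun b => z b τ) (fun b => S b τ) a)
      ((1 / 2 : ℂ) • (weightedSquareSum r (fun b => z b t) (fun b => S b t) a *
            regularPart M₀ (fun b => z b t) (fun b => S b t) a -
          regularPart M₀ (fun b => z b t) (fun b => S b t) a *
            weightedSquareSum r (fun b => z b t) (fun b => S b t) a) -
          deriv (z a) t • weightedSquareSum 1 (fun b => z b t) (fun b => S b t) a +
        ∑ b, ((r a / 2 + r b) * (z a t - z b t)⁻¹ ^ 3) • (S a t * S b t - S b t * S a t)) t := by
  rw [← regularPart_derivative (h.injective t ht) (h.anticommute t ht) (h.pole_equation t ht) a]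
  refine (HasDerivAt.fun_sum fun b _ => ?_).const_add M₀
  have h1 : HasDerivAt (fun τ => (z a τ - z b τ)⁻¹)
      (-((z a t - z b t)⁻¹ ^ 2 * (deriv (z a) t - deriv (z b) t))) t := by
    by_cases hab : a = b
    · subst hab
      simpa using hasDerivAt_const t (0 : ℂ)
    · refine (((h.differentiableAt t ht a).hasDerivAt.sub
        (h.differentiableAt t ht b).hasDerivAt).fun_inv
          (sub_ne_zero.2 ((h.injective t ht).ne hab))).congr_deriv ?_
      rw [Pi.sub_apply, inv_pow, div_eq_mul_inv, mul_comm]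
      ring
  exact h1.smul (h.spin_equation t ht b)

/-- The factor `1 + r a * r b` vanishes when the two poles lie on opposite sides of the real line,
so upper and lower poles do not accelerate each other. -/
theorem exists_hasDerivAt_deriv (h : IsPoleSystem I M₀ r z S) (hI : IsOpen I) {t : ℝ}
    (ht : t ∈ I) (a : ι) :
    ∃ Z : ℂ, HasDerivAt (deriv (z a)) Z t ∧
      Z • S a t = -∑ b, ((1 + r a * r b) * (z a t - z b t)⁻¹ ^ 3) • (S a t * S b t * S a t) := by
  obtain ⟨φ, -, hφ⟩ := exists_dual_vector ℂ (S a t) (norm_ne_zero_iff.2 (h.ne_zero t ht a))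
  have hφ0 : φ (S a t) ≠ 0 := by
    rw [hφ]
    simpa using h.ne_zero t ht a
  have hS := h.spin_equation t ht a
  have hB := h.hasDerivAt_regularPart ht a
  have hSB := hS.mul hB
  have hdiff : DifferentiableAt ℝ (deriv (z a)) t := by
    -- Second differentiability is not part of the data. A functional `φ` with `φ (S a t) ≠ 0`
    -- expresses the velocity near `t` as a quotient of differentiable functions.
    have h1 : DifferentiableAt ℝ (fun τ => r a *
        φ (S a τ * regularPart M₀ (fun b => z b τ) (fun b => S b τ) a) / φ (S a τ)) t := by
      have e1 := ((φ.restrictScalars ℝ).hasFDerivAt.comp_hasDerivAt t hSB).differentiableAt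
      have e2 := ((φ.restrictScalars ℝ).hasFDerivAt.comp_hasDerivAt t hS).differentiableAt
      exact (e1.const_mul (r a)).fun_div e2 hφ0
    refine h1.congr_of_eventuallyEq ?_
    have hcont : ContinuousAt (fun τ => φ (S a τ)) t :=
      φ.continuous.continuousAt.comp hS.continuousAt
    filter_upwards [hI.mem_nhds ht, hcont.eventually_ne hφ0] with τ hτ hτ0
    rw [eq_div_iff hτ0, ← smul_eq_mul, ← map_smul, h.pole_equation τ hτ a, map_smul, smul_eq_mul]
  refine ⟨_, hdiff.hasDerivAt, ?_⟩
  have hZ := (hdiff.hasDerivAt.smul hS).unique ((hSB.const_smul (r a)).congr_of_eventuallyEq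
    (by filter_upwards [hI.mem_nhds ht] with τ hτ using h.pole_equation τ hτ a))
  have hpole := h.pole_equation t ht a
  have hrr := h.sign_sq a
  have hq : S a t * regularPart M₀ (fun b => z b t) (fun b => S b t) a =
      (r a * deriv (z a) t) • S a t := by
    rw [← smul_smul, hpole, smul_smul, hrr, one_smul]
  have hrq : r a * (r a * deriv (z a) t) = deriv (z a) t := by rw [← mul_assoc, hrr, one_mul]
  have hac2 := anticommutator_weightedSquareSum (h.injective t ht) (h.mul_self t ht)
    (h.anticommute t ht) a
  have key := acceleration_algebra
    (U := ∑ b, (z a t - z b t)⁻¹ ^ 3 • S b t)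
    (W := ∑ b, (r b * (z a t - z b t)⁻¹ ^ 3) • S b t)
    (h.mul_self t ht a) hq
    (by rw [hac2]; simp only [Finset.mul_sum, Finset.sum_mul, mul_smul_comm, smul_mul_assoc,
      smul_add, Finset.sum_add_distrib]) rfl
    (B' := (1 / 2 : ℂ) • (weightedSquareSum r (fun b => z b t) (fun b => S b t) a *
            regularPart M₀ (fun b => z b t) (fun b => S b t) a -
          regularPart M₀ (fun b => z b t) (fun b => S b t) a *
            weightedSquareSum r (fun b => z b t) (fun b => S b t) a) -
          deriv (z a) t • weightedSquareSum 1 (fun b => z b t) (fun b => S b t) a +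
        ∑ b, ((r a / 2 + r b) * (z a t - z b t)⁻¹ ^ 3) • (S a t * S b t - S b t * S a t))
    (by
      rw [hrq, add_assoc]
      congr 1
      simp only [Finset.mul_sum, Finset.sum_mul, mul_smul_comm, smul_mul_assoc,
        Finset.smul_sum, ← Finset.sum_sub_distrib, ← Finset.sum_add_distrib]
      refine Finset.sum_congr rfl fun b _ => ?_
      module)
    (Z := deriv (deriv (z a)) t) (r := r a) (by
      rw [hrq, ← hZ, add_comm]) hrr
  rw [key]
  simp only [Finset.mul_sum, Finset.sum_mul, mul_smul_comm, smul_mul_assoc,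
    Finset.smul_sum, ← Finset.sum_neg_distrib, ← Finset.sum_sub_distrib]
  refine Finset.sum_congr rfl fun b _ => ?_
  rw [mul_assoc]
  module

end IsPoleSystem

/-! ### The equations of motion in the upper half plane -/

section

attribute [local instance] Matrix.linftyOpNormedRing Matrix.linftyOpNormedAlgebra

theorem hasDerivAt_matrix_entry {S : ℝ → Matrix (Fin 2) (Fin 2) ℂ} {S' : Matrix (Fin 2) (Fin 2) ℂ}
    {t : ℝ} (h : HasDerivAt S S' t) (p q : Fin 2) :
    HasDerivAt (fun τ => S τ p q) (S' p q) t :=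
  ((LinearMap.toContinuousLinearMap (Matrix.entryLinearMap ℂ ℂ p q)).restrictScalars
    ℝ).hasFDerivAt.comp_hasDerivAt t h

namespace IsRationalSolution

variable {N : ℕ} {I : Set ℝ} {m : ℝ → ℝ → R3} {m₀ : R3} {s : Fin N → ℝ → C3}
  {x : Fin N → ℝ → ℂ}

/-- For an upper pole the weights `r a + r b` are `2` at upper poles and `0` at lower ones, so the
conjugate poles drop out. -/
theorem hasDerivAt_pauli_spin (hm : IsRationalSolution I m m₀ s x) (hI : IsOpen I) {t : ℝ}
    (ht : t ∈ I) (j : Fin N) (p q : Fin 2) :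
    HasDerivAt (fun τ => pauli (s j τ) p q)
      ((weightedSquareSum 1 (fun k => x k t) (fun k => pauli (s k t)) j * pauli (s j t) -
        pauli (s j t) * weightedSquareSum 1 (fun k => x k t) (fun k => pauli (s k t)) j) p q) t := by
  have h := (hm.isPoleSystem hI).spin_equation t ht (Sum.inl j)
  have hQ : weightedSquareSum 1 (fun k => x k t) (fun k => pauli (s k t)) j = (1 / 2 : ℂ) •
      (poleSign (Sum.inl j) • weightedSquareSum 1 (fun b => allPoles x b t)
        (fun b => pauli (allSpins s b t)) (Sum.inl j) +
      weightedSquareSum poleSign (fun b => allPoles x b t)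
        (fun b => pauli (allSpins s b t)) (Sum.inl j)) := by
    simp only [weightedSquareSum, Fintype.sum_sum_type, poleSign, allPoles, allSpins,
      Sum.elim_inl, Sum.elim_inr, Pi.one_apply, Pi.neg_apply, one_mul, neg_mul, one_smul,
      neg_smul, Finset.sum_neg_distrib]
    module
  rw [hQ]
  refine hasDerivAt_matrix_entry (h.congr_deriv ?_) p q
  rw [smul_sub, smul_mul_assoc, mul_smul_comm]
  rfl

theorem exists_hasDerivAt_deriv_pole (hm : IsRationalSolution I m m₀ s x) (hI : IsOpen I) {t : ℝ}
    (ht : t ∈ I) (j : Fin N) :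
    ∃ Z : ℂ, HasDerivAt (deriv (x j)) Z t ∧ Z • pauli (s j t) =
      -∑ k, (2 * (x j t - x k t)⁻¹ ^ 3) • (pauli (s j t) * pauli (s k t) * pauli (s j t)) := by
  obtain ⟨Z, h1, h2⟩ := (hm.isPoleSystem hI).exists_hasDerivAt_deriv hI ht (Sum.inl j)
  refine ⟨Z, h1, ?_⟩
  refine Eq.trans h2 ?_
  rw [Fintype.sum_sum_type]
  simp [poleSign, allPoles, allSpins, one_add_one_eq_two]

theorem pauli_spin_mul_self (hm : IsRationalSolution I m m₀ s x) (hI : IsOpen I) {t : ℝ}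
    (ht : t ∈ I) (j : Fin N) : pauli (s j t) * pauli (s j t) = 0 :=
  (hm.isPoleSystem hI).mul_self t ht (Sum.inl j)

theorem pauli_spin_ne_zero (hm : IsRationalSolution I m m₀ s x) {t : ℝ}
    (ht : t ∈ I) (j : Fin N) : pauli (s j t) ≠ 0 := fun h =>
  hm.spin_ne_zero t ht j (pauli_injective (by rw [h, map_zero]))

theorem regularPart_upper (t : ℝ) (j : Fin N) :
    regularPart (pauli (toC m₀)) (fun b => allPoles x b t) (fun b => pauli (allSpins s b t))
      (Sum.inl j) = pauli (toC m₀) + ∑ k, (x j t - x k t)⁻¹ • pauli (s k t) +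
        ∑ k, (x j t - conj (x k t))⁻¹ • (pauli (s k t))ᴴ := by
  simp [regularPart, Fintype.sum_sum_type, allPoles, allSpins, pauli_conjC, add_assoc]

theorem anticommute_upper (hm : IsRationalSolution I m m₀ s x) (hI : IsOpen I) {t : ℝ}
    (ht : t ∈ I) (j : Fin N) :
    pauli (s j t) * (pauli (toC m₀) + ∑ k, (x j t - x k t)⁻¹ • pauli (s k t) +
        ∑ k, (x j t - conj (x k t))⁻¹ • (pauli (s k t))ᴴ) +
      (pauli (toC m₀) + ∑ k, (x j t - x k t)⁻¹ • pauli (s k t) +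
        ∑ k, (x j t - conj (x k t))⁻¹ • (pauli (s k t))ᴴ) * pauli (s j t) = 0 := by
  rw [← regularPart_upper]
  exact (hm.isPoleSystem hI).anticommute t ht (Sum.inl j)

theorem pole_equation_upper (hm : IsRationalSolution I m m₀ s x) (hI : IsOpen I) {t : ℝ}
    (ht : t ∈ I) (j : Fin N) :
    deriv (x j) t • pauli (s j t) =
      pauli (s j t) * (pauli (toC m₀) + ∑ k, (x j t - x k t)⁻¹ • pauli (s k t) +
        ∑ k, (x j t - conj (x k t))⁻¹ • (pauli (s k t))ᴴ) := by
  rw [← regularPart_upper]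
  refine ((hm.isPoleSystem hI).pole_equation t ht (Sum.inl j)).trans ?_
  simp [poleSign, allSpins]

end IsRationalSolution

end

/-! ### Rank one matrices -/

/-- `S ^ 2 = 0` forces `det S = 0`, and that is the only nontrivial case of the identity. -/
theorem rank_one_of_mul_self_eq_zero {S : Matrix (Fin 2) (Fin 2) ℂ} (hS : S * S = 0)
    (i p k q : Fin 2) : S i q * S p k = S p q * S i k := by
  have h1 : S.det = 0 := by
    have := congrArg Matrix.det hS
    rw [Matrix.det_mul, Matrix.det_zero] at this
    exact mul_self_eq_zero.1 this
  rw [Matrix.det_fin_two] at h1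
  fin_cases i <;> fin_cases p <;> fin_cases k <;> fin_cases q <;>
    simp only [Fin.zero_eta, Fin.mk_one, Fin.isValue] <;>
    first | ring1 | linear_combination h1 | linear_combination -h1

theorem exists_vecMulVec_eq {S : Matrix (Fin 2) (Fin 2) ℂ} (hS : S * S = 0) (hS0 : S ≠ 0) :
    ∃ e f : Fin 2 → ℂ, Matrix.vecMulVec e f = S := by
  obtain ⟨p, q, hpq⟩ : ∃ p q, S p q ≠ 0 := by
    by_contra! h
    exact hS0 (Matrix.ext h)
  refine ⟨fun i => S i q, fun i => S p i / S p q, ?_⟩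
  ext i k
  rw [Matrix.vecMulVec_apply, mul_div_assoc', rank_one_of_mul_self_eq_zero hS, mul_div_cancel_left₀ _ hpq]

/-- An entry `(p, q)` that is nonzero at `t` stays so nearby, and column `q` with the normalised row
`p` gives differentiable factors. The factors are free up to `(g e, g⁻¹ f)`; the scalar `θ` records
the normalisation `f q = 1`. -/
theorem exists_local_vecMulVec_eq {S : ℝ → Matrix (Fin 2) (Fin 2) ℂ}
    {Q : Matrix (Fin 2) (Fin 2) ℂ} {t : ℝ}
    (hS : ∀ᶠ τ in 𝓝 t, S τ * S τ = 0) (hS0 : S t ≠ 0)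
    (hd : ∀ p q, HasDerivAt (fun τ => S τ p q) ((Q * S t - S t * Q) p q) t) :
    ∃ (e f : ℝ → Fin 2 → ℂ) (θ : ℂ), (∀ᶠ τ in 𝓝 t, Matrix.vecMulVec (e τ) (f τ) = S τ) ∧
      (∀ i, HasDerivAt (fun τ => e τ i) ((Q *ᵥ e t - θ • e t) i) t) ∧
      ∀ i, HasDerivAt (fun τ => f τ i) ((θ • f t - f t ᵥ* Q) i) t := by
  obtain ⟨p, q, hpq⟩ : ∃ p q, S t p q ≠ 0 := by
    by_contra! h
    exact hS0 (Matrix.ext h)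
  have hst := hS.self_of_nhds
  have hfac : ∀ i k, S t i k = S t i q * (S t p k / S t p q) := by
    intro i k
    rw [mul_div_assoc', rank_one_of_mul_self_eq_zero hst, mul_div_cancel_left₀ _ hpq]
  set e : ℝ → Fin 2 → ℂ := fun τ i => S τ i q
  set f : ℝ → Fin 2 → ℂ := fun τ i => S τ p i / S τ p q
  have hQS : ∀ i k, (Q * S t) i k = (Q *ᵥ e t) i * f t k := by
    intro i k
    simp only [Matrix.mul_apply, Matrix.mulVec, dotProduct, Finset.sum_mul, e, f]
    refine Finset.sum_congr rfl fun l _ => ?_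
    rw [hfac l k]
    ring
  have hSQ : ∀ i k, (S t * Q) i k = e t i * (f t ᵥ* Q) k := by
    intro i k
    simp only [Matrix.mul_apply, Matrix.vecMul, dotProduct, Finset.mul_sum, e, f]
    refine Finset.sum_congr rfl fun l _ => ?_
    rw [hfac i l]
    ring
  have hfq : f t q = 1 := div_self hpq
  refine ⟨e, f, (f t ᵥ* Q) q, ?_, fun i => ?_, fun i => ?_⟩
  · filter_upwards [hS, (hd p q).continuousAt.eventually_ne hpq] with τ hτ hτ0
    ext i k
    rw [Matrix.vecMulVec_apply, mul_div_assoc', rank_one_of_mul_self_eq_zero hτ,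
      mul_div_cancel_left₀ _ hτ0]
  · refine (hd i q).congr_deriv ?_
    rw [Matrix.sub_apply, hQS, hSQ, hfq]
    simp [mul_comm]
  · refine ((hd p i).fun_div (hd p q) hpq).congr_deriv ?_
    rw [Matrix.sub_apply, hQS, hSQ, Matrix.sub_apply, hQS, hSQ, hfq]
    have h1 : S t p i = S t p q * f t i := by simp only [f]; field_simp
    have h2 : e t p = S t p q := rfl
    rw [h1, h2]
    simp only [Pi.sub_apply, Pi.smul_apply, smul_eq_mul]
    field_simp
    ring

theorem exists_smul_of_vecMulVec_eq {e f e' f' : Fin 2 → ℂ}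
    (h : Matrix.vecMulVec e f = Matrix.vecMulVec e' f') (h0 : Matrix.vecMulVec e f ≠ 0) :
    ∃ g : ℂ, g ≠ 0 ∧ e' = g • e ∧ f = g • f' := by
  obtain ⟨p, q, hpq⟩ : ∃ p q, e p * f q ≠ 0 := by
    by_contra! hc
    exact h0 (Matrix.ext fun p q => hc p q)
  have hent : ∀ i k, e i * f k = e' i * f' k := fun i k => congrFun (congrFun h i) k
  have hep := left_ne_zero_of_mul hpq
  have hfq := right_ne_zero_of_mul hpq
  have hpq' : e' p * f' q ≠ 0 := hent p q ▸ hpq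
  have hep' := left_ne_zero_of_mul hpq'
  have hfq' := right_ne_zero_of_mul hpq'
  refine ⟨e' p / e p, div_ne_zero hep' hep, ?_, ?_⟩
  · ext i
    have h1 := hent i q
    have h2 := hent p q
    simp only [Pi.smul_apply, smul_eq_mul]
    field_simp
    apply mul_right_cancel₀ hfq'
    apply mul_right_cancel₀ hfq
    linear_combination (e' i * f' q) * h2 - e' p * f' q * h1
  · ext k
    have h1 := hent p k
    simp only [Pi.smul_apply, smul_eq_mul]
    field_simp
    linear_combination h1

/-! ### The Lax matrix -/

/-- The Lax matrix of poles `x` with velocities `v` and residues `e j (f j)ᵀ`. -/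
def laxMatrix {N : ℕ} (x v : Fin N → ℂ) (e f : Fin N → Fin 2 → ℂ) :
    Matrix (Fin N) (Fin N) ℂ :=
  Matrix.diagonal v - Matrix.of fun j k => (x j - x k)⁻¹ * (f j ⬝ᵥ e k)

theorem laxMatrix_apply {N : ℕ} (x v : Fin N → ℂ) (e f : Fin N → Fin 2 → ℂ) (j k : Fin N) :
    laxMatrix x v e f j k = (if j = k then v j else 0) - (x j - x k)⁻¹ * (f j ⬝ᵥ e k) := by
  simp only [laxMatrix, Matrix.sub_apply, Matrix.diagonal_apply, Matrix.of_apply]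

theorem smul_one_sub_laxMatrix_apply {N : ℕ} (x v : Fin N → ℂ) (e f : Fin N → Fin 2 → ℂ)
    (z c : ℂ) (j k : Fin N) :
    (z • 1 - (Matrix.diagonal x + c • laxMatrix x v e f)) j k =
      (if j = k then z - x j - c * v j else 0) + c * ((x j - x k)⁻¹ * (f j ⬝ᵥ e k)) := by
  rw [Matrix.sub_apply, Matrix.add_apply, Matrix.smul_apply, Matrix.smul_apply, laxMatrix_apply,
    Matrix.diagonal_apply, Matrix.one_apply]
  split_ifs <;> simp only [smul_eq_mul] <;> ring

/-- Rescaling the factors conjugates the Lax matrix by a diagonal matrix. -/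
theorem det_sub_laxMatrix_gauge {N : ℕ} (x v : Fin N → ℂ) {e f e' f' : Fin N → Fin 2 → ℂ}
    (h : ∀ j, Matrix.vecMulVec (e j) (f j) = Matrix.vecMulVec (e' j) (f' j))
    (h0 : ∀ j, Matrix.vecMulVec (e j) (f j) ≠ 0) (z c : ℂ) :
    (z • 1 - (Matrix.diagonal x + c • laxMatrix x v e' f')).det =
      (z • 1 - (Matrix.diagonal x + c • laxMatrix x v e f)).det := by
  choose g hg0 hge hgf using fun j => exists_smul_of_vecMulVec_eq (h j) (h0 j)
  have hM : z • 1 - (Matrix.diagonal x + c • laxMatrix x v e' f') =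
      Matrix.diagonal (fun j => (g j)⁻¹) *
        (z • 1 - (Matrix.diagonal x + c • laxMatrix x v e f)) * Matrix.diagonal g := by
    ext j k
    rw [Matrix.mul_diagonal, Matrix.diagonal_mul]
    have h1 : f j ⬝ᵥ e' k = g j * g k * (f' j ⬝ᵥ e k) := by
      rw [hgf j, hge k, smul_dotProduct, dotProduct_smul]
      simp [mul_assoc]
    have h2 : f' j ⬝ᵥ e' k = (g j)⁻¹ * (f j ⬝ᵥ e k) * g k := by
      rw [hge k, hgf j, smul_dotProduct, dotProduct_smul]
      have := hg0 j
      simp only [smul_eq_mul]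
      field_simp
    rw [smul_one_sub_laxMatrix_apply, smul_one_sub_laxMatrix_apply, h2]
    have := hg0 j
    split_ifs with hjk
    · subst hjk
      field_simp
    · ring
  rw [hM, Matrix.det_mul, Matrix.det_mul, Matrix.det_diagonal, Matrix.det_diagonal,
    Finset.prod_inv_distrib]
  have : ∏ j, g j ≠ 0 := Finset.prod_ne_zero_iff.2 fun j _ => hg0 j
  field_simp

/-- Jacobi's formula, read off from the determinant as a multilinear function of the rows. -/
theorem hasDerivAt_det {n : Type*} [Fintype n] [DecidableEq n] {M : ℝ → Matrix n n ℂ}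
    {M' : Matrix n n ℂ} {t : ℝ} (h : ∀ i j, HasDerivAt (fun τ => M τ i j) (M' i j) t) :
    HasDerivAt (fun τ => (M τ).det) (M' * (M t).adjugate).trace t := by
  let D : ContinuousMultilinearMap ℂ (fun _ : n => n → ℂ) ℂ :=
    { toMultilinearMap := (Matrix.detRowAlternating (n := n) (R := ℂ)).toMultilinearMap
      cont := (continuous_id (X := Matrix n n ℂ)).matrix_det }
  have h1 : HasDerivAt (fun τ => (fun i j => M τ i j : n → n → ℂ)) (fun i j => M' i j) t :=
    hasDerivAt_pi.2 fun i => hasDerivAt_pi.2 fun j => h i j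
  have h2 := ((D.hasFDerivAt (x := (fun i j => M t i j))).restrictScalars ℝ).comp_hasDerivAt t h1
  refine h2.congr_deriv ?_
  simp only [ContinuousLinearMap.coe_restrictScalars', ContinuousMultilinearMap.linearDeriv_apply,
    Matrix.trace, Matrix.diag_apply]
  refine Finset.sum_congr rfl fun i _ => ?_
  have h3 : (M' * (M t).adjugate) i i = ((M t)ᵀ.adjugate *ᵥ M' i) i := by
    rw [← Matrix.adjugate_transpose, Matrix.mulVec_transpose]
    rfl
  rw [h3, ← Matrix.cramer_eq_adjugate_mulVec, Matrix.cramer_transpose_apply]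
  rfl

theorem hasDerivAt_det_of_commutator {n : Type*} [Fintype n] [DecidableEq n]
    {M : ℝ → Matrix n n ℂ} {A : Matrix n n ℂ} {t : ℝ}
    (h : ∀ i j, HasDerivAt (fun τ => M τ i j) ((M t * A - A * M t) i j) t) :
    HasDerivAt (fun τ => (M τ).det) 0 t := by
  refine (hasDerivAt_det h).congr_deriv ?_
  rw [sub_mul, Matrix.trace_sub, Matrix.mul_assoc A, Matrix.mul_adjugate, Matrix.mul_assoc,
    Matrix.trace_mul_comm, Matrix.mul_assoc, Matrix.adjugate_mul, sub_self]

/-- A Lax pair: `X' = L + [X, A]` and `L' = [L, A]`, so `X + (t₁ - τ) L` evolves by a commutator,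
the two occurrences of `L` cancelling. -/
theorem laxMatrix_isospectral {N : ℕ} {x v : Fin N → ℝ → ℂ} {e f : ℝ → Fin N → Fin 2 → ℂ} {t : ℝ}
    {Z θ : Fin N → ℂ} (hinj : Function.Injective fun j => x j t)
    (hx : ∀ j, HasDerivAt (x j) (v j t) t) (hv : ∀ j, HasDerivAt (v j) (Z j) t)
    (hef : ∀ j, f t j ⬝ᵥ e t j = 0)
    (hZ : ∀ j, Z j = -∑ k, 2 * (x j t - x k t)⁻¹ ^ 3 * ((f t j ⬝ᵥ e t k) * (f t k ⬝ᵥ e t j)))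
    (he : ∀ j i, HasDerivAt (fun τ => e τ j i) ((weightedSquareSum 1 (fun k => x k t)
      (fun k => Matrix.vecMulVec (e t k) (f t k)) j *ᵥ e t j - θ j • e t j) i) t)
    (hf : ∀ j i, HasDerivAt (fun τ => f τ j i) ((θ j • f t j - f t j ᵥ* weightedSquareSum 1
      (fun k => x k t) (fun k => Matrix.vecMulVec (e t k) (f t k)) j) i) t) (z : ℂ) (t₁ : ℝ) :
    HasDerivAt (fun τ => (z • 1 - (Matrix.diagonal (fun j => x j τ) +
      ((t₁ - τ : ℝ) : ℂ) • laxMatrix (fun j => x j τ) (fun j => v j τ) (e τ) (f τ))).det) 0 t := by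
  set h : Fin N → Fin N → ℂ := fun j k => f t j ⬝ᵥ e t k with hh
  set Q := fun j => weightedSquareSum 1 (fun k => x k t)
      (fun k => Matrix.vecMulVec (e t k) (f t k)) j with hQ
  have hQe : ∀ j k l, f t j ⬝ᵥ (Q l *ᵥ e t k) = ∑ i, (x l t - x i t)⁻¹ ^ 2 * (h j i * h i k) := by
    intro j k l
    simp only [hQ, weightedSquareSum, Matrix.sum_mulVec, dotProduct_sum, Matrix.smul_mulVec,
      Matrix.vecMulVec_mulVec, dotProduct_smul, Pi.one_apply, one_mul, smul_eq_mul]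
    refine Finset.sum_congr rfl fun i _ => ?_
    simp only [hh, MulOpposite.smul_eq_mul_unop, MulOpposite.unop_op]
  have hd : ∀ j k, HasDerivAt (fun τ => f τ j ⬝ᵥ e τ k)
      (∑ i, ((x k t - x i t)⁻¹ ^ 2 - (x j t - x i t)⁻¹ ^ 2) * (h j i * h i k) +
        (θ j - θ k) * h j k) t := by
    intro j k
    have h1 : HasDerivAt (fun τ => f τ j ⬝ᵥ e τ k)
        ((θ j • f t j - f t j ᵥ* Q j) ⬝ᵥ e t k + f t j ⬝ᵥ (Q k *ᵥ e t k - θ k • e t k)) t := by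
      simp only [dotProduct, ← Finset.sum_add_distrib]
      exact HasDerivAt.fun_sum fun i _ => (hf j i).mul (he k i)
    refine h1.congr_deriv ?_
    rw [sub_dotProduct, dotProduct_sub, ← Matrix.dotProduct_mulVec, hQe, hQe, smul_dotProduct,
      dotProduct_smul]
    simp only [sub_mul, Finset.sum_sub_distrib, smul_eq_mul, hh]
    ring
  have hi : ∀ j k, HasDerivAt (fun τ => (x j τ - x k τ)⁻¹)
      (-((x j t - x k t)⁻¹ ^ 2 * (v j t - v k t))) t := by
    intro j k
    by_cases hjk : j = k
    · subst hjk
      simpa using hasDerivAt_const t (0 : ℂ)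
    · refine (((hx j).sub (hx k)).fun_inv (sub_ne_zero.2 (hinj.ne hjk))).congr_deriv ?_
      rw [Pi.sub_apply, inv_pow, div_eq_mul_inv, mul_comm]
      ring
  refine hasDerivAt_det_of_commutator
    -- The diagonal part `θ` of `A` compensates the scaling of the factors `e` and `f`.
    (A := Matrix.of (fun j k => (x j t - x k t)⁻¹ ^ 2 * h j k) - Matrix.diagonal θ)
    fun j k => ?_
  have hcomm : ∀ M : Matrix (Fin N) (Fin N) ℂ, ∀ (μ : Fin N → ℂ) (c : ℂ),
      (∀ j k, M j k = (if j = k then μ j else 0) + c * ((x j t - x k t)⁻¹ * h j k)) →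
      (M * (Matrix.of (fun j k => (x j t - x k t)⁻¹ ^ 2 * h j k) - Matrix.diagonal θ) -
        (Matrix.of (fun j k => (x j t - x k t)⁻¹ ^ 2 * h j k) - Matrix.diagonal θ) * M) j k =
      (μ j - μ k) * ((x j t - x k t)⁻¹ ^ 2 * h j k) +
        c * (∑ l, ((x j t - x l t)⁻¹ * (x l t - x k t)⁻¹ ^ 2 -
          (x j t - x l t)⁻¹ ^ 2 * (x l t - x k t)⁻¹) * (h j l * h l k) +
          (θ j - θ k) * ((x j t - x k t)⁻¹ * h j k)) := by
    intro M μ c hM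
    have hMdef : M = Matrix.diagonal μ + c • Matrix.of fun j k => (x j t - x k t)⁻¹ * h j k := by
      ext j k
      simp only [hM, Matrix.add_apply, Matrix.diagonal_apply, Matrix.smul_apply, Matrix.of_apply,
        smul_eq_mul]
    rw [hMdef]
    simp only [mul_sub, add_mul, sub_mul, mul_add, Matrix.sub_apply, Matrix.add_apply,
      Matrix.diagonal_mul, Matrix.mul_diagonal, Matrix.of_apply, Matrix.smul_mul, Matrix.mul_smul,
      Matrix.smul_apply, smul_eq_mul, Matrix.diagonal_mul_diagonal, Matrix.diagonal_apply,
      mul_comm (θ _) (μ _)]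
    simp only [Matrix.mul_apply, Matrix.of_apply, Finset.sum_sub_distrib]
    have e1 : ∀ l, (x j t - x l t)⁻¹ * h j l * ((x l t - x k t)⁻¹ ^ 2 * h l k) =
      (x j t - x l t)⁻¹ * (x l t - x k t)⁻¹ ^ 2 * (h j l * h l k) := fun l => by ring
    have e2 : ∀ l, (x j t - x l t)⁻¹ ^ 2 * h j l * ((x l t - x k t)⁻¹ * h l k) =
      (x j t - x l t)⁻¹ ^ 2 * (x l t - x k t)⁻¹ * (h j l * h l k) := fun l => by ring
    simp only [e1, e2]
    ring
  have hc : HasDerivAt (fun τ : ℝ => ((t₁ - τ : ℝ) : ℂ)) (-1) t := by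
    have := ((hasDerivAt_id t).const_sub t₁).ofReal_comp
    simpa using this
  have hentry : ∀ τ, (z • 1 - (Matrix.diagonal (fun j => x j τ) +
      ((t₁ - τ : ℝ) : ℂ) • laxMatrix (fun j => x j τ) (fun j => v j τ) (e τ) (f τ))) j k =
      (if j = k then z - x j τ - ((t₁ - τ : ℝ) : ℂ) * v j τ else 0) +
        ((t₁ - τ : ℝ) : ℂ) * ((x j τ - x k τ)⁻¹ * (f τ j ⬝ᵥ e τ k)) := fun τ =>
    smul_one_sub_laxMatrix_apply _ _ _ _ _ _ _ _
  simp only [hentry]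
  rw [hcomm _ (fun j => z - x j t - ((t₁ - t : ℝ) : ℂ) * v j t) ((t₁ - t : ℝ) : ℂ)
    (fun j k => smul_one_sub_laxMatrix_apply _ _ _ _ _ _ _ _)]
  have hoff := hc.mul ((hi j k).mul (hd j k))
  by_cases hjk : j = k
  · subst hjk
    have hdiag := (((hx j).const_sub z).sub (hc.mul (hv j))).add hoff
    simp only [if_true]
    refine hdiag.congr_deriv ?_
    simp only [sub_self, inv_zero, zero_mul, zero_add, mul_zero, neg_zero, hZ, Pi.mul_apply,
      add_zero]
    have : ∀ l, ((x j t - x l t)⁻¹ * (x l t - x j t)⁻¹ ^ 2 -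
        (x j t - x l t)⁻¹ ^ 2 * (x l t - x j t)⁻¹) * (h j l * h l j) =
        2 * (x j t - x l t)⁻¹ ^ 3 * ((f t j ⬝ᵥ e t l) * (f t l ⬝ᵥ e t j)) := by
      intro l
      rw [← neg_sub (x j t) (x l t), inv_neg]
      ring
    simp only [this]
    ring
  · simp only [if_neg hjk, zero_add]
    refine hoff.congr_deriv ?_
    have hne := sub_ne_zero.2 (hinj.ne hjk)
    have hhd : ∀ j, h j j = 0 := hef
    -- The terms `l = j` and `l = k` vanish because `f j · e j = 0`; the others follow from a
    -- partial fraction identity for three distinct poles.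
    have hsum : ∑ l, ((x j t - x l t)⁻¹ * (x l t - x k t)⁻¹ ^ 2 -
          (x j t - x l t)⁻¹ ^ 2 * (x l t - x k t)⁻¹) * (h j l * h l k) =
        (x j t - x k t)⁻¹ * ∑ i, ((x k t - x i t)⁻¹ ^ 2 - (x j t - x i t)⁻¹ ^ 2) *
          (h j i * h i k) := by
      rw [Finset.mul_sum]
      refine Finset.sum_congr rfl fun l _ => ?_
      by_cases hjl : j = l
      · subst hjl
        simp [hhd]
      · by_cases hlk : l = k
        · subst hlk
          simp [hhd]
        · have h1 := sub_ne_zero.2 (hinj.ne hjl)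
          have h2 := sub_ne_zero.2 (hinj.ne hlk)
          have h3 := sub_ne_zero.2 (hinj.ne (Ne.symm hlk))
          have h4 : (x j t - x l t)⁻¹ * (x l t - x k t)⁻¹ ^ 2 -
              (x j t - x l t)⁻¹ ^ 2 * (x l t - x k t)⁻¹ =
              (x j t - x k t)⁻¹ * ((x k t - x l t)⁻¹ ^ 2 - (x j t - x l t)⁻¹ ^ 2) := by
            rw [← neg_sub (x l t) (x k t), inv_neg]
            field_simp
            ring
          rw [h4, mul_assoc]
    rw [hsum]
    simp only [Pi.mul_apply]
    field_simp
    ring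

/-- The determinant of `z - X(τ) - (t₁ - τ) L(τ)` does not depend on `τ`, and at `τ = t₁` the Lax
matrix has coefficient zero. -/
theorem IsRationalSolution.prod_sub_pole {N : ℕ} {T : ℝ} {m : ℝ → ℝ → R3} {m₀ : R3}
    {s : Fin N → ℝ → C3} {x : Fin N → ℝ → ℂ} (hm : IsRationalSolution (Set.Ioi T) m m₀ s x)
    {t₀ t₁ : ℝ} (ht₀ : T < t₀) (ht₁ : T < t₁) {e f : Fin N → Fin 2 → ℂ}
    (hef : ∀ j, Matrix.vecMulVec (e j) (f j) = pauli (s j t₀)) (z : ℂ) :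
    ∏ j, (z - x j t₁) = (z • 1 - (Matrix.diagonal (fun j => x j t₀) +
      ((t₁ - t₀ : ℝ) : ℂ) • laxMatrix (fun j => x j t₀) (fun j => deriv (x j) t₀) e f)).det := by
  classical
  have hI : IsOpen (Set.Ioi T) := isOpen_Ioi
  have hex : ∀ τ : ℝ, ∃ e f : Fin N → Fin 2 → ℂ, T < τ →
      ∀ j, Matrix.vecMulVec (e j) (f j) = pauli (s j τ) := by
    intro τ
    by_cases hτ : T < τ
    · choose e f h using fun j =>
        exists_vecMulVec_eq (hm.pauli_spin_mul_self hI hτ j) (hm.pauli_spin_ne_zero hτ j)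
      exact ⟨e, f, fun _ => h⟩
    · exact ⟨0, 0, fun h => absurd h hτ⟩
  choose E F hEF using hex
  set c : ℝ → ℂ := fun τ => (z • 1 - (Matrix.diagonal (fun j => x j τ) +
    ((t₁ - τ : ℝ) : ℂ) • laxMatrix (fun j => x j τ) (fun j => deriv (x j) τ) (E τ) (F τ))).det
    with hc
  -- The factors `E τ`, `F τ` are chosen separately at each time, without continuity. By gauge
  -- invariance `c` can be differentiated with the local smooth factors instead.
  have hgauge : ∀ τ, T < τ → ∀ e f : Fin N → Fin 2 → ℂ,
      (∀ j, Matrix.vecMulVec (e j) (f j) = pauli (s j τ)) →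
      c τ = (z • 1 - (Matrix.diagonal (fun j => x j τ) +
    ((t₁ - τ : ℝ) : ℂ) • laxMatrix (fun j => x j τ) (fun j => deriv (x j) τ) e f)).det := by
    intro τ hτ e f h
    exact det_sub_laxMatrix_gauge _ _ (fun j => by rw [h, hEF τ hτ])
      (fun j => by rw [h]; exact hm.pauli_spin_ne_zero hτ j) _ _
  have hderiv : ∀ t ∈ Set.Ioi T, HasDerivAt c 0 t := by
    intro t ht
    choose e f θ h1 h2 h3 using fun j => exists_local_vecMulVec_eq
      (S := fun τ => pauli (s j τ))
      (by filter_upwards [hI.mem_nhds ht] with τ hτ using hm.pauli_spin_mul_self hI hτ j)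
      (hm.pauli_spin_ne_zero ht j) (hm.hasDerivAt_pauli_spin hI ht j)
    choose Z hZ1 hZ2 using hm.exists_hasDerivAt_deriv_pole hI ht
    have hef' : ∀ j, Matrix.vecMulVec (e j t) (f j t) = pauli (s j t) := fun j =>
      (h1 j).self_of_nhds
    have hQ : ∀ j, weightedSquareSum 1 (fun k => x k t) (fun k => pauli (s k t)) j =
        weightedSquareSum 1 (fun k => x k t)
          (fun k => Matrix.vecMulVec (e k t) (f k t)) j := by
      intro j
      simp only [hef']
    have key := laxMatrix_isospectral (x := x) (v := fun j => deriv (x j))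
      (e := fun τ j => e j τ) (f := fun τ j => f j τ) (Z := Z) (θ := θ)
      (hm.poles_distinct t ht) (fun j => (hm.differentiableAt_pole t ht j).hasDerivAt) hZ1
      (fun j => by
        have hsq := hm.pauli_spin_mul_self hI ht j
        have hne := hm.pauli_spin_ne_zero ht j
        rw [← hef', Matrix.vecMulVec_mul_vecMulVec] at hsq
        rw [← hef'] at hne
        rw [Matrix.vecMulVec_smul] at hsq
        exact (smul_eq_zero.1 hsq).resolve_right hne)
      (fun j => by
        have h := hZ2 j
        have hne := hm.pauli_spin_ne_zero ht j
        have h4 : ∀ k, pauli (s j t) * pauli (s k t) * pauli (s j t) =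
            ((f j t ⬝ᵥ e k t) * (f k t ⬝ᵥ e j t)) • pauli (s j t) := by
          intro k
          rw [← hef', ← hef', Matrix.vecMulVec_mul_vecMulVec, Matrix.vecMulVec_mul_vecMulVec,
            smul_dotProduct, Matrix.vecMulVec_smul, smul_eq_mul]
        simp only [h4, smul_smul, ← Finset.sum_smul, ← neg_smul] at h
        exact smul_left_injective ℂ hne h)
      (fun j i => by
        have := h2 j i
        rw [hQ] at this
        exact this)
      (fun j i => by
        have := h3 j i
        rw [hQ] at this
        exact this) z t₁
    refine key.congr_of_eventuallyEq ?_
    filter_upwards [hI.mem_nhds ht, eventually_all.2 h1] with τ hτ hτ1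
    exact hgauge τ hτ _ _ hτ1
  have hconst : c t₁ = c t₀ := by
    refine hI.is_const_of_deriv_eq_zero isPreconnected_Ioi
      (fun t ht => (hderiv t ht).differentiableAt.differentiableWithinAt)
      (fun t ht => (hderiv t ht).deriv) ht₁ ht₀
  rw [← hgauge t₀ ht₀ e f hef, ← hconst, hc]
  have : z • (1 : Matrix (Fin N) (Fin N) ℂ) - (Matrix.diagonal (fun j => x j t₁) +
      ((t₁ - t₁ : ℝ) : ℂ) • laxMatrix (fun j => x j t₁) (fun j => deriv (x j) t₁) (E t₁) (F t₁)) =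
      Matrix.diagonal fun j => z - x j t₁ := by
    ext j k
    by_cases hjk : j = k
    · subst hjk; simp
    · simp [hjk]
  simp only [this, Matrix.det_diagonal]

/-! ### The spectrum of the Lax matrix -/

section Symmetrizable

open Matrix

variable {n : Type*} [Fintype n]

theorem star_dotProduct_mulVec_of_isHermitian {K : Matrix n n ℂ} (hK : K.IsHermitian)
    (u w : n → ℂ) : star (star u ⬝ᵥ (K *ᵥ w)) = star w ⬝ᵥ (K *ᵥ u) := by
  rw [← star_dotProduct, star_mulVec, hK.eq, ← dotProduct_mulVec]

variable {G L : Matrix n n ℂ}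

/-- `L` is self-adjoint for the form `G`, of which only the absence of nonzero isotropic vectors is
needed. -/
theorem im_eq_zero_of_symmetrizable (hG : G.IsHermitian) (hGL : (G * L).IsHermitian)
    (hpos : ∀ u, star u ⬝ᵥ (G *ᵥ u) = 0 → u = 0) {u : n → ℂ} {l : ℂ} (hu : u ≠ 0)
    (h : L *ᵥ u = l • u) : l.im = 0 := by
  have h1 := star_dotProduct_mulVec_of_isHermitian hG u u
  have h2 := star_dotProduct_mulVec_of_isHermitian hGL u u
  rw [← mulVec_mulVec, h, mulVec_smul, dotProduct_smul, smul_eq_mul, star_mul', h1] at h2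
  have h3 := mul_right_cancel₀ (fun h0 => hu (hpos u h0)) h2
  exact Complex.conj_eq_iff_im.1 h3

variable [DecidableEq n]

/-- There are no Jordan blocks: by self-adjointness `(L - l) u` is isotropic for `G` once `(L - l) ^
2 u = 0`. -/
theorem mulVec_eq_of_sq_of_symmetrizable (hG : G.IsHermitian) (hGL : (G * L).IsHermitian)
    (hpos : ∀ u, star u ⬝ᵥ (G *ᵥ u) = 0 → u = 0) {u : n → ℂ} {l : ℂ} (hl : l.im = 0)
    (h : (L - l • 1) *ᵥ ((L - l • 1) *ᵥ u) = 0) : (L - l • 1) *ᵥ u = 0 := by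
  have hK : (G * (L - l • 1)).IsHermitian := by
    have : (l • G).IsHermitian := by
      rw [IsHermitian, conjTranspose_smul, hG.eq, Complex.star_def, Complex.conj_eq_iff_im.2 hl]
    simpa [mul_sub] using hGL.sub this
  refine hpos _ ?_
  have h1 := star_dotProduct_mulVec_of_isHermitian hK u ((L - l • 1) *ᵥ u)
  rw [← mulVec_mulVec, ← mulVec_mulVec, h, mulVec_zero, dotProduct_zero, star_zero] at h1
  exact h1.symm

/-- The row is one maximising `a k * ‖u k‖`. With `a j = ‖e j‖` the radii for the Lax matrix involve
only the products `‖e j‖ ‖f j‖`, which do not change when the factors are rescaled. The conclusion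
`u j ≠ 0` serves to bound multiplicities. -/
theorem exists_gershgorin_weighted {a : n → ℝ} (ha : ∀ j, 0 < a j) {c : n → n → ℝ}
    (hc : ∀ j k, j ≠ k → a j * ‖L j k‖ ≤ c j k * a k) (hc0 : ∀ j k, j ≠ k → 0 ≤ c j k)
    {u : n → ℂ} {l : ℂ} (hu : u ≠ 0)
    (h : L *ᵥ u = l • u) : ∃ j, u j ≠ 0 ∧ ‖l - L j j‖ ≤ ∑ k ∈ Finset.univ.erase j, c j k := by
  obtain ⟨i, hi⟩ := Function.ne_iff.1 hu
  obtain ⟨j, -, hj⟩ := Finset.exists_max_image Finset.univ (fun k => a k * ‖u k‖)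
    ⟨i, Finset.mem_univ i⟩
  have hpos : 0 < a j * ‖u j‖ :=
    (mul_pos (ha i) (norm_pos_iff.2 hi)).trans_le (hj i (Finset.mem_univ i))
  refine ⟨j, fun h0 => by simp [h0] at hpos, ?_⟩
  have h1 : (l - L j j) * u j = ∑ k ∈ Finset.univ.erase j, L j k * u k := by
    have h2 := congrFun h j
    rw [mulVec, dotProduct, ← Finset.add_sum_erase _ _ (Finset.mem_univ j), Pi.smul_apply,
      smul_eq_mul] at h2
    linear_combination -h2
  refine le_of_mul_le_mul_right ?_ hpos
  calc ‖l - L j j‖ * (a j * ‖u j‖) = a j * ‖(l - L j j) * u j‖ := by rw [norm_mul]; ring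
    _ = a j * ‖∑ k ∈ Finset.univ.erase j, L j k * u k‖ := by rw [h1]
    _ ≤ a j * ∑ k ∈ Finset.univ.erase j, ‖L j k * u k‖ :=
        mul_le_mul_of_nonneg_left (norm_sum_le _ _) (ha j).le
    _ = ∑ k ∈ Finset.univ.erase j, (a j * ‖L j k‖) * ‖u k‖ := by
        rw [Finset.mul_sum]
        refine Finset.sum_congr rfl fun k _ => ?_
        rw [norm_mul, mul_assoc]
    _ ≤ ∑ k ∈ Finset.univ.erase j, c j k * (a j * ‖u j‖) := by
        refine Finset.sum_le_sum fun k hk => ?_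
        have hjk := (Finset.ne_of_mem_erase hk).symm
        calc a j * ‖L j k‖ * ‖u k‖ ≤ c j k * a k * ‖u k‖ :=
              mul_le_mul_of_nonneg_right (hc j k hjk) (norm_nonneg _)
          _ = c j k * (a k * ‖u k‖) := by ring
          _ ≤ c j k * (a j * ‖u j‖) :=
              mul_le_mul_of_nonneg_left (hj k (Finset.mem_univ k)) (hc0 j k hjk)
    _ = _ := by rw [Finset.sum_mul]

/-- Symmetrisability makes the eigenvalues real and every generalised eigenvector an eigenvector, so
the multiplicity of a root is the dimension of its eigenspace. Disjointness of the discs makes that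
dimension at most one. -/
theorem exists_injective_det_eq_prod {N : ℕ} {G L : Matrix (Fin N) (Fin N) ℂ}
    (hG : G.IsHermitian) (hGL : (G * L).IsHermitian)
    (hpos : ∀ u, star u ⬝ᵥ (G *ᵥ u) = 0 → u = 0)
    {a : Fin N → ℝ} (ha : ∀ j, 0 < a j) {c : Fin N → Fin N → ℝ}
    (hc : ∀ j k, j ≠ k → a j * ‖L j k‖ ≤ c j k * a k) (hc0 : ∀ j k, j ≠ k → 0 ≤ c j k)
    (hdisj : ∀ j p, j ≠ p → ∑ k ∈ Finset.univ.erase j, c j k + ∑ k ∈ Finset.univ.erase p, c p k <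
      ‖L j j - L p p‖) :
    ∃ w : Fin N → ℝ, Function.Injective w ∧ ∀ z : ℂ, (z • 1 - L).det = ∏ i, (z - w i) := by
  classical
  have hsplit := (IsAlgClosed.splits L.charpoly).eq_prod_roots_of_monic L.charpoly_monic
  have hreal : ∀ l ∈ L.charpoly.roots, l.im = 0 := by
    intro l hl
    have h1 := (Polynomial.mem_roots'.1 hl).2
    rw [Polynomial.IsRoot.def, eval_charpoly] at h1
    obtain ⟨u, hu, hu'⟩ := exists_mulVec_eq_zero_iff.2 h1
    refine im_eq_zero_of_symmetrizable hG hGL hpos hu (l := l) ?_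
    rw [sub_mulVec, sub_eq_zero] at hu'
    rw [← hu', scalar_apply, ← smul_one_eq_diagonal, smul_mulVec, one_mulVec]
  have hnodup : L.charpoly.roots.Nodup := by
    rw [Multiset.nodup_iff_count_le_one]
    intro l
    by_cases hl : l ∈ L.charpoly.roots
    swap
    · rw [Multiset.count_eq_zero_of_notMem hl]; exact zero_le_one
    have hlre := hreal l hl
    rw [Polynomial.count_roots, ← charpoly_toLin', ← LinearMap.finrank_maxGenEigenspace_eq]
    have hmem : ∀ u, u ∈ Module.End.maxGenEigenspace (toLin' L) l → L *ᵥ u = l • u := by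
      intro u hu
      obtain ⟨k, hk⟩ := (Module.End.mem_maxGenEigenspace _ _ _).1 hu
      set D : Module.End ℂ (Fin N → ℂ) := toLin' L - l • 1 with hD
      have happ : ∀ w, D w = (L - l • 1) *ᵥ w := by
        intro w
        simp [hD, sub_mulVec, smul_mulVec]
      have key : ∀ k, (D ^ (k + 1)) u = 0 → (L - l • 1) *ᵥ u = 0 := by
        intro k
        induction k with
        | zero => intro h; rwa [zero_add, pow_one, happ] at h
        | succ k ih =>
          intro h
          refine ih ?_
          rw [pow_succ', pow_succ', Module.End.mul_apply, Module.End.mul_apply, happ, happ] at h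
          rw [pow_succ', Module.End.mul_apply, happ]
          exact mulVec_eq_of_sq_of_symmetrizable hG hGL hpos hlre h
      have h0 : (L - l • 1) *ᵥ u = 0 := by
        refine key k ?_
        rw [pow_succ', Module.End.mul_apply, hk, map_zero]
      rwa [sub_mulVec, smul_mulVec, one_mulVec, sub_eq_zero] at h0
    by_cases hbot : ∃ u ∈ Module.End.maxGenEigenspace (toLin' L) l, u ≠ 0
    · obtain ⟨u, hu, hu0⟩ := hbot
      obtain ⟨j, -, hj⟩ := exists_gershgorin_weighted ha hc hc0 hu0 (hmem u hu)
      -- Coordinate `j` determines the eigenvector: a nonzero one vanishing at `j` would put `l` in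
      -- a second disc `p ≠ j` as well.
      have hinj : Function.Injective ((LinearMap.proj j : (Fin N → ℂ) →ₗ[ℂ] ℂ).comp
          (Module.End.maxGenEigenspace (toLin' L) l).subtype) := by
        rw [injective_iff_map_eq_zero]
        rintro ⟨w, hw⟩ hwj
        have hwj' : w j = 0 := hwj
        by_contra hne
        have hw0 : w ≠ 0 := fun h => hne (by simp [h])
        obtain ⟨p, hp, hp'⟩ := exists_gershgorin_weighted ha hc hc0 hw0 (hmem w hw)
        have hjp : j ≠ p := fun h => hp (h ▸ hwj')
        have h1 := hdisj j p hjp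
        have h2 : ‖L j j - L p p‖ ≤ ‖l - L j j‖ + ‖l - L p p‖ := by
          rw [show L j j - L p p = (l - L p p) - (l - L j j) by ring]
          exact (norm_sub_le _ _).trans (add_comm _ _).le
        linarith
      simpa using LinearMap.finrank_le_finrank_of_injective hinj
    · push Not at hbot
      rw [(Submodule.eq_bot_iff _).2 hbot, finrank_bot]
      exact zero_le_one
  have hcard : L.charpoly.roots.toFinset.card = N := by
    rw [Multiset.toFinset_card_of_nodup hnodup,
      ← (IsAlgClosed.splits L.charpoly).natDegree_eq_card_roots, charpoly_natDegree_eq_dim,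
      Fintype.card_fin]
  let eqv := (L.charpoly.roots.toFinset.equivFinOfCardEq hcard).symm
  have hre : ∀ i, (((eqv i : ℂ).re : ℝ) : ℂ) = (eqv i : ℂ) := by
    intro i
    apply Complex.ext
    · simp
    · simpa using (hreal _ (Multiset.mem_toFinset.1 (eqv i).2)).symm
  refine ⟨fun i => (eqv i : ℂ).re, fun i j hij => ?_, fun z => ?_⟩
  · apply eqv.injective
    apply Subtype.ext
    rw [← hre i, ← hre j]
    exact congrArg _ hij
  · have h1 : (z • 1 - L).det = ((L.charpoly.roots.map
        fun x => Polynomial.X - Polynomial.C x).prod).eval z := by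
      rw [← hsplit, eval_charpoly, scalar_apply, ← smul_one_eq_diagonal]
    rw [h1, Polynomial.eval_multiset_prod, Multiset.map_map]
    simp only [hre]
    have h2 : (L.charpoly.roots.map
        ((Polynomial.eval z) ∘ fun x => Polynomial.X - Polynomial.C x)).prod =
        ∏ l ∈ L.charpoly.roots.toFinset, (z - l) := by
      rw [Finset.prod_eq_multiset_prod, Multiset.toFinset_val, hnodup.dedup]
      simp
    rw [h2, ← Finset.prod_coe_sort]
    exact (eqv.prod_comp fun l : L.charpoly.roots.toFinset => z - (l : ℂ)).symm

end Symmetrizable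

/-! ### The Gram matrix -/

section Gram

variable {N : ℕ}

/-- The Gram matrix, in the Hardy space, of the functions `e j / (y - x j)`. -/
def gramMatrix (x : Fin N → ℂ) (e : Fin N → Fin 2 → ℂ) : Matrix (Fin N) (Fin N) ℂ :=
  Matrix.of fun j k => Complex.I * (star (e j) ⬝ᵥ e k) * (x k - conj (x j))⁻¹

theorem gramMatrix_isHermitian (x : Fin N → ℂ) (e : Fin N → Fin 2 → ℂ) :
    (gramMatrix x e).IsHermitian := by
  ext j k
  rw [Matrix.conjTranspose_apply, gramMatrix, Matrix.of_apply, Matrix.of_apply, star_mul', star_mul',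
    ← Matrix.star_dotProduct, star_inv₀, star_sub]
  simp only [Complex.star_def, Complex.conj_I, Complex.conj_conj]
  rw [← neg_sub (x k), inv_neg]
  ring

theorem sub_conj_ne_zero {p q : ℂ} (hp : 0 < p.im) (hq : 0 < q.im) : p - conj q ≠ 0 := by
  intro h
  have := congrArg Complex.im h
  simp at this
  linarith

theorem hasDerivAt_cexp_I_mul (p : ℂ) (ξ : ℝ) :
    HasDerivAt (fun ξ : ℝ => Complex.exp (Complex.I * p * ξ))
      (Complex.I * p * Complex.exp (Complex.I * p * ξ)) ξ := by
  have h := ((Complex.ofRealCLM.hasDerivAt (x := ξ)).const_mul (Complex.I * p)).cexp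
  refine h.congr_deriv ?_
  simp [mul_comm]

/-- All derivatives at `ξ = 1` vanish, which is a Vandermonde system with distinct nodes `i x k`. -/
theorem exp_linear_independent {x : Fin N → ℂ} (hx : Function.Injective x) {c : Fin N → ℂ}
    (h : ∀ ξ : ℝ, 0 < ξ → ∑ k, c k * Complex.exp (Complex.I * x k * ξ) = 0) : c = 0 := by
  have key : ∀ n : ℕ, ∀ ξ : ℝ, 0 < ξ →
      ∑ k, c k * (Complex.I * x k) ^ n * Complex.exp (Complex.I * x k * ξ) = 0 := by
    intro n
    induction n with
    | zero => simpa using h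
    | succ n ih =>
      intro ξ hξ
      have h1 : HasDerivAt (fun ξ : ℝ => ∑ k, c k * (Complex.I * x k) ^ n *
          Complex.exp (Complex.I * x k * ξ))
          (∑ k, c k * (Complex.I * x k) ^ n *
            (Complex.I * x k * Complex.exp (Complex.I * x k * ξ))) ξ :=
        HasDerivAt.fun_sum fun k _ => (hasDerivAt_cexp_I_mul (x k) ξ).const_mul _
      have h2 : HasDerivAt (fun ξ : ℝ => ∑ k, c k * (Complex.I * x k) ^ n *
          Complex.exp (Complex.I * x k * ξ)) 0 ξ := by
        refine (hasDerivAt_const ξ (0 : ℂ)).congr_of_eventuallyEq ?_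
        filter_upwards [lt_mem_nhds hξ] with ξ hξ using ih ξ hξ
      rw [← h1.unique h2]
      refine Finset.sum_congr rfl fun k _ => ?_
      ring
  have hinj : Function.Injective fun k => Complex.I * x k := fun j k hjk =>
    hx (mul_left_cancel₀ Complex.I_ne_zero hjk)
  have h1 := Matrix.eq_zero_of_forall_pow_sum_mul_pow_eq_zero hinj
    (v := fun k => c k * Complex.exp (Complex.I * x k * (1 : ℝ))) (fun n => by
      rw [← key n 1 one_pos]
      refine Finset.sum_congr rfl fun k _ => ?_
      ring)
  funext k
  have h2 := congrFun h1 k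
  exact (mul_eq_zero.1 h2).resolve_right (Complex.exp_ne_zero _)

theorem tendsto_cexp_I_mul {p : ℂ} (hp : 0 < p.im) :
    Tendsto (fun ξ : ℝ => Complex.exp (Complex.I * p * ξ)) atTop (𝓝 0) := by
  rw [tendsto_zero_iff_norm_tendsto_zero]
  have h : Tendsto (fun ξ : ℝ => Real.exp (-(p.im * ξ))) atTop (𝓝 0) :=
    Real.tendsto_exp_neg_atTop_nhds_zero.comp (tendsto_id.const_mul_atTop hp)
  refine h.congr fun ξ => ?_
  rw [Complex.norm_exp]
  congr 1
  simp

/-- Since `i / (x k - conj (x j))` is the integral of `exp (i (x k - conj (x j)) ξ)` over `ξ > 0`,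
the quadratic form is the integral of `|w(ξ)|²`, with `w = ∑ u k e k exp (i x k ξ)`. Here `g(ξ)`
plays the role of the integral over `(ξ, ∞)`: it has derivative `-|w|²`, tends to zero at infinity,
and vanishes at `0` by hypothesis. So `w = 0`, and the exponentials are independent. -/
theorem gramMatrix_definite {x : Fin N → ℂ} (hx : Function.Injective x) (him : ∀ j, 0 < (x j).im)
    {e : Fin N → Fin 2 → ℂ} (he : ∀ j, e j ≠ 0) {u : Fin N → ℂ}
    (hu : star u ⬝ᵥ (gramMatrix x e *ᵥ u) = 0) : u = 0 := by
  set g : ℝ → ℂ := fun ξ => ∑ j, ∑ k, conj (u j) * u k * gramMatrix x e j k *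
    Complex.exp (Complex.I * (x k - conj (x j)) * ξ) with hg
  have hg0 : g 0 = 0 := by
    rw [← hu, hg]
    simp only [dotProduct, Matrix.mulVec, Finset.mul_sum]
    refine Finset.sum_congr rfl fun j _ => Finset.sum_congr rfl fun k _ => ?_
    simp
    ring
  set w : ℝ → Fin 2 → ℂ := fun ξ i => ∑ k, u k * e k i * Complex.exp (Complex.I * x k * ξ) with hw
  have hderiv : ∀ ξ : ℝ, HasDerivAt g ((-∑ i, ‖w ξ i‖ ^ 2 : ℝ) : ℂ) ξ := by
    intro ξ
    have h1 : HasDerivAt g (∑ j, ∑ k, conj (u j) * u k * gramMatrix x e j k *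
        (Complex.I * (x k - conj (x j)) * Complex.exp (Complex.I * (x k - conj (x j)) * ξ))) ξ :=
      HasDerivAt.fun_sum fun j _ => HasDerivAt.fun_sum fun k _ =>
        (hasDerivAt_cexp_I_mul (x k - conj (x j)) ξ).const_mul _
    refine h1.congr_deriv ?_
    have h2 : ∀ i, ((‖w ξ i‖ ^ 2 : ℝ) : ℂ) = ∑ j, ∑ k, conj (u j) * u k * (conj (e j i) * e k i) *
        Complex.exp (Complex.I * (x k - conj (x j)) * ξ) := by
      intro i
      rw [Complex.ofReal_pow, ← Complex.conj_mul', hw, map_sum, Finset.sum_mul_sum]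
      refine Finset.sum_congr rfl fun j _ => Finset.sum_congr rfl fun k _ => ?_
      rw [map_mul, map_mul, ← Complex.exp_conj]
      rw [show Complex.I * (x k - conj (x j)) * ξ =
        conj (Complex.I * x j * ξ) + Complex.I * x k * ξ by simp; ring, Complex.exp_add]
      ring
    push_cast
    simp only [← Complex.ofReal_pow]
    simp only [h2]
    rw [Finset.sum_comm (s := Finset.univ (α := Fin 2)), ← Finset.sum_neg_distrib]
    refine Finset.sum_congr rfl fun j _ => ?_
    rw [Finset.sum_comm (s := Finset.univ (α := Fin 2)), ← Finset.sum_neg_distrib]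
    refine Finset.sum_congr rfl fun k _ => ?_
    have hne := sub_conj_ne_zero (him k) (him j)
    rw [← Finset.sum_mul, ← Finset.mul_sum]
    have h3 : ∑ i, conj (e j i) * e k i = star (e j) ⬝ᵥ e k := rfl
    rw [h3, gramMatrix, Matrix.of_apply]
    field_simp
    rw [Complex.I_sq]
    ring
  have hre : ∀ ξ : ℝ, HasDerivAt (fun ξ => (g ξ).re) (-∑ i, ‖w ξ i‖ ^ 2) ξ := fun ξ =>
    Complex.reCLM.hasFDerivAt.comp_hasDerivAt ξ (hderiv ξ)
  have hanti : Antitone fun ξ => (g ξ).re :=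
    antitone_of_deriv_nonpos (fun ξ => (hre ξ).differentiableAt) fun ξ => by
      rw [(hre ξ).deriv]
      exact neg_nonpos.2 (Finset.sum_nonneg fun i _ => by positivity)
  have hlim : Tendsto (fun ξ => (g ξ).re) atTop (𝓝 0) := by
    have h1 : Tendsto g atTop (𝓝 (∑ j : Fin N, ∑ k : Fin N,
        conj (u j) * u k * gramMatrix x e j k * 0)) :=
      tendsto_finsetSum _ fun j _ => tendsto_finsetSum _ fun k _ =>
        (tendsto_cexp_I_mul (p := x k - conj (x j)) (by
          have := him j
          have := him k
          simp
          linarith)).const_mul _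
    simp only [mul_zero, Finset.sum_const_zero] at h1
    simpa [Function.comp_def] using (Complex.continuous_re.tendsto 0).comp h1
  have hzero : ∀ ξ : ℝ, 0 ≤ ξ → (g ξ).re = 0 := by
    intro ξ hξ
    refine le_antisymm ?_ (hanti.le_of_tendsto hlim ξ)
    have := hanti hξ
    simpa [hg0] using this
  have hwz : ∀ ξ : ℝ, 0 < ξ → ∀ i, w ξ i = 0 := by
    intro ξ hξ i
    have h1 : HasDerivAt (fun ξ => (g ξ).re) 0 ξ := by
      refine (hasDerivAt_const ξ (0 : ℝ)).congr_of_eventuallyEq ?_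
      filter_upwards [lt_mem_nhds hξ] with ξ hξ using hzero ξ hξ.le
    have h2 := (hre ξ).unique h1
    rw [neg_eq_zero, Finset.sum_eq_zero_iff_of_nonneg fun i _ => by positivity] at h2
    simpa using h2 i (Finset.mem_univ i)
  funext k
  obtain ⟨i, hi⟩ := Function.ne_iff.1 (he k)
  have h1 := congrFun (exp_linear_independent hx (c := fun k => u k * e k i)
    fun ξ hξ => hwz ξ hξ i) k
  exact (mul_eq_zero.1 h1).resolve_right hi

/-- The relation `B_k e_k = -v_k e_k` eliminates the velocities from the entries of the product.
After partial fractions (`key`), conjugate transposition exchanges the two remaining sums and fixes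
the `M₀` term. -/
theorem gramMatrix_mul_laxMatrix_isHermitian {x v : Fin N → ℂ} (hx : Function.Injective x)
    (him : ∀ j, 0 < (x j).im) {e f : Fin N → Fin 2 → ℂ} {M₀ : Matrix (Fin 2) (Fin 2) ℂ}
    (hM₀ : M₀.IsHermitian) (hef : ∀ j, f j ⬝ᵥ e j = 0)
    (h : ∀ j, (M₀ + ∑ k, (x j - x k)⁻¹ • Matrix.vecMulVec (e k) (f k) +
      ∑ k, (x j - conj (x k))⁻¹ • (Matrix.vecMulVec (e k) (f k))ᴴ) *ᵥ e j = -(v j • e j)) :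
    (gramMatrix x e * laxMatrix x v e f).IsHermitian := by
  set a : Fin N → Fin N → Fin N → ℂ := fun j l k => (star (e j) ⬝ᵥ e l) * (f l ⬝ᵥ e k) with ha
  have hconj : ∀ j l k, star (e j) ⬝ᵥ ((Matrix.vecMulVec (e l) (f l))ᴴ *ᵥ e k) = conj (a k l j) := by
    intro j l k
    rw [Matrix.conjTranspose_vecMulVec, Matrix.vecMulVec_mulVec, dotProduct_smul, ha]
    simp only [MulOpposite.smul_eq_mul_unop, MulOpposite.unop_op, map_mul]
    rw [← Complex.star_def, ← Matrix.star_dotProduct, ← Matrix.star_dotProduct_star, mul_comm]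
  have hB : ∀ j k, star (e j) ⬝ᵥ (M₀ *ᵥ e k) + ∑ l, (x k - x l)⁻¹ * a j l k +
      ∑ l, (x k - conj (x l))⁻¹ * conj (a k l j) = -(v k * (star (e j) ⬝ᵥ e k)) := by
    intro j k
    have h1 := congrArg (star (e j) ⬝ᵥ ·) (h k)
    simp only [Matrix.add_mulVec, Matrix.sum_mulVec, Matrix.smul_mulVec, dotProduct_add,
      dotProduct_sum, dotProduct_smul, hconj, dotProduct_neg, smul_eq_mul] at h1
    rw [← h1]
    congr 2
    refine Finset.sum_congr rfl fun l _ => ?_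
    rw [Matrix.vecMulVec_mulVec, dotProduct_smul]
    simp only [MulOpposite.smul_eq_mul_unop, MulOpposite.unop_op, ha]
  have key : ∀ j k, (gramMatrix x e * laxMatrix x v e f) j k =
      Complex.I * (x k - conj (x j))⁻¹ * (-(star (e j) ⬝ᵥ (M₀ *ᵥ e k)) +
        ∑ l, (x l - conj (x j))⁻¹ * a j l k - ∑ l, (x k - conj (x l))⁻¹ * conj (a k l j)) := by
    intro j k
    have h1 : (gramMatrix x e * laxMatrix x v e f) j k =
        Complex.I * (x k - conj (x j))⁻¹ * (v k * (star (e j) ⬝ᵥ e k)) -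
          ∑ l, Complex.I * ((x l - conj (x j))⁻¹ * (x l - x k)⁻¹) * a j l k := by
      simp only [Matrix.mul_apply, laxMatrix_apply, mul_sub, Finset.sum_sub_distrib, mul_ite,
        mul_zero, Finset.sum_ite_eq', Finset.mem_univ, if_true, gramMatrix, Matrix.of_apply, ha]
      congr 1
      · ring
      · refine Finset.sum_congr rfl fun l _ => ?_
        ring
    have h2 : v k * (star (e j) ⬝ᵥ e k) = -(star (e j) ⬝ᵥ (M₀ *ᵥ e k) +
        ∑ l, (x k - x l)⁻¹ * a j l k + ∑ l, (x k - conj (x l))⁻¹ * conj (a k l j)) := by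
      rw [hB, neg_neg]
    have h3 : ∑ l, Complex.I * ((x l - conj (x j))⁻¹ * (x l - x k)⁻¹) * a j l k =
        -(Complex.I * (x k - conj (x j))⁻¹ * ∑ l, (x k - x l)⁻¹ * a j l k) -
        Complex.I * (x k - conj (x j))⁻¹ * ∑ l, (x l - conj (x j))⁻¹ * a j l k := by
      rw [Finset.mul_sum, Finset.mul_sum, ← Finset.sum_neg_distrib, ← Finset.sum_sub_distrib]
      refine Finset.sum_congr rfl fun l _ => ?_
      by_cases hlk : l = k
      · subst hlk
        have haz : a j l l = 0 := by simp only [ha, hef, mul_zero]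
        simp only [haz, mul_zero, neg_zero, sub_zero]
      · have e1 := sub_ne_zero.2 (hx.ne hlk)
        have e2 := sub_conj_ne_zero (him l) (him j)
        have e3 := sub_conj_ne_zero (him k) (him j)
        rw [← neg_sub (x l) (x k), inv_neg]
        field_simp
        ring
    rw [h1, h2, h3]
    ring
  ext j k
  rw [Matrix.conjTranspose_apply, key, key]
  have hM : star (star (e k) ⬝ᵥ (M₀ *ᵥ e j)) = star (e j) ⬝ᵥ (M₀ *ᵥ e k) :=
    star_dotProduct_mulVec_of_isHermitian hM₀ _ _
  simp only [Complex.star_def] at hM ⊢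
  simp only [map_mul, map_sub, map_add, map_neg, map_sum, map_inv₀, hM, Complex.conj_I,
    Complex.conj_conj]
  rw [← neg_sub (x k) (conj (x j)), inv_neg]
  have e2 : ∑ l, (conj (x l) - x k)⁻¹ * conj (a k l j) =
      -∑ l, (x k - conj (x l))⁻¹ * conj (a k l j) := by
    rw [← Finset.sum_neg_distrib]
    refine Finset.sum_congr rfl fun l _ => ?_
    rw [← neg_sub (x k) (conj (x l)), inv_neg]
    ring
  have e3 : ∑ l, (conj (x j) - x l)⁻¹ * a j l k = -∑ l, (x l - conj (x j))⁻¹ * a j l k := by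
    rw [← Finset.sum_neg_distrib]
    refine Finset.sum_congr rfl fun l _ => ?_
    rw [← neg_sub (x l) (conj (x j)), inv_neg]
    ring
  rw [e2, e3]
  ring

end Gram

/-! ### The initial condition -/

theorem norm_dotProduct_le (f e : Fin 2 → ℂ) :
    ‖f ⬝ᵥ e‖ ≤ ‖(WithLp.toLp 2 f : EuclideanSpace ℂ (Fin 2))‖ *
      ‖(WithLp.toLp 2 e : EuclideanSpace ℂ (Fin 2))‖ := by
  have h := norm_inner_le_norm (𝕜 := ℂ) (WithLp.toLp 2 (star f) : EuclideanSpace ℂ (Fin 2))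
    (WithLp.toLp 2 e)
  rw [EuclideanSpace.inner_toLp_toLp, star_star, dotProduct_comm] at h
  refine h.trans_eq ?_
  congr 1
  simp [EuclideanSpace.norm_eq]

/-- The left side is the Frobenius norm of `pauli s`, which is `√2 ‖s‖`. -/
theorem norm_mul_norm_of_vecMulVec_eq {e f : Fin 2 → ℂ} {s : C3}
    (h : Matrix.vecMulVec e f = pauli s) :
    ‖(WithLp.toLp 2 e : EuclideanSpace ℂ (Fin 2))‖ *
      ‖(WithLp.toLp 2 f : EuclideanSpace ℂ (Fin 2))‖ ≤ 2 * ‖s‖ := by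
  have hent : ∀ i k, e i * f k = pauli s i k := fun i k => congrFun (congrFun h i) k
  have hsq : ∀ z w : ℂ, ‖z - Complex.I * w‖ ^ 2 + ‖z + Complex.I * w‖ ^ 2 =
      2 * ‖z‖ ^ 2 + 2 * ‖w‖ ^ 2 := by
    intro z w
    simp only [← Complex.normSq_eq_norm_sq, Complex.normSq_apply]
    simp
    ring
  have h00 := congrArg (‖·‖ ^ 2) (hent 0 0)
  have h01 := congrArg (‖·‖ ^ 2) (hent 0 1)
  have h10 := congrArg (‖·‖ ^ 2) (hent 1 0)
  have h11 := congrArg (‖·‖ ^ 2) (hent 1 1)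
  simp only [pauli_apply, Matrix.of_apply, Matrix.cons_val', Matrix.cons_val_zero,
    Matrix.cons_val_one, Matrix.cons_val_fin_one, norm_mul, mul_pow, norm_neg, Fin.isValue]
    at h00 h01 h10 h11
  refine le_of_sq_le_sq ?_ (by positivity)
  rw [mul_pow, mul_pow, EuclideanSpace.norm_sq_eq, EuclideanSpace.norm_sq_eq,
    EuclideanSpace.norm_sq_eq, Fin.sum_univ_two, Fin.sum_univ_two, Fin.sum_univ_three]
  have := hsq (s 0) (s 1)
  simp only
  nlinarith [sq_nonneg ‖s 0‖, sq_nonneg ‖s 1‖, sq_nonneg ‖s 2‖]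

theorem lt_of_alpha_pos {N : ℕ} {s : Fin N → ℝ → C3} {x : Fin N → ℝ → ℂ} {t : ℝ}
    (hα : 0 < alpha s x t) (hs : ∀ j, s j t ≠ 0) {j k p q : Fin N} (hjk : j ≠ k) (hpq : p ≠ q)
    (l : Fin N) :
    16 * N * ‖s l t‖ < |(x j t).re - (x k t).re| * |(deriv (x p) t).re - (deriv (x q) t).re| := by
  have hD : poleGap x t ≤ ENNReal.ofReal |(x j t).re - (x k t).re| :=
    iInf_le_of_le j (iInf_le_of_le k (iInf_le _ hjk))
  have hν : velocityGap x t ≤ ENNReal.ofReal |(deriv (x p) t).re - (deriv (x q) t).re| :=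
    iInf_le_of_le p (iInf_le_of_le q (iInf_le _ hpq))
  have hS : ENNReal.ofReal ‖s l t‖ ≤ spinSize s t :=
    le_iSup (fun j => ENNReal.ofReal ‖s j t‖) l
  have h1 : 2 ^ 4 * (N : ℝ≥0∞) * spinSize s t / velocityGap x t < poleGap x t :=
    tsub_pos_iff_lt.1 hα
  have h2 : 2 ^ 4 * (N : ℝ≥0∞) * ENNReal.ofReal ‖s l t‖ /
      ENNReal.ofReal |(deriv (x p) t).re - (deriv (x q) t).re| <
      ENNReal.ofReal |(x j t).re - (x k t).re| :=
    (ENNReal.div_le_div (mul_le_mul_right hS _) hν).trans_lt (h1.trans_le hD)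
  have hN : 0 < (N : ℝ) := by exact_mod_cast (Fin.pos j)
  have hpos : 0 < ‖s l t‖ := norm_pos_iff.2 (hs l)
  have h3 : 2 ^ 4 * (N : ℝ≥0∞) * ENNReal.ofReal ‖s l t‖ = ENNReal.ofReal (16 * N * ‖s l t‖) := by
    rw [ENNReal.ofReal_mul (by positivity), ENNReal.ofReal_mul (by positivity),
      ENNReal.ofReal_natCast]
    norm_num
  rw [h3] at h2
  -- Were this gap zero, the quotient would be `∞` because the spin is nonzero, contradicting `h2`.
  have hνpos : 0 < |(deriv (x p) t).re - (deriv (x q) t).re| := by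
    by_contra hcon
    rw [ENNReal.ofReal_of_nonpos (not_lt.1 hcon), ENNReal.div_zero (by
      rw [Ne, ENNReal.ofReal_eq_zero, not_le]
      positivity)] at h2
    exact not_top_lt h2
  rw [← ENNReal.ofReal_div_of_pos hνpos, ENNReal.ofReal_lt_ofReal_iff_of_nonneg (by positivity),
    div_lt_iff₀ hνpos] at h2
  exact h2

/-- The only use of `α(t₀) > 0` is to make the Gershgorin discs of the Lax matrix at `t₀` disjoint.
-/
theorem IsRationalSolution.exists_asymptotic_velocities {N : ℕ} {T t₀ : ℝ} (hT : T < t₀)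
    {m : ℝ → ℝ → R3} {m₀ : R3} {s : Fin N → ℝ → C3} {x : Fin N → ℝ → ℂ}
    (hm : IsRationalSolution (Set.Ioi T) m m₀ s x) (hα : 0 < alpha s x t₀) :
    ∃ w : Fin N → ℝ, Function.Injective w ∧ ∃ X L : Matrix (Fin N) (Fin N) ℂ,
      (∀ z : ℂ, (z • 1 - L).det = ∏ i, (z - w i)) ∧
      ∀ t, T < t → ∀ z : ℂ, ∏ j, (z - x j t) = (z • 1 - (X + ((t - t₀ : ℝ) : ℂ) • L)).det := by
  have hI : IsOpen (Set.Ioi T) := isOpen_Ioi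
  have ht₀ : t₀ ∈ Set.Ioi T := hT
  choose e f hef using fun j =>
    exists_vecMulVec_eq (hm.pauli_spin_mul_self hI ht₀ j) (hm.pauli_spin_ne_zero ht₀ j)
  have hne : ∀ j, Matrix.vecMulVec (e j) (f j) ≠ 0 := fun j => by
    rw [hef]; exact hm.pauli_spin_ne_zero ht₀ j
  have hfe : ∀ j, f j ⬝ᵥ e j = 0 := by
    intro j
    have hsq := hm.pauli_spin_mul_self hI ht₀ j
    rw [← hef, Matrix.vecMulVec_mul_vecMulVec, Matrix.vecMulVec_smul] at hsq
    exact (smul_eq_zero.1 hsq).resolve_right (hne j)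
  have he0 : ∀ j, e j ≠ 0 := fun j h => hne j (by rw [h, Matrix.zero_vecMulVec])
  have hf0 : ∀ j, f j ≠ 0 := fun j h => hne j (by rw [h, Matrix.vecMulVec_zero])
  -- `S B = x' S` and anticommutation give `B S = -x' S`; a nonzero component of `f j` is then
  -- cancelled.
  have hB : ∀ j, (pauli (toC m₀) + ∑ k, (x j t₀ - x k t₀)⁻¹ • Matrix.vecMulVec (e k) (f k) +
      ∑ k, (x j t₀ - conj (x k t₀))⁻¹ • (Matrix.vecMulVec (e k) (f k))ᴴ) *ᵥ e j =
      -(deriv (x j) t₀ • e j) := by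
    intro j
    have h1 := hm.pole_equation_upper hI ht₀ j
    have h2 := hm.anticommute_upper hI ht₀ j
    rw [← h1] at h2
    simp only [hef]
    have h3 := eq_neg_of_add_eq_zero_right h2
    obtain ⟨q, hq⟩ := Function.ne_iff.1 (hf0 j)
    ext i
    have h4 := congrFun (congrFun h3 i) q
    rw [← hef j, Matrix.mul_vecMulVec, Matrix.vecMulVec_apply, Matrix.neg_apply, Matrix.smul_apply,
      Matrix.vecMulVec_apply] at h4
    refine mul_right_cancel₀ hq (h4.trans ?_)
    simp
    ring
  have hM₀ : (pauli (toC m₀)).IsHermitian := by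
    rw [Matrix.IsHermitian, ← pauli_conjC]
    congr 1
    ext i
    simp [conjC, toC]
  set c : Fin N → Fin N → ℝ := fun j k => 2 * ‖s j t₀‖ / ‖x j t₀ - x k t₀‖ with hc
  have hxpos : ∀ {j k}, j ≠ k → 0 < ‖x j t₀ - x k t₀‖ := fun hjk =>
    norm_pos_iff.2 (sub_ne_zero.2 ((hm.poles_distinct t₀ ht₀).ne hjk))
  -- From `16 N |s| < D ν` each `c i k` is at most `ν / (8N)`. The radii are then at most `ν / 8`,
  -- and two of them add up to less than `ν`.
  have hcν : ∀ {j p : Fin N}, j ≠ p → ∀ i k, i ≠ k →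
      c i k ≤ |(deriv (x j) t₀).re - (deriv (x p) t₀).re| / (8 * N) := by
    intro j p hjp i k hik
    have hN : 0 < (N : ℝ) := by exact_mod_cast (Fin.pos j)
    have h1 := lt_of_alpha_pos hα (hm.spin_ne_zero t₀ ht₀) hik hjp i
    have h2 : |(x i t₀).re - (x k t₀).re| ≤ ‖x i t₀ - x k t₀‖ := by
      rw [← Complex.sub_re]; exact Complex.abs_re_le_norm _
    rw [hc, div_le_div_iff₀ (hxpos hik) (by positivity)]
    nlinarith [mul_le_mul_of_nonneg_right h2
      (abs_nonneg ((deriv (x j) t₀).re - (deriv (x p) t₀).re))]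
  have hcsum : ∀ {j p : Fin N}, j ≠ p → ∀ i, ∑ k ∈ Finset.univ.erase i, c i k ≤
      |(deriv (x j) t₀).re - (deriv (x p) t₀).re| / 8 := by
    intro j p hjp i
    have hN : 0 < (N : ℝ) := by exact_mod_cast (Fin.pos j)
    calc ∑ k ∈ Finset.univ.erase i, c i k
        ≤ ∑ _k ∈ Finset.univ.erase i, |(deriv (x j) t₀).re - (deriv (x p) t₀).re| / (8 * N) :=
          Finset.sum_le_sum fun k hk => hcν hjp i k (Finset.ne_of_mem_erase hk).symm
      _ ≤ ∑ _k : Fin N, |(deriv (x j) t₀).re - (deriv (x p) t₀).re| / (8 * N) :=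
          Finset.sum_le_sum_of_subset_of_nonneg (Finset.erase_subset _ _)
            fun _ _ _ => by positivity
      _ = |(deriv (x j) t₀).re - (deriv (x p) t₀).re| / 8 := by
          rw [Finset.sum_const, Finset.card_univ, Fintype.card_fin, nsmul_eq_mul]
          field_simp
  have hdiag : ∀ j, laxMatrix (fun j => x j t₀) (fun j => deriv (x j) t₀) e f j j =
      deriv (x j) t₀ := by
    intro j
    simp [laxMatrix_apply]
  obtain ⟨w, hw, hdet⟩ := exists_injective_det_eq_prod
    (G := gramMatrix (fun j => x j t₀) e)
    (L := laxMatrix (fun j => x j t₀) (fun j => deriv (x j) t₀) e f)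
    (gramMatrix_isHermitian _ _)
    (gramMatrix_mul_laxMatrix_isHermitian (hm.poles_distinct t₀ ht₀) (hm.im_pos t₀ ht₀) hM₀ hfe hB)
    (fun u hu => gramMatrix_definite (hm.poles_distinct t₀ ht₀) (hm.im_pos t₀ ht₀) he0 hu)
    (a := fun j => ‖(WithLp.toLp 2 (e j) : EuclideanSpace ℂ (Fin 2))‖)
    (fun j => norm_pos_iff.2 fun h => he0 j (by simpa using h))
    (c := c) (fun j k hjk => by
      rw [laxMatrix_apply, if_neg hjk, zero_sub, norm_neg, norm_mul, norm_inv]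
      have h1 := norm_dotProduct_le (f j) (e k)
      have h2 := norm_mul_norm_of_vecMulVec_eq (hef j)
      have h3 := hxpos hjk
      calc _ ≤ ‖(WithLp.toLp 2 (e j) : EuclideanSpace ℂ (Fin 2))‖ * (‖x j t₀ - x k t₀‖⁻¹ *
            (‖(WithLp.toLp 2 (f j) : EuclideanSpace ℂ (Fin 2))‖ *
              ‖(WithLp.toLp 2 (e k) : EuclideanSpace ℂ (Fin 2))‖)) := by gcongr
        _ = (‖(WithLp.toLp 2 (e j) : EuclideanSpace ℂ (Fin 2))‖ *
            ‖(WithLp.toLp 2 (f j) : EuclideanSpace ℂ (Fin 2))‖) * ‖x j t₀ - x k t₀‖⁻¹ *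
              ‖(WithLp.toLp 2 (e k) : EuclideanSpace ℂ (Fin 2))‖ := by ring
        _ ≤ (2 * ‖s j t₀‖) * ‖x j t₀ - x k t₀‖⁻¹ *
              ‖(WithLp.toLp 2 (e k) : EuclideanSpace ℂ (Fin 2))‖ := by gcongr
        _ = _ := by simp only [hc, div_eq_mul_inv])
    (fun j k _ => by positivity)
    (fun j p hjp => by
      have h1 := hcsum hjp j
      have h2 := hcsum hjp p
      have h3 := lt_of_alpha_pos hα (hm.spin_ne_zero t₀ ht₀) hjp hjp j
      have h4 : 0 < |(deriv (x j) t₀).re - (deriv (x p) t₀).re| := by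
        by_contra hcon
        rw [le_antisymm (not_lt.1 hcon) (abs_nonneg _), mul_zero] at h3
        have : 0 ≤ 16 * N * ‖s j t₀‖ := by positivity
        linarith
      rw [hdiag, hdiag]
      have h5 : |(deriv (x j) t₀).re - (deriv (x p) t₀).re| ≤
          ‖deriv (x j) t₀ - deriv (x p) t₀‖ := by
        rw [← Complex.sub_re]; exact Complex.abs_re_le_norm _
      linarith)
  exact ⟨w, hw, Matrix.diagonal fun j => x j t₀, _, hdet,
    fun t ht z => hm.prod_sub_pole hT ht hef z⟩

/-! ### Separation of the poles for large times -/

theorem exists_pos_le_abs_sub {N : ℕ} {w : Fin N → ℝ} (hw : Function.Injective w) :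
    ∃ g : ℝ, 0 < g ∧ ∀ i j, i ≠ j → g ≤ |w i - w j| := by
  have h : ∀ p : {p : Fin N × Fin N // p.1 ≠ p.2}, ∀ᶠ g in 𝓝[>] (0 : ℝ),
      g ≤ |w p.1.1 - w p.1.2| := by
    rintro ⟨⟨i, j⟩, hij⟩
    have : 0 < |w i - w j| := abs_pos.2 (sub_ne_zero.2 (hw.ne hij))
    exact mem_nhdsWithin_of_mem_nhds (ge_mem_nhds this)
  obtain ⟨g, hg, hg0⟩ := ((eventually_all.2 h).and self_mem_nhdsWithin).exists
  exact ⟨g, hg0, fun i j hij => hg ⟨⟨i, j⟩, hij⟩⟩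

/-- A small product forces some `y j` close to each `w i`. The gap between the `w i` makes this
choice injective, hence bijective, so every `y j` is close to some `w i`. The labelling may vary
with `t`. -/
theorem localization_of_tendsto_prod {N : ℕ} {w : Fin N → ℝ} {g : ℝ} (hg : 0 < g)
    (hw : ∀ i j, i ≠ j → g ≤ |w i - w j|) {y : Fin N → ℝ → ℂ}
    (hy : ∀ i, Tendsto (fun t => ∏ j, ((w i : ℂ) - y j t)) atTop (𝓝 0)) :
    (∀ᶠ t in atTop, ∀ j k, j ≠ k → g / 2 ≤ ‖y j t - y k t‖) ∧
      ∀ ε : ℝ, 0 < ε → ∀ᶠ t in atTop, ∀ j, ∃ i, ‖(w i : ℂ) - y j t‖ < ε := by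
  have hdist : ∀ i j, i ≠ j → g ≤ ‖(w i : ℂ) - w j‖ := by
    intro i j hij
    rw [← Complex.ofReal_sub, Complex.norm_real]
    exact hw i j hij
  have hex : ∀ ε : ℝ, 0 < ε → ∀ᶠ t in atTop, ∀ i, ∃ j, ‖(w i : ℂ) - y j t‖ < ε := by
    intro ε hε
    refine eventually_all.2 fun i => ?_
    have h1 : ∀ᶠ t in atTop, ‖∏ j, ((w i : ℂ) - y j t)‖ < ε ^ N := by
      have := (tendsto_zero_iff_norm_tendsto_zero.1 (hy i)).eventually_lt_const (pow_pos hε N)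
      exact this
    filter_upwards [h1] with t ht
    by_contra! hcon
    rw [norm_prod] at ht
    refine absurd ht (not_lt.2 ?_)
    calc ε ^ N = ∏ _j : Fin N, ε := by simp
      _ ≤ ∏ j, ‖(w i : ℂ) - y j t‖ := Finset.prod_le_prod (fun _ _ => hε.le) fun j _ => hcon j
  have hbij : ∀ ε : ℝ, 0 < ε → ε ≤ g / 4 → ∀ᶠ t in atTop, ∃ σ : Fin N → Fin N,
      Function.Bijective σ ∧ ∀ i, ‖(w i : ℂ) - y (σ i) t‖ < ε := by
    intro ε hε hεg
    filter_upwards [hex ε hε] with t ht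
    choose σ hσ using ht
    refine ⟨σ, Finite.injective_iff_bijective.1 fun i i' hii => ?_, hσ⟩
    by_contra hne
    have h1 := hdist i i' hne
    have h2 := hσ i
    have h3 := hσ i'
    rw [← hii] at h3
    have h4 : ‖(w i : ℂ) - w i'‖ ≤ ‖(w i : ℂ) - y (σ i) t‖ + ‖(w i' : ℂ) - y (σ i) t‖ := by
      rw [show (w i : ℂ) - w i' = (w i - y (σ i) t) - (w i' - y (σ i) t) by ring]
      exact norm_sub_le _ _
    linarith
  constructor
  · filter_upwards [hbij (g / 4) (by positivity) le_rfl] with t ⟨σ, hσ, hσ'⟩ j k hjk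
    obtain ⟨i, rfl⟩ := hσ.2 j
    obtain ⟨i', rfl⟩ := hσ.2 k
    have h1 := hdist i i' fun h => hjk (h ▸ rfl)
    have h2 := hσ' i
    have h3 := hσ' i'
    have h4 : ‖(w i : ℂ) - w i'‖ ≤ ‖(w i : ℂ) - y (σ i) t‖ + ‖(w i' : ℂ) - y (σ i') t‖ +
        ‖y (σ i) t - y (σ i') t‖ := by
      rw [show (w i : ℂ) - w i' = (w i - y (σ i) t) - (w i' - y (σ i') t) +
        (y (σ i) t - y (σ i') t) by ring]
      exact (norm_add_le _ _).trans (add_le_add_left (norm_sub_le _ _) _)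
    linarith
  · intro ε hε
    filter_upwards [hbij (min ε (g / 4)) (by positivity) (min_le_right _ _)] with t ⟨σ, hσ, hσ'⟩ j
    obtain ⟨i, rfl⟩ := hσ.2 j
    exact ⟨i, (hσ' i).trans_le (min_le_left _ _)⟩

/-- The rescaled poles `x j / (t - t₀)` are the eigenvalues of `L + X / (t - t₀)`, which converge to
the real and distinct `w i`. -/
theorem IsRationalSolution.poles_separate {N : ℕ} {T t₀ : ℝ} (hT : T < t₀)
    {m : ℝ → ℝ → R3} {m₀ : R3} {s : Fin N → ℝ → C3} {x : Fin N → ℝ → ℂ}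
    (hm : IsRationalSolution (Set.Ioi T) m m₀ s x) (hα : 0 < alpha s x t₀) :
    ∃ g : ℝ, 0 < g ∧ (∀ᶠ t in atTop, ∀ j k, j ≠ k → g * t ≤ ‖x j t - x k t‖) ∧
      ∀ ε : ℝ, 0 < ε → ∀ᶠ t in atTop, ∀ j, (x j t).im ≤ ε * t := by
  obtain ⟨w, hw, X, L, hL, hX⟩ := hm.exists_asymptotic_velocities hT hα
  obtain ⟨g, hg, hgw⟩ := exists_pos_le_abs_sub hw
  have hτ : Tendsto (fun t : ℝ => (((t - t₀)⁻¹ : ℝ) : ℂ)) atTop (𝓝 0) := by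
    have h := tendsto_inv_atTop_zero.comp (tendsto_atTop_add_const_right atTop (-t₀) tendsto_id)
    simpa [sub_eq_add_neg, Function.comp_def] using (Complex.continuous_ofReal.tendsto 0).comp h
  obtain ⟨h1, h2⟩ := localization_of_tendsto_prod hg hgw
    (y := fun j t => (((t - t₀)⁻¹ : ℝ) : ℂ) * x j t) (by
    intro i
    have hcont : Continuous fun c : ℂ => ((w i : ℂ) • 1 - (c • X + L)).det :=
      Continuous.matrix_det (by fun_prop)
    have hlim := (hcont.tendsto 0).comp hτ
    simp only [zero_smul, zero_add, hL] at hlim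
    rw [Finset.prod_eq_zero (Finset.mem_univ i) (sub_self _)] at hlim
    refine hlim.congr' ?_
    filter_upwards [eventually_gt_atTop t₀] with t ht
    have hne : ((t - t₀ : ℝ) : ℂ) ≠ 0 := by exact_mod_cast (sub_pos.2 ht).ne'
    have h3 := hX t (hT.trans ht) (((t - t₀ : ℝ) : ℂ) * w i)
    have h4 : (((t - t₀ : ℝ) : ℂ) * w i) • (1 : Matrix (Fin N) (Fin N) ℂ) -
        (X + ((t - t₀ : ℝ) : ℂ) • L) = ((t - t₀ : ℝ) : ℂ) •
          ((w i : ℂ) • 1 - ((((t - t₀)⁻¹ : ℝ) : ℂ) • X + L)) := by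
      rw [Complex.ofReal_inv, smul_sub, smul_add, smul_smul, smul_smul, mul_inv_cancel₀ hne,
        one_smul]
    rw [h4, Matrix.det_smul, Fintype.card_fin] at h3
    have h5 : ∀ j, ((t - t₀ : ℝ) : ℂ) * w i - x j t =
        ((t - t₀ : ℝ) : ℂ) * ((w i : ℂ) - (((t - t₀)⁻¹ : ℝ) : ℂ) * x j t) := by
      intro j
      rw [Complex.ofReal_inv, mul_sub, ← mul_assoc, mul_inv_cancel₀ hne, one_mul]
    simp only [h5, Finset.prod_mul_distrib, Finset.prod_const, Finset.card_univ,
      Fintype.card_fin] at h3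
    exact (mul_left_cancel₀ (pow_ne_zero _ hne) h3).symm)
  have hlarge : ∀ᶠ t : ℝ in atTop, 0 < t - t₀ ∧ t ≤ 2 * (t - t₀) ∧ t - t₀ ≤ 2 * t := by
    filter_upwards [eventually_gt_atTop (2 * |t₀|), eventually_gt_atTop (0 : ℝ)] with t ht ht'
    have := le_abs_self t₀
    have := neg_abs_le t₀
    refine ⟨?_, ?_, ?_⟩ <;> linarith [abs_nonneg t₀]
  refine ⟨g / 4, by positivity, ?_, fun ε hε => ?_⟩
  · filter_upwards [h1, hlarge] with t ht ⟨hpos, hle, _⟩ j k hjk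
    have h3 := ht j k hjk
    rw [← mul_sub, norm_mul, Complex.norm_real, Real.norm_of_nonneg (by positivity),
      ← div_eq_inv_mul, le_div_iff₀ hpos] at h3
    nlinarith
  · filter_upwards [h2 (ε / 2) (by positivity), hlarge] with t ht ⟨hpos, _, hle⟩ j
    obtain ⟨i, hi⟩ := ht j
    have h3 := (Complex.abs_im_le_norm _).trans_lt hi
    rw [Complex.sub_im, Complex.ofReal_im, zero_sub, abs_neg, Complex.im_ofReal_mul] at h3
    have h4 := (le_abs_self _).trans_lt h3
    rw [← div_eq_inv_mul, div_lt_iff₀ hpos] at h4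
    nlinarith

/-! ### Bounds for the equations of motion -/

theorem norm_conjC (u : C3) : ‖conjC u‖ = ‖u‖ := by
  simp [EuclideanSpace.norm_eq, conjC]

/-- This makes the self-interaction of a pole with its own conjugate equal to `|s_j|²` up to a
factor, the source of the bound in `exists_norm_spin_le`. -/
theorem pauli_mul_conjTranspose_add (u : C3) :
    pauli u * (pauli u)ᴴ + (pauli u)ᴴ * pauli u = ((2 * ‖u‖ ^ 2 : ℝ) : ℂ) • 1 := by
  have hn : ((‖u‖ ^ 2 : ℝ) : ℂ) = u 0 * conj (u 0) + u 1 * conj (u 1) + u 2 * conj (u 2) := by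
    rw [EuclideanSpace.norm_sq_eq, Fin.sum_univ_three]
    push_cast
    simp only [Complex.mul_conj']
  have h2 : ((2 * ‖u‖ ^ 2 : ℝ) : ℂ) = 2 * ((‖u‖ ^ 2 : ℝ) : ℂ) := by push_cast; ring
  rw [h2, hn, ← pauli_conjC]
  ext p q
  fin_cases p <;> fin_cases q <;>
    simp [pauli_apply, conjC] <;> ring_nf <;> simp

theorem norm_inv_sub_conj_le {z w : ℂ} (hz : 0 < z.im) (hw : 0 < w.im) (hzw : z ≠ w) :
    ‖(z - conj w)⁻¹‖ ≤ ‖(z - w)⁻¹‖ := by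
  rw [norm_inv, norm_inv]
  refine inv_anti₀ (norm_pos_iff.2 (sub_ne_zero.2 hzw)) ?_
  rw [← sq_le_sq₀ (norm_nonneg _) (norm_nonneg _), ← Complex.normSq_eq_norm_sq,
    ← Complex.normSq_eq_norm_sq, Complex.normSq_apply, Complex.normSq_apply]
  simp
  nlinarith

section

attribute [local instance] Matrix.linftyOpNormedRing Matrix.linftyOpNormedAlgebra

theorem exists_pauli_bound : ∃ C : ℝ, 0 < C ∧ ∀ u, ‖pauli u‖ ≤ C * ‖u‖ ∧ ‖u‖ ≤ C * ‖pauli u‖ := by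
  obtain ⟨K, hK, hK'⟩ := LinearMap.exists_antilipschitzWith pauli
    (LinearMap.ker_eq_bot.2 pauli_injective)
  obtain ⟨M, hM, hM'⟩ := SemilinearMapClass.bound_of_continuous pauli
    (LinearMap.continuous_of_finiteDimensional pauli)
  refine ⟨max M K, lt_max_of_lt_left hM, fun u => ⟨?_, ?_⟩⟩
  · exact (hM' u).trans (mul_le_mul_of_nonneg_right (le_max_left _ _) (norm_nonneg _))
  · have := hK'.le_mul_dist u 0
    rw [map_zero, dist_zero_right, dist_zero_right] at this
    exact this.trans (mul_le_mul_of_nonneg_right (le_max_right _ _) (norm_nonneg _))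

variable {N : ℕ} {I : Set ℝ} {m : ℝ → ℝ → R3} {m₀ : R3} {s : Fin N → ℝ → C3}
  {x : Fin N → ℝ → ℂ}

namespace IsRationalSolution

theorem exists_norm_deriv_spin_le (hm : IsRationalSolution I m m₀ s x) (hI : IsOpen I) :
    ∃ C : ℝ, 0 < C ∧ ∀ t ∈ I, ∀ j,
      ‖deriv (s j) t‖ ≤ C * ‖s j t‖ * ∑ k, ‖(x j t - x k t)⁻¹‖ ^ 2 * ‖s k t‖ := by
  obtain ⟨C, hC, hP⟩ := exists_pauli_bound
  refine ⟨C * (2 * (C * C)), by positivity, fun t ht j => ?_⟩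
  have hd := (hm.differentiableAt_spin t ht j).hasDerivAt
  set Q := weightedSquareSum 1 (fun k => x k t) (fun k => pauli (s k t)) j with hQ
  have h1 : pauli (deriv (s j) t) = Q * pauli (s j t) - pauli (s j t) * Q := by
    ext p q
    exact (hasDerivAt_matrix_entry (pauliL.hasFDerivAt.comp_hasDerivAt t hd) p q).unique
      (hm.hasDerivAt_pauli_spin hI ht j p q)
  have h2 : ‖Q‖ ≤ C * ∑ k, ‖(x j t - x k t)⁻¹‖ ^ 2 * ‖s k t‖ := by
    rw [hQ, weightedSquareSum, Finset.mul_sum]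
    refine (norm_sum_le _ _).trans (Finset.sum_le_sum fun k _ => ?_)
    simp only [Pi.one_apply, one_mul, norm_smul, norm_pow]
    rw [mul_left_comm]
    gcongr
    exact (hP _).1
  calc ‖deriv (s j) t‖ ≤ C * ‖pauli (deriv (s j) t)‖ := (hP _).2
    _ ≤ C * (‖Q‖ * ‖pauli (s j t)‖ + ‖pauli (s j t)‖ * ‖Q‖) := by
        rw [h1]
        gcongr
        exact (norm_sub_le _ _).trans (add_le_add (norm_mul_le _ _) (norm_mul_le _ _))
    _ = C * (2 * (‖pauli (s j t)‖ * ‖Q‖)) := by ring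
    _ ≤ C * (2 * ((C * ‖s j t‖) * (C * ∑ k, ‖(x j t - x k t)⁻¹‖ ^ 2 * ‖s k t‖))) := by
        have := (hP (s j t)).1
        gcongr
    _ = _ := by ring

theorem exists_norm_deriv_deriv_pole_le (hm : IsRationalSolution I m m₀ s x) (hI : IsOpen I) :
    ∃ C : ℝ, 0 < C ∧ ∀ t ∈ I, ∀ j, ∃ Z : ℂ, HasDerivAt (deriv (x j)) Z t ∧
      ‖Z‖ ≤ C * ‖s j t‖ * ∑ k, ‖(x j t - x k t)⁻¹‖ ^ 3 * ‖s k t‖ := by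
  obtain ⟨C, hC, hP⟩ := exists_pauli_bound
  refine ⟨2 * (C * C), by positivity, fun t ht j => ?_⟩
  obtain ⟨Z, hZ, hZ'⟩ := hm.exists_hasDerivAt_deriv_pole hI ht j
  refine ⟨Z, hZ, ?_⟩
  set S := fun k => pauli (s k t)
  have hS : 0 < ‖pauli (s j t)‖ := norm_pos_iff.2 (hm.pauli_spin_ne_zero ht j)
  refine le_of_mul_le_mul_right ?_ hS
  rw [← norm_smul, hZ', norm_neg]
  calc _ ≤ ∑ k, (2 * ‖(x j t - x k t)⁻¹‖ ^ 3) * ((C * ‖s j t‖) * (C * ‖s k t‖) * ‖pauli (s j t)‖) := by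
        refine (norm_sum_le _ _).trans (Finset.sum_le_sum fun k _ => ?_)
        rw [norm_smul, norm_mul, norm_pow, Complex.norm_ofNat]
        have := (hP (s j t)).1
        have := (hP (s k t)).1
        gcongr
        exact (norm_mul_le _ _).trans (mul_le_mul_of_nonneg_right ((norm_mul_le _ _).trans
          (by gcongr)) (norm_nonneg _))
    _ = _ := by
        rw [Finset.mul_sum, Finset.sum_mul]
        exact Finset.sum_congr rfl fun k _ => by ring

/-- In the anticommutation relation at `x j`, the term of the conjugate pole `conj (x j)` is of size
`|s_j|² / Im x_j`. All other terms are at most a multiple of `|s_j|` times the last factor, since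
reflecting `x k` moves it away from `x j`. -/
theorem exists_norm_spin_le (hm : IsRationalSolution I m m₀ s x) (hI : IsOpen I) :
    ∃ C : ℝ, 0 < C ∧ ∀ t ∈ I, ∀ j,
      ‖s j t‖ ≤ C * (x j t).im * (1 + ∑ k, ‖(x j t - x k t)⁻¹‖ * ‖s k t‖) := by
  obtain ⟨C, hC, hP⟩ := exists_pauli_bound
  refine ⟨2 * C * (C * ‖toC m₀‖ + 2 * C), by positivity, fun t ht j => ?_⟩
  set S := pauli (s j t) with hS
  set A := ∑ k, ‖(x j t - x k t)⁻¹‖ * ‖s k t‖ with hA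
  have hy := hm.im_pos t ht j
  have hs := norm_pos_iff.2 (hm.spin_ne_zero t ht j)
  set R := pauli (toC m₀) + ∑ k, (x j t - x k t)⁻¹ • pauli (s k t) +
    ∑ k ∈ Finset.univ.erase j, (x j t - conj (x k t))⁻¹ • (pauli (s k t))ᴴ with hR
  have hA0 : 0 ≤ A := Finset.sum_nonneg fun k _ => mul_nonneg (norm_nonneg _) (norm_nonneg _)
  have hb1 : ‖∑ k, (x j t - x k t)⁻¹ • pauli (s k t)‖ ≤ C * A := by
    rw [hA, Finset.mul_sum]
    refine (norm_sum_le _ _).trans (Finset.sum_le_sum fun k _ => ?_)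
    rw [norm_smul, mul_left_comm]
    exact mul_le_mul_of_nonneg_left (hP _).1 (norm_nonneg _)
  have hb2 : ‖∑ k ∈ Finset.univ.erase j, (x j t - conj (x k t))⁻¹ • (pauli (s k t))ᴴ‖ ≤ C * A := by
    rw [hA, Finset.mul_sum]
    refine (norm_sum_le _ _).trans ((Finset.sum_le_sum fun k hk => ?_).trans
      (Finset.sum_le_univ_sum_of_nonneg fun k =>
        mul_nonneg hC.le (mul_nonneg (norm_nonneg _) (norm_nonneg _))))
    rw [norm_smul, mul_left_comm, ← pauli_conjC, ← norm_conjC (s k t)]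
    refine mul_le_mul (norm_inv_sub_conj_le hy (hm.im_pos t ht k) fun h =>
      (Finset.ne_of_mem_erase hk) (hm.poles_distinct t ht h).symm) (hP _).1 (norm_nonneg _)
      (norm_nonneg _)
  have hRb : ‖R‖ ≤ C * ‖toC m₀‖ + C * A + C * A :=
    (norm_add_le _ _).trans (add_le_add ((norm_add_le _ _).trans (add_le_add (hP _).1 hb1)) hb2)
  have hx : x j t - conj (x j t) = ((2 * (x j t).im : ℝ) : ℂ) * Complex.I := by
    rw [Complex.sub_conj]
  have h1 : ((x j t - conj (x j t))⁻¹ * ((2 * ‖s j t‖ ^ 2 : ℝ) : ℂ)) •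
      (1 : Matrix (Fin 2) (Fin 2) ℂ) = -(S * R + R * S) := by
    rw [mul_smul, ← pauli_mul_conjTranspose_add, eq_neg_iff_add_eq_zero,
      ← hm.anticommute_upper hI ht j, ← Finset.add_sum_erase _
        (fun k => (x j t - conj (x k t))⁻¹ • (pauli (s k t))ᴴ) (Finset.mem_univ j), hR, smul_add,
      ← mul_smul_comm, ← smul_mul_assoc, ← hS]
    simp only [mul_add, add_mul]
    abel
  have h2 := congrArg norm h1
  rw [norm_smul, norm_neg, norm_mul, norm_inv, hx, norm_mul, Complex.norm_I, mul_one,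
    Complex.norm_real, Complex.norm_real, Real.norm_of_nonneg (by positivity),
    Real.norm_of_nonneg (by positivity)] at h2
  have h3 : ‖S * R + R * S‖ ≤ 2 * (‖S‖ * ‖R‖) :=
    (norm_add_le _ _).trans ((add_le_add (norm_mul_le _ _) (norm_mul_le _ _)).trans_eq (by ring))
  have h4 : (2 * (x j t).im)⁻¹ * (2 * ‖s j t‖ ^ 2) ≤
      2 * (C * ‖s j t‖ * (C * ‖toC m₀‖ + C * A + C * A)) := by
    refine (le_mul_of_one_le_right (by positivity) (one_le_norm_one _)).trans (h2.le.trans (h3.trans ?_))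
    have := (hP (s j t)).1
    gcongr
  have h5 : (2 * (x j t).im)⁻¹ * (2 * ‖s j t‖ ^ 2) = ‖s j t‖ * (‖s j t‖ / (x j t).im) := by
    field_simp
  rw [h5] at h4
  have h6 : ‖s j t‖ / (x j t).im ≤ 2 * (C * (C * ‖toC m₀‖ + C * A + C * A)) :=
    le_of_mul_le_mul_left (h4.trans_eq (by ring)) hs
  rw [div_le_iff₀ hy] at h6
  have h7 : C * ‖toC m₀‖ + C * A + C * A ≤ (C * ‖toC m₀‖ + 2 * C) * (1 + A) := by
    have := mul_nonneg (mul_nonneg hC.le (norm_nonneg (toC m₀))) hA0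
    linarith
  calc _ ≤ _ := h6
    _ = (2 * C * (x j t).im) * (C * ‖toC m₀‖ + C * A + C * A) := by ring
    _ ≤ (2 * C * (x j t).im) * ((C * ‖toC m₀‖ + 2 * C) * (1 + A)) := by gcongr
    _ = _ := by ring

end IsRationalSolution

end

/-! ### Asymptotics of the spins and of the poles -/

/-- `h` dominates the tail of the integral of `f'`. The rate `h t` is kept so that the limit of a
velocity can be integrated once more. -/
theorem exists_tendsto_of_norm_deriv_le {E : Type*} [NormedAddCommGroup E] [NormedSpace ℝ E]
    [CompleteSpace E] {f f' : ℝ → E} {h h' : ℝ → ℝ} {T : ℝ}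
    (hf : ∀ t, T ≤ t → HasDerivAt f (f' t) t) (hh : ∀ t, T ≤ t → HasDerivAt h (-h' t) t)
    (hb : ∀ t, T ≤ t → ‖f' t‖ ≤ h' t) (h0 : Tendsto h atTop (𝓝 0)) :
    ∃ L, Tendsto f atTop (𝓝 L) ∧ ∀ t, T ≤ t → ‖f t - L‖ ≤ h t := by
  have hmain : ∀ t u, T ≤ t → t ≤ u → ‖f u - f t‖ ≤ h t - h u := by
    intro t u ht hu
    refine image_norm_le_of_norm_deriv_right_le_deriv_boundary' (a := t) (b := u)
      (f := fun τ => f τ - f t) (f' := f') (B := fun τ => h t - h τ) (B' := h')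
      (fun τ hτ => ((hf τ (ht.trans hτ.1)).continuousAt.sub continuousAt_const).continuousWithinAt)
      (fun τ hτ => ((hf τ (ht.trans hτ.1)).sub_const _).hasDerivWithinAt) (by simp)
      (fun τ hτ => ((continuousAt_const).sub (hh τ (ht.trans hτ.1)).continuousAt).continuousWithinAt)
      (fun τ hτ => (((hh τ (ht.trans hτ.1)).const_sub (h t)).congr_deriv (neg_neg _)).hasDerivWithinAt)
      (fun τ hτ => hb τ (ht.trans hτ.1)) ⟨hu, le_rfl⟩
  have hc : Cauchy (map f atTop) := by
    refine Metric.cauchy_iff.2 ⟨inferInstance, fun ε hε => ?_⟩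
    obtain ⟨t₁, ht₁⟩ := ((Metric.tendsto_nhds.1 h0 (ε / 4) (by positivity)).and
      (eventually_ge_atTop T)).exists_forall_of_atTop
    refine ⟨f '' Set.Ici t₁, image_mem_map (Ici_mem_atTop _), ?_⟩
    have hd : ∀ u, t₁ ≤ u → dist (f u) (f t₁) < ε / 2 := by
      intro u hu
      have h1 := hmain t₁ u (ht₁ t₁ le_rfl).2 hu
      have h2 := abs_lt.1 (by simpa using (ht₁ t₁ le_rfl).1)
      have h3 := abs_lt.1 (by simpa using (ht₁ u hu).1)
      rw [dist_eq_norm]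
      linarith
    rintro _ ⟨u, hu, rfl⟩ _ ⟨w, hw, rfl⟩
    linarith [dist_triangle_right (f u) (f w) (f t₁), hd u hu, hd w hw]
  obtain ⟨L, hL⟩ := CompleteSpace.complete hc
  refine ⟨L, hL, fun t ht => ?_⟩
  have h1 : Tendsto (fun u => ‖f u - f t‖) atTop (𝓝 ‖L - f t‖) :=
    ((show Tendsto f atTop (𝓝 L) from hL).sub_const _).norm
  have h2 : Tendsto (fun u => h t - h u) atTop (𝓝 (h t)) := by simpa using h0.const_sub (h t)
  rw [norm_sub_rev]
  exact le_of_tendsto_of_tendsto h1 h2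
    ((eventually_ge_atTop t).mono fun u hu => hmain t u ht hu)

theorem hasDerivAt_const_div {K t : ℝ} (ht : t ≠ 0) :
    HasDerivAt (fun τ : ℝ => K / τ) (-(K / t ^ 2)) t := by
  simpa [div_eq_mul_inv] using (hasDerivAt_inv ht).const_mul K

theorem hasDerivAt_const_div_sq {K t : ℝ} (ht : t ≠ 0) :
    HasDerivAt (fun τ : ℝ => K / τ ^ 2) (-(2 * K / t ^ 3)) t := by
  refine (((hasDerivAt_pow 2 t).fun_inv (pow_ne_zero 2 ht)).const_mul K).congr_deriv ?_
  push_cast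
  field_simp

/-- For `w = q ^ (-1/2)` the inequality says that `w - K / (2t)` is nondecreasing. The growth
condition makes it positive at some time, which keeps `w` away from zero. -/
theorem exists_bound_of_riccati {q q' : ℝ → ℝ} {T K : ℝ} (hT : 0 < T)
    (hq : ∀ t, T ≤ t → 0 < q t) (hd : ∀ t, T ≤ t → HasDerivAt q (q' t) t)
    (hb : ∀ t, T ≤ t → q' t ≤ K / t ^ 2 * (q t * √(q t)))
    (ho : ∀ ε : ℝ, 0 < ε → ∀ᶠ t in atTop, √(q t) ≤ ε * t) :
    ∃ B : ℝ, 0 < B ∧ ∀ᶠ t in atTop, √(q t) ≤ B := by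
  have hs : ∀ t, T ≤ t → 0 < √(q t) := fun t ht => Real.sqrt_pos.2 (hq t ht)
  have hw : ∀ t, T ≤ t → HasDerivAt (fun τ => (√(q τ))⁻¹ - K / 2 / τ)
      (-(q' t / (2 * √(q t))) / √(q t) ^ 2 - -(K / 2 / t ^ 2)) t := fun t ht =>
    (((hd t ht).sqrt (hq t ht).ne').fun_inv (hs t ht).ne').sub
      (hasDerivAt_const_div (hT.trans_le ht).ne')
  have hmono : MonotoneOn (fun τ => (√(q τ))⁻¹ - K / 2 / τ) (Set.Ici T) := by
    refine monotoneOn_of_deriv_nonneg (convex_Ici T)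
      (fun t ht => (hw t ht).continuousAt.continuousWithinAt)
      (fun t ht => (hw t (interior_subset ht)).differentiableAt.differentiableWithinAt) fun t ht => ?_
    rw [interior_Ici] at ht
    have ht' : T ≤ t := ht.le
    rw [(hw t ht').deriv]
    have h1 := hb t ht'
    have h2 := hs t ht'
    have h3 := Real.sq_sqrt (hq t ht').le
    have h4 : q' t / (2 * √(q t)) / √(q t) ^ 2 ≤ K / 2 / t ^ 2 := by
      rw [div_div, div_le_iff₀ (by positivity)]
      refine h1.trans_eq ?_
      rw [h3]
      ring
    rw [neg_div]
    linarith
  -- With `ε = (|K| + 1)⁻¹` one gets `w(t₁) ≥ (|K| + 1) / t₁ > K / (2 t₁)`.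
  obtain ⟨t₁, ht₁, ht₁'⟩ := ((ho (|K| + 1)⁻¹ (by positivity)).and (eventually_ge_atTop T)).exists
  have hp : 0 < t₁ := hT.trans_le ht₁'
  have hδ : 0 < (√(q t₁))⁻¹ - K / 2 / t₁ := by
    have h1 : (|K| + 1) / t₁ ≤ (√(q t₁))⁻¹ := by
      rw [← inv_div]
      exact inv_anti₀ (hs t₁ ht₁') (ht₁.trans_eq (by rw [div_eq_inv_mul]))
    have h2 : K / 2 / t₁ < (|K| + 1) / t₁ := by
      refine div_lt_div_of_pos_right ?_ hp
      linarith [le_abs_self K, abs_nonneg K]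
    linarith
  have hlim : Tendsto (fun t : ℝ => K / 2 / t) atTop (𝓝 0) := tendsto_const_nhds.div_atTop tendsto_id
  set δ := (√(q t₁))⁻¹ - K / 2 / t₁
  refine ⟨(δ / 2)⁻¹, by positivity, ?_⟩
  filter_upwards [eventually_ge_atTop t₁, hlim.eventually (lt_mem_nhds (show -(δ / 2) < 0 by linarith))]
    with t ht h1
  have h2 := hmono ht₁' (ht₁'.trans ht) ht
  have h3 : δ / 2 ≤ (√(q t))⁻¹ := by
    have : δ ≤ (√(q t))⁻¹ - K / 2 / t := h2
    linarith
  exact (le_inv_comm₀ (by positivity) (hs t (ht₁'.trans ht))).1 h3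

theorem hasDerivAt_norm_sq_spin {f : ℝ → C3} {f' : C3} {t : ℝ} (h : HasDerivAt f f' t) :
    ∃ d : ℝ, HasDerivAt (fun τ => ‖f τ‖ ^ 2) d t ∧ |d| ≤ 2 * (‖f t‖ * ‖f'‖) := by
  let _ : InnerProductSpace ℝ C3 := InnerProductSpace.rclikeToReal ℂ C3
  refine ⟨_, h.norm_sq, ?_⟩
  rw [abs_mul, abs_two]
  exact mul_le_mul_of_nonneg_left (abs_real_inner_le_norm _ _) zero_le_two

/-- Gronwall from below: `‖f‖² exp (-2K / t)` is nondecreasing, and `1 / t²` is integrable at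
infinity. -/
theorem exists_pos_le_norm_of_norm_deriv_le {f f' : ℝ → C3} {T K : ℝ} (hT : 0 < T)
    (hd : ∀ t, T ≤ t → HasDerivAt f (f' t) t) (h0 : f T ≠ 0)
    (hb : ∀ t, T ≤ t → ‖f' t‖ ≤ K / t ^ 2 * ‖f t‖) :
    ∃ c : ℝ, 0 < c ∧ ∀ t, T ≤ t → c ≤ ‖f t‖ ^ 2 := by
  have hK : 0 ≤ K := by
    have h1 := (norm_nonneg _).trans (hb T le_rfl)
    have h2 := nonneg_of_mul_nonneg_left h1 (norm_pos_iff.2 h0)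
    by_contra! h
    exact absurd h2 (not_le.2 (div_neg_of_neg_of_pos h (by positivity)))
  choose! d hd' hdb using fun t (ht : T ≤ t) => hasDerivAt_norm_sq_spin (hd t ht)
  have hw : ∀ t, T ≤ t → HasDerivAt (fun τ => ‖f τ‖ ^ 2 * Real.exp (-(2 * K / τ)))
      (d t * Real.exp (-(2 * K / t)) + ‖f t‖ ^ 2 * (Real.exp (-(2 * K / t)) * - -(2 * K / t ^ 2))) t :=
    fun t ht => (hd' t ht).mul (hasDerivAt_const_div (hT.trans_le ht).ne').neg.exp
  have hmono : MonotoneOn (fun τ => ‖f τ‖ ^ 2 * Real.exp (-(2 * K / τ))) (Set.Ici T) := by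
    refine monotoneOn_of_deriv_nonneg (convex_Ici T)
      (fun t ht => (hw t ht).continuousAt.continuousWithinAt)
      (fun t ht => (hw t (interior_subset ht)).differentiableAt.differentiableWithinAt) fun t ht => ?_
    rw [interior_Ici] at ht
    have ht' : T ≤ t := ht.le
    rw [(hw t ht').deriv]
    have h1 : 0 ≤ d t + ‖f t‖ ^ 2 * (2 * K / t ^ 2) := by
      have h2 := (neg_abs_le (d t)).trans' (neg_le_neg (hdb t ht'))
      have h3 := mul_le_mul_of_nonneg_left (hb t ht') (norm_nonneg (f t))
      have h4 : ‖f t‖ ^ 2 * (2 * K / t ^ 2) = 2 * (‖f t‖ * (K / t ^ 2 * ‖f t‖)) := by ring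
      linarith
    have h5 := mul_nonneg h1 (Real.exp_pos (-(2 * K / t))).le
    linarith
  refine ⟨‖f T‖ ^ 2 * Real.exp (-(2 * K / T)), by positivity, fun t ht => ?_⟩
  refine (hmono Set.self_mem_Ici ht ht).trans (mul_le_of_le_one_right (by positivity) ?_)
  rw [Real.exp_le_one_iff, neg_nonpos]
  have := hT.trans_le ht
  positivity

theorem sum_norm_inv_pow_mul_le {N : ℕ} {z : Fin N → ℂ} {r : Fin N → ℝ} {d : ℝ} (hd : 0 < d)
    (hr : ∀ k, 0 ≤ r k) (hz : ∀ j k, j ≠ k → d ≤ ‖z j - z k‖) (j : Fin N) {n : ℕ} (hn : n ≠ 0) :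
    ∑ k, ‖(z j - z k)⁻¹‖ ^ n * r k ≤ (∑ k, r k) / d ^ n := by
  rw [Finset.sum_div]
  refine Finset.sum_le_sum fun k _ => ?_
  rw [div_eq_inv_mul, ← inv_pow]
  refine mul_le_mul_of_nonneg_right ?_ (hr k)
  by_cases h : j = k
  · subst h
    simp only [sub_self, inv_zero, norm_zero, zero_pow hn]
    positivity
  · rw [norm_inv]
    exact pow_le_pow_left₀ (by positivity) (inv_anti₀ hd (hz j k h)) n

namespace IsRationalSolution

variable {N : ℕ} {T t₀ : ℝ} {m : ℝ → ℝ → R3} {m₀ : R3} {s : Fin N → ℝ → C3}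
  {x : Fin N → ℝ → ℂ}

theorem spin_isLittleO (hm : IsRationalSolution (Set.Ioi T) m m₀ s x) {g : ℝ} (hg : 0 < g)
    (hsep : ∀ᶠ t in atTop, ∀ j k, j ≠ k → g * t ≤ ‖x j t - x k t‖)
    (him : ∀ ε : ℝ, 0 < ε → ∀ᶠ t in atTop, ∀ j, (x j t).im ≤ ε * t) {ε : ℝ} (hε : 0 < ε) :
    ∀ᶠ t in atTop, ∑ k, ‖s k t‖ ≤ ε * t := by
  obtain ⟨C, hC, hb⟩ := hm.exists_norm_spin_le isOpen_Ioi
  -- With `σ = ∑ ‖s k t‖`, summing the bound over `j` gives `σ ≤ min (ε / 2) (g / 2) * (t + σ / g)`: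
  -- the part `g / 2` lets half of `σ` be absorbed, the part `ε / 2` gives the claim.
  set η : ℝ := min (ε / 2) (g / 2) / ((N + 1) * C) with hη
  have hη0 : 0 < η := by positivity
  filter_upwards [hsep, him η hη0, eventually_gt_atTop T, eventually_gt_atTop 0]
    with t h1 h2 hT h0
  set σ := ∑ k, ‖s k t‖
  have hσ : 0 ≤ σ := Finset.sum_nonneg fun k _ => norm_nonneg _
  have h3 : ∀ j, ‖s j t‖ ≤ C * (η * t) * (1 + σ / (g * t)) := by
    intro j
    have h4 := sum_norm_inv_pow_mul_le (r := fun k => ‖s k t‖) (mul_pos hg h0)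
      (fun k => norm_nonneg _) h1 j one_ne_zero
    simp only [pow_one] at h4
    have h5 := h2 j
    refine (hb t hT j).trans ?_
    gcongr
  have h4 : σ ≤ N * (C * (η * t) * (1 + σ / (g * t))) := by
    refine (Finset.sum_le_sum fun j _ => h3 j).trans_eq ?_
    simp
  have h5 : N * (C * (η * t) * (1 + σ / (g * t))) ≤ min (ε / 2) (g / 2) * (t + σ / g) := by
    have h6 : η * ((N + 1) * C) = min (ε / 2) (g / 2) := by
      rw [hη]
      field_simp
    have h7 : C * (η * t) * (1 + σ / (g * t)) = C * η * (t + σ / g) := by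
      field_simp
    rw [h7, ← h6]
    have : 0 ≤ C * η * (t + σ / g) := by positivity
    linarith
  have h6 : min (ε / 2) (g / 2) * t ≤ ε / 2 * t := by
    gcongr
    exact min_le_left _ _
  have h7 : min (ε / 2) (g / 2) * (σ / g) ≤ g / 2 * (σ / g) := by
    gcongr
    exact min_le_right _ _
  have h8 : g / 2 * (σ / g) = σ / 2 := by field_simp
  linarith

theorem spin_bounded (hm : IsRationalSolution (Set.Ioi T) m m₀ s x) {g : ℝ} (hg : 0 < g)
    (hsep : ∀ᶠ t in atTop, ∀ j k, j ≠ k → g * t ≤ ‖x j t - x k t‖)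
    (him : ∀ ε : ℝ, 0 < ε → ∀ᶠ t in atTop, ∀ j, (x j t).im ≤ ε * t) :
    ∃ B : ℝ, 0 < B ∧ ∀ᶠ t in atTop, ∑ k, ‖s k t‖ ≤ B := by
  -- Without poles the sum of squares is zero, while the Riccati lemma needs a positive function.
  rcases isEmpty_or_nonempty (Fin N) with hN | hN
  · exact ⟨1, one_pos, by simp⟩
  obtain ⟨C, hC, hb⟩ := hm.exists_norm_deriv_spin_le isOpen_Ioi
  have hle : ∀ t k, ‖s k t‖ ≤ √(∑ k, ‖s k t‖ ^ 2) := fun t k =>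
    Real.le_sqrt_of_sq_le (Finset.single_le_sum (f := fun k => ‖s k t‖ ^ 2)
      (fun k _ => by positivity) (Finset.mem_univ k))
  have hle' : ∀ t, ∑ k, ‖s k t‖ ≤ N * √(∑ k, ‖s k t‖ ^ 2) := fun t =>
    (Finset.sum_le_sum fun k _ => hle t k).trans_eq (by simp)
  obtain ⟨T₁, hT₁⟩ := (hsep.and ((eventually_gt_atTop T).and
    (eventually_gt_atTop 0))).exists_forall_of_atTop
  choose! d hd hdb using fun k t (ht : T₁ ≤ t) => hasDerivAt_norm_sq_spin
    (hm.differentiableAt_spin t (hT₁ t ht).2.1 k).hasDerivAt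
  have hR := exists_bound_of_riccati (q := fun t => ∑ k, ‖s k t‖ ^ 2)
    (q' := fun t => ∑ k, d k t) (T := T₁) (K := 2 * C * N / g ^ 2) (hT₁ T₁ le_rfl).2.2
    (fun t ht => Finset.sum_pos (fun k _ =>
      pow_pos (norm_pos_iff.2 (hm.spin_ne_zero t (hT₁ t ht).2.1 k)) 2) Finset.univ_nonempty)
    (fun t ht => HasDerivAt.fun_sum fun k _ => hd k t ht)
    (fun t ht => ?_) (fun ε hε => ?_)
  · obtain ⟨B, hB, hB'⟩ := hR
    refine ⟨(N + 1) * B, by positivity, hB'.mono fun t ht => (hle' t).trans ?_⟩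
    have : (N : ℝ) * √(∑ k, ‖s k t‖ ^ 2) ≤ N * B := by gcongr
    linarith
  · obtain ⟨h1, h2, h3⟩ := hT₁ t ht
    have h4 : ∀ k, d k t ≤ 2 * C * N / g ^ 2 / t ^ 2 * (‖s k t‖ ^ 2 * √(∑ k, ‖s k t‖ ^ 2)) := by
      intro k
      have h5 := sum_norm_inv_pow_mul_le (r := fun k => ‖s k t‖) (mul_pos hg h3)
        (fun k => norm_nonneg _) h1 k two_ne_zero
      calc d k t ≤ 2 * (‖s k t‖ * ‖deriv (s k) t‖) := (le_abs_self _).trans (hdb k t ht)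
        _ ≤ 2 * (‖s k t‖ * (C * ‖s k t‖ * ((N * √(∑ k, ‖s k t‖ ^ 2)) / (g * t) ^ 2))) := by
          gcongr
          refine (hb t h2 k).trans ?_
          gcongr
          refine h5.trans ?_
          gcongr
          exact hle' t
        _ = _ := by
          field_simp
    refine (Finset.sum_le_sum fun k _ => h4 k).trans_eq ?_
    rw [← Finset.mul_sum, ← Finset.sum_mul]
  · filter_upwards [hm.spin_isLittleO hg hsep him hε] with t ht
    refine (Real.sqrt_le_left (Finset.sum_nonneg fun k _ => norm_nonneg _)).2 ?_ |>.trans ht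
    exact Finset.sum_sq_le_sq_sum_of_nonneg fun k _ => norm_nonneg _

theorem exists_asymptotics (hT : T < t₀) (hm : IsRationalSolution (Set.Ioi T) m m₀ s x)
    (hα : 0 < alpha s x t₀) :
    ∃ (v : Fin N → ℝ) (a : Fin N → C3) (b : Fin N → ℂ), Function.Injective v ∧
      (∀ j, 0 < (b j).im) ∧
      (∀ j, Tendsto (fun t : ℝ => x j t - (v j : ℂ) * (t : ℂ)) atTop (𝓝 (b j))) ∧
      (∀ j, Tendsto (fun t : ℝ => s j t) atTop (𝓝 (a j))) := by
  obtain ⟨g, hg, hsep, him⟩ := hm.poles_separate hT hα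
  obtain ⟨B, hB, hBs⟩ := hm.spin_bounded hg hsep him
  obtain ⟨C₁, hC₁, hb₁⟩ := hm.exists_norm_deriv_spin_le isOpen_Ioi
  obtain ⟨C₂, hC₂, hb₂⟩ := hm.exists_norm_deriv_deriv_pole_le isOpen_Ioi
  obtain ⟨C₃, hC₃, hb₃⟩ := hm.exists_norm_spin_le isOpen_Ioi
  obtain ⟨T₁, hT₁⟩ := (hsep.and (hBs.and ((eventually_gt_atTop T).and
    (eventually_gt_atTop 0)))).exists_forall_of_atTop
  have hp : 0 < T₁ := (hT₁ T₁ le_rfl).2.2.2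
  have hsum : ∀ t, T₁ ≤ t → ∀ j (n : ℕ), n ≠ 0 →
      ∑ k, ‖(x j t - x k t)⁻¹‖ ^ n * ‖s k t‖ ≤ B / (g * t) ^ n := by
    intro t ht j n hn
    obtain ⟨h1, h2, h3, h4⟩ := hT₁ t ht
    refine (sum_norm_inv_pow_mul_le (r := fun k => ‖s k t‖) (mul_pos hg h4)
      (fun k => norm_nonneg _) h1 j hn).trans ?_
    gcongr
  have hsB : ∀ t, T₁ ≤ t → ∀ j, ‖s j t‖ ≤ B := fun t ht j =>
    (Finset.single_le_sum (f := fun k => ‖s k t‖) (fun k _ => norm_nonneg _)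
      (Finset.mem_univ j)).trans (hT₁ t ht).2.1
  have hds : ∀ j t, T₁ ≤ t → HasDerivAt (s j) (deriv (s j) t) t := fun j t ht =>
    (hm.differentiableAt_spin t (hT₁ t ht).2.2.1 j).hasDerivAt
  have hds' : ∀ j t, T₁ ≤ t → ‖deriv (s j) t‖ ≤ C₁ * B / g ^ 2 / t ^ 2 * ‖s j t‖ := by
    intro j t ht
    refine (hb₁ t (hT₁ t ht).2.2.1 j).trans ?_
    refine (mul_le_mul_of_nonneg_left (hsum t ht j 2 two_ne_zero) (by positivity)).trans_eq ?_
    have := hp.trans_le ht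
    field_simp
  have hds'' : ∀ j t, T₁ ≤ t → ‖deriv (s j) t‖ ≤ C₁ * B / g ^ 2 * B / t ^ 2 := by
    intro j t ht
    refine (hds' j t ht).trans ?_
    refine (mul_le_mul_of_nonneg_left (hsB t ht j) (by positivity)).trans_eq ?_
    ring
  have hlim : ∀ K : ℝ, Tendsto (fun t : ℝ => K / t) atTop (𝓝 0) := fun K =>
    tendsto_const_nhds.div_atTop tendsto_id
  have hlim2 : ∀ K : ℝ, Tendsto (fun t : ℝ => K / t ^ 2) atTop (𝓝 0) := fun K =>
    tendsto_const_nhds.div_atTop (tendsto_pow_atTop two_ne_zero)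
  choose a ha _ using fun j => exists_tendsto_of_norm_deriv_le (hds j)
    (fun t ht => hasDerivAt_const_div (hp.trans_le ht).ne') (hds'' j) (hlim _)
  choose! Z hZ hZb using fun j t (ht : T₁ ≤ t) => hb₂ t (hT₁ t ht).2.2.1 j
  -- Written as `2 * K / t ^ 3` to be the derivative of `-K / t ^ 2`.
  have hZb' : ∀ j t, T₁ ≤ t → ‖Z j t‖ ≤ 2 * (C₂ * B * B / g ^ 3 / 2) / t ^ 3 := by
    intro j t ht
    have := hp.trans_le ht
    have h1 := hsB t ht j
    calc ‖Z j t‖ ≤ C₂ * B * (B / (g * t) ^ 3) := by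
          refine (hZb j t ht).trans ?_
          have := hsum t ht j 3 three_ne_zero
          gcongr
      _ = _ := by field_simp
  choose V _ hV using fun j => exists_tendsto_of_norm_deriv_le (hZ j)
    (fun t ht => hasDerivAt_const_div_sq (hp.trans_le ht).ne') (hZb' j) (hlim2 _)
  have hdx : ∀ j t, T₁ ≤ t → HasDerivAt (fun τ : ℝ => x j τ - V j * (τ : ℂ))
      (deriv (x j) t - V j) t := by
    intro j t ht
    refine ((hm.differentiableAt_pole t (hT₁ t ht).2.2.1 j).hasDerivAt.sub
      ((Complex.ofRealCLM.hasDerivAt (x := t)).const_mul (V j))).congr_deriv ?_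
    simp
  choose b hb _ using fun j => exists_tendsto_of_norm_deriv_le (hdx j)
    (fun t ht => hasDerivAt_const_div (hp.trans_le ht).ne') (hV j) (hlim _)
  have hinv : Tendsto (fun t : ℝ => t⁻¹) atTop (𝓝 0) := tendsto_inv_atTop_zero
  -- The imaginary part of the velocity is the limit of `Im x_j / t`, which is zero.
  have hVim : ∀ j, (V j).im = 0 := by
    intro j
    have h1 : Tendsto (fun t : ℝ => t⁻¹ * (x j t - V j * (t : ℂ)).im + (V j).im) atTop
        (𝓝 (0 * (b j).im + (V j).im)) :=
      (hinv.mul ((Complex.continuous_im.tendsto _).comp (hb j))).add_const _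
    rw [zero_mul, zero_add] at h1
    have h2 : ∀ᶠ t : ℝ in atTop, t⁻¹ * (x j t - V j * (t : ℂ)).im + (V j).im = (x j t).im / t := by
      filter_upwards [eventually_gt_atTop 0] with t ht
      rw [Complex.sub_im, Complex.im_mul_ofReal]
      field_simp
      ring
    refine tendsto_nhds_unique (h1.congr' h2) (Metric.tendsto_nhds.2 fun ε hε => ?_)
    filter_upwards [him (ε / 2) (by positivity), eventually_gt_atTop T, eventually_gt_atTop 0]
      with t h3 h4 h5
    have h6 := hm.im_pos t h4 j
    rw [Real.dist_0_eq_abs, abs_of_pos (by positivity), div_lt_iff₀ h5]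
    nlinarith [h3 j]
  have hVre : ∀ j, V j = ((V j).re : ℂ) := fun j => Complex.ext (by simp) (by simp [hVim])
  -- Equal velocities would keep two poles at bounded distance, against their linear separation.
  have hinj : Function.Injective fun j => (V j).re := by
    intro j k hjk
    by_contra hne
    have hVV : V j = V k := by rw [hVre j, hVre k, show (V j).re = (V k).re from hjk]
    have h1 : Tendsto (fun t : ℝ => t⁻¹ * ‖(x j t - V j * (t : ℂ)) - (x k t - V k * (t : ℂ))‖) atTop
        (𝓝 (0 * ‖b j - b k‖)) := hinv.mul ((hb j).sub (hb k)).norm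
    rw [zero_mul] at h1
    refine absurd (ge_of_tendsto h1 ?_) (not_le.2 hg)
    filter_upwards [hsep, eventually_gt_atTop 0] with t h2 h3
    rw [hVV, sub_sub_sub_cancel_right, ← div_eq_inv_mul, le_div_iff₀ h3]
    exact h2 j k hne
  refine ⟨fun j => (V j).re, a, b, hinj, fun j => ?_, fun j => ?_, ha⟩
  -- The limit spin is nonzero, and passing to the limit in the spin bound gives `‖a j‖ ≤ C₃ * (b
  -- j).im`.
  · obtain ⟨c, hc, hc'⟩ := exists_pos_le_norm_of_norm_deriv_le hp (hds j)
      (hm.spin_ne_zero T₁ (hT₁ T₁ le_rfl).2.2.1 j) (hds' j)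
    have h1 : c ≤ ‖a j‖ ^ 2 := ge_of_tendsto ((ha j).norm.pow 2)
      ((eventually_ge_atTop T₁).mono fun t ht => hc' t ht)
    have h2 : 0 < ‖a j‖ := by
      refine (norm_nonneg _).lt_of_ne fun h => ?_
      rw [← h] at h1
      norm_num at h1
      linarith
    have h3 : Tendsto (fun t : ℝ => C₃ * (x j t - V j * (t : ℂ)).im * (1 + B / g / t)) atTop
        (𝓝 (C₃ * (b j).im * (1 + 0))) :=
      (((Complex.continuous_im.tendsto _).comp (hb j)).const_mul C₃).mul ((hlim _).const_add 1)
    have h4 : ‖a j‖ ≤ C₃ * (b j).im * (1 + 0) := by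
      refine le_of_tendsto_of_tendsto (ha j).norm h3 ?_
      filter_upwards [eventually_ge_atTop T₁] with t ht
      have h5 := hsum t ht j 1 one_ne_zero
      have h6 := hm.im_pos t (hT₁ t ht).2.2.1 j
      simp only [pow_one] at h5
      rw [Complex.sub_im, Complex.im_mul_ofReal, hVim, zero_mul, sub_zero, div_div]
      refine (hb₃ t (hT₁ t ht).2.2.1 j).trans ?_
      gcongr
    rw [add_zero, mul_one] at h4
    exact pos_of_mul_pos_right (h2.trans_le h4) hC₃.le
  · rw [← hVre j]
    exact hb j

end IsRationalSolution

/-! ### The Fourier transform of the Fourier inverse of a function -/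

theorem integral_fourierInv_smul_eq {E : Type*} [NormedAddCommGroup E] [NormedSpace ℂ E]
    [CompleteSpace E] {f : ℝ → ℂ} {g : ℝ → E} (hf : Integrable f) (hg : Integrable g) :
    ∫ ξ, (𝓕⁻ f) ξ • g ξ = ∫ y, f y • (𝓕⁻ g) y := by
  have h := VectorFourier.integral_fourierIntegral_smul_eq_flip (L := -innerₗ ℝ)
    Real.continuous_fourierChar (by simp only [LinearMap.neg_apply, innerₗ_apply_apply]; fun_prop)
    hf hg
  have hflip : (-innerₗ ℝ : ℝ →ₗ[ℝ] ℝ →ₗ[ℝ] ℝ).flip = -innerₗ ℝ := by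
    ext
    simp
  rw [hflip] at h
  exact h

theorem continuous_fourierInv {E : Type*} [NormedAddCommGroup E] [NormedSpace ℂ E]
    {g : ℝ → E} (hg : Integrable g) : Continuous (𝓕⁻ g) := by
  rw [← Real.Lp.fourierTransformInv_toLp (memLp_one_iff_integrable.2 hg)]
  exact BoundedContinuousFunction.continuous _

section

variable {F : Type*} [NormedAddCommGroup F] [InnerProductSpace ℂ F] [CompleteSpace F]

/-- On `L¹ ∩ L²` the inverse transform of `L²` agrees with the integral. Both are tested against
smooth compactly supported functions, regarded as Schwartz functions, onto which the transform is
moved. -/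
theorem coe_fourierInv_toLp_ae_eq {Φ : ℝ → F} (h1 : Integrable Φ) (h2 : MemLp Φ 2) :
    (𝓕⁻ (h2.toLp Φ) : Lp F 2 (volume : Measure ℝ)) =ᵐ[volume] 𝓕⁻ Φ := by
  refine ae_eq_of_integral_contDiff_smul_eq
    ((Lp.memLp (𝓕⁻ (h2.toLp Φ))).locallyIntegrable one_le_two)
    (continuous_fourierInv h1).locallyIntegrable fun g hg hgc => ?_
  have hg₁ : HasCompactSupport (Complex.ofRealCLM ∘ g) := hgc.comp_left rfl
  have hg₂ : ContDiff ℝ (⊤ : ℕ∞) (Complex.ofRealCLM ∘ g) := by fun_prop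
  set G := hg₁.toSchwartzMap hg₂
  have hG : ∀ y, (G : ℝ → ℂ) y = (g y : ℂ) := fun y => rfl
  have e1 : ∫ y, g y • (𝓕⁻ (h2.toLp Φ) : Lp F 2 (volume : Measure ℝ)) y =
      Lp.toTemperedDistribution (𝓕⁻ (h2.toLp Φ)) G := by
    rw [Lp.toTemperedDistribution_apply]
    simp only [hG, Complex.coe_smul]
  rw [e1, ← Lp.fourierInv_toTemperedDistribution_eq, TemperedDistribution.fourierInv_apply,
    Lp.toTemperedDistribution_apply]
  have e2 : ∫ y, g y • (𝓕⁻ Φ) y = ∫ y, G y • (𝓕⁻ Φ) y := by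
    simp only [hG, Complex.coe_smul]
  rw [e2, ← integral_fourierInv_smul_eq G.integrable h1, SchwartzMap.fourierInv_coe]
  refine integral_congr_ae ?_
  filter_upwards [h2.coeFn_toLp] with ξ hξ
  rw [hξ]

theorem memLp_fourierInv {Φ : ℝ → F} (h1 : Integrable Φ) (h2 : MemLp Φ 2) :
    MemLp (𝓕⁻ Φ) 2 volume :=
  (memLp_congr_ae (coe_fourierInv_toLp_ae_eq h1 h2)).1 (Lp.memLp _)

theorem coe_fourier_toLp_fourierInv_ae_eq {Φ : ℝ → F} (h1 : Integrable Φ) (h2 : MemLp Φ 2)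
    (h : MemLp (𝓕⁻ Φ) 2 volume) :
    (𝓕 (h.toLp (𝓕⁻ Φ)) : Lp F 2 (volume : Measure ℝ)) =ᵐ[volume] Φ := by
  have h3 : h.toLp (𝓕⁻ Φ) = 𝓕⁻ (h2.toLp Φ) := by
    refine Lp.ext (h.coeFn_toLp.trans (coe_fourierInv_toLp_ae_eq h1 h2).symm)
  rw [h3, FourierTransform.fourier_fourierInv_eq]
  exact h2.coeFn_toLp

end

/-- A function given as an inverse transform has its Sobolev norm read off from `Φ`. No Fourier
integral of a rational function, which need not be integrable, has to be computed. -/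
theorem sobolevNorm_fourierInv (σ : ℝ) {Φ : ℝ → C3} (h1 : Integrable Φ) (h2 : MemLp Φ 2) :
    sobolevNorm σ (𝓕⁻ Φ) =
      eLpNorm (fun ξ : ℝ => ((1 + (2 * Real.pi * ξ) ^ 2) ^ (σ / 2) : ℝ) • Φ ξ) 2 volume := by
  have h := memLp_fourierInv h1 h2
  rw [sobolevNorm, dif_pos h]
  refine eLpNorm_congr_ae ?_
  filter_upwards [coe_fourier_toLp_fourierInv_ae_eq h1 h2 h] with ξ hξ
  rw [hξ]

/-! ### Exponential weights -/

theorem integrable_exp_neg_mul_abs {k : ℝ} (hk : 0 < k) :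
    Integrable fun ξ : ℝ => Real.exp (-(k * |ξ|)) := by
  rw [← integrableOn_univ, ← Set.Iic_union_Ioi (a := (0 : ℝ))]
  refine IntegrableOn.union ?_ ?_
  · refine (integrableOn_exp_mul_Iic hk 0).congr_fun (fun ξ hξ => ?_) measurableSet_Iic
    simp only [abs_of_nonpos (Set.mem_Iic.1 hξ), mul_neg, neg_neg]
  · refine (integrableOn_exp_mul_Ioi (neg_lt_zero.2 hk) 0).congr_fun (fun ξ hξ => ?_)
      measurableSet_Ioi
    simp only [abs_of_pos (Set.mem_Ioi.1 hξ), neg_mul]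

theorem memLp_exp_neg_mul_abs {k : ℝ} (hk : 0 < k) :
    MemLp (fun ξ : ℝ => Real.exp (-(k * |ξ|))) 2 := by
  rw [memLp_two_iff_integrable_sq_norm (by fun_prop)]
  refine (integrable_exp_neg_mul_abs (k := 2 * k) (by positivity)).congr (ae_of_all _ fun ξ => ?_)
  simp only [Real.norm_of_nonneg (Real.exp_pos _).le, ← Real.exp_nat_mul]
  congr 1
  push_cast
  ring

/-- Half of the exponential decay absorbs any polynomial weight. -/
theorem exists_sobolev_weight_le (σ : ℝ) {k : ℝ} (hk : 0 < k) :
    ∃ M : ℝ, 0 < M ∧ ∀ ξ : ℝ, (1 + (2 * Real.pi * ξ) ^ 2) ^ (σ / 2) *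
      ((1 + 2 * Real.pi * |ξ|) * Real.exp (-(2 * k * |ξ|))) ≤ M * Real.exp (-(k * |ξ|)) := by
  -- One power more than the Sobolev weight, for the factor `1 + 2π|ξ|`; `r` is chosen so that `r (1
  -- + 2π|ξ|) = r + k|ξ|`.
  set n := ⌈|σ|⌉₊ + 1 with hn
  set r : ℝ := k / (2 * Real.pi) with hr
  have hr0 : 0 < r := by positivity
  refine ⟨n.factorial / r ^ n * Real.exp r, by positivity, fun ξ => ?_⟩
  set X : ℝ := 1 + 2 * Real.pi * |ξ| with hX
  have hX1 : 1 ≤ X := by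
    have : 0 ≤ 2 * Real.pi * |ξ| := by positivity
    linarith
  have h1 : (1 + (2 * Real.pi * ξ) ^ 2) ^ (σ / 2) ≤ X ^ ⌈|σ|⌉₊ := by
    have h2 : 1 + (2 * Real.pi * ξ) ^ 2 ≤ X ^ (2 : ℝ) := by
      rw [Real.rpow_two, hX, ← sq_abs (2 * Real.pi * ξ), abs_mul, abs_of_pos Real.two_pi_pos]
      nlinarith [show 0 ≤ 2 * Real.pi * |ξ| by positivity]
    have h3 : 1 ≤ 1 + (2 * Real.pi * ξ) ^ 2 := by nlinarith [sq_nonneg (2 * Real.pi * ξ)]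
    calc (1 + (2 * Real.pi * ξ) ^ 2) ^ (σ / 2) ≤ (1 + (2 * Real.pi * ξ) ^ 2) ^ (|σ| / 2) :=
          Real.rpow_le_rpow_of_exponent_le h3 (by linarith [le_abs_self σ])
      _ ≤ (X ^ (2 : ℝ)) ^ (|σ| / 2) := Real.rpow_le_rpow (by positivity) h2 (by positivity)
      _ = X ^ |σ| := by
          rw [← Real.rpow_mul (by linarith)]
          congr 1
          ring
      _ ≤ X ^ (⌈|σ|⌉₊ : ℝ) := Real.rpow_le_rpow_of_exponent_le hX1 (Nat.le_ceil _)
      _ = X ^ ⌈|σ|⌉₊ := Real.rpow_natCast _ _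
  have h4 : X ^ n ≤ n.factorial / r ^ n * Real.exp (r * X) := by
    have := Real.pow_div_factorial_le_exp (r * X) (by positivity) n
    rw [mul_pow] at this
    rw [div_mul_eq_mul_div, le_div_iff₀ (by positivity)]
    rw [div_le_iff₀ (by positivity)] at this
    linarith
  have h5 : r * X = r + k * |ξ| := by
    rw [hX, hr]
    field_simp
  calc _ ≤ X ^ ⌈|σ|⌉₊ * (X * Real.exp (-(2 * k * |ξ|))) := by gcongr
    _ = X ^ n * Real.exp (-(2 * k * |ξ|)) := by rw [hn]; ring
    _ ≤ n.factorial / r ^ n * Real.exp (r * X) * Real.exp (-(2 * k * |ξ|)) := by gcongr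
    _ = n.factorial / r ^ n * Real.exp r * Real.exp (-(k * |ξ|)) := by
        have h6 : Real.exp (r * X) * Real.exp (-(2 * k * |ξ|)) =
            Real.exp r * Real.exp (-(k * |ξ|)) := by
          rw [← Real.exp_add, ← Real.exp_add, h5]
          congr 1
          ring
        rw [mul_assoc, h6, mul_assoc]

/-! ### Fourier representation of rational functions -/

/-- The Fourier transform of `y ↦ (y - p)⁻¹`, for `p` in the upper half plane. -/
def poleKernel (p : ℂ) (ξ : ℝ) : ℂ :=
  if ξ ≤ 0 then 2 * Real.pi * Complex.I * Complex.exp (-(2 * Real.pi * Complex.I * p * ξ)) else 0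

theorem exponent_re (p : ℂ) (ξ : ℝ) :
    (-(2 * Real.pi * Complex.I * p * ξ)).re = 2 * Real.pi * p.im * ξ := by
  simp

theorem norm_poleKernel_le {p : ℂ} {k : ℝ} (hk : 2 * k ≤ 2 * Real.pi * p.im) (ξ : ℝ) :
    ‖poleKernel p ξ‖ ≤ 2 * Real.pi * Real.exp (-(2 * k * |ξ|)) := by
  rw [poleKernel]
  split_ifs with h
  · rw [norm_mul, Complex.norm_exp, exponent_re, abs_of_nonpos h]
    have h1 : ‖(2 * Real.pi * Complex.I : ℂ)‖ = 2 * Real.pi := by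
      simp [abs_of_pos Real.pi_pos]
    rw [h1]
    gcongr
    nlinarith
  · rw [norm_zero]
    positivity

theorem measurable_poleKernel (p : ℂ) : Measurable (poleKernel p) :=
  Measurable.ite measurableSet_Iic (by fun_prop) measurable_const

theorem norm_exp_sub_exp_le {z w : ℂ} {M : ℝ} (hz : z.re ≤ M) (hw : w.re ≤ M) :
    ‖Complex.exp z - Complex.exp w‖ ≤ Real.exp M * ‖z - w‖ := by
  refine Convex.norm_image_sub_le_of_norm_deriv_le (s := {z : ℂ | z.re ≤ M})
    (fun x _ => Complex.differentiableAt_exp) (fun x hx => ?_) (convex_halfSpace_re_le M) hw hz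
  rw [Complex.deriv_exp, Complex.norm_exp]
  exact Real.exp_le_exp.2 hx

/-- The exponential is Lipschitz on a left half plane; the factor `|ξ|` comes from the difference of
the exponents. -/
theorem norm_poleKernel_sub_le {p q : ℂ} {k : ℝ} (hp : 2 * k ≤ 2 * Real.pi * p.im)
    (hq : 2 * k ≤ 2 * Real.pi * q.im) (ξ : ℝ) :
    ‖poleKernel p ξ - poleKernel q ξ‖ ≤
      2 * Real.pi * ‖p - q‖ * (2 * Real.pi * |ξ| * Real.exp (-(2 * k * |ξ|))) := by
  rw [poleKernel, poleKernel]
  split_ifs with h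
  · have h1 : ‖(2 * Real.pi * Complex.I : ℂ)‖ = 2 * Real.pi := by
      simp [abs_of_pos Real.pi_pos]
    have h2 : -(2 * Real.pi * Complex.I * p * ξ) - -(2 * Real.pi * Complex.I * q * ξ) =
        -((2 * Real.pi * Complex.I) * (p - q) * ξ) := by ring
    have h3 := norm_exp_sub_exp_le (z := -(2 * Real.pi * Complex.I * p * ξ))
      (w := -(2 * Real.pi * Complex.I * q * ξ)) (M := -(2 * k * |ξ|))
      (by rw [exponent_re, abs_of_nonpos h]; nlinarith)
      (by rw [exponent_re, abs_of_nonpos h]; nlinarith)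
    rw [h2, norm_neg, norm_mul, norm_mul, h1, Complex.norm_real, Real.norm_eq_abs] at h3
    rw [← mul_sub, norm_mul, h1]
    refine (mul_le_mul_of_nonneg_left h3 (by positivity)).trans_eq ?_
    ring
  · rw [sub_zero, norm_zero]
    positivity

theorem integral_poleKernel {p : ℂ} (hp : 0 < p.im) (y : ℝ) :
    ∫ ξ : ℝ, Complex.exp (2 * Real.pi * y * ξ * Complex.I) * poleKernel p ξ = ((y : ℂ) - p)⁻¹ := by
  set c : ℂ := 2 * Real.pi * Complex.I * (y - p) with hc
  have hre : 0 < c.re := by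
    have : c.re = 2 * Real.pi * p.im := by simp [hc]
    rw [this]
    positivity
  have h1 : (fun ξ : ℝ => Complex.exp (2 * Real.pi * y * ξ * Complex.I) * poleKernel p ξ) =
      (Set.Iic (0 : ℝ)).indicator fun ξ => 2 * Real.pi * Complex.I * Complex.exp (c * ξ) := by
    ext ξ
    rw [Set.indicator_apply, poleKernel]
    simp only [Set.mem_Iic]
    split_ifs with h
    · rw [mul_left_comm, ← Complex.exp_add, hc]
      congr 2
      ring
    · rw [mul_zero]
  rw [h1, integral_indicator measurableSet_Iic, integral_const_mul,
    integral_exp_mul_complex_Iic hre, Complex.ofReal_zero, mul_zero, Complex.exp_zero, hc]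
  have h2 : (2 * Real.pi * Complex.I : ℂ) ≠ 0 := by
    simp [Real.pi_ne_zero]
  have h3 : (y : ℂ) - p ≠ 0 := fun h => by
    rw [hc, h, mul_zero] at hre
    exact lt_irrefl _ hre
  field_simp

theorem integrable_of_norm_le_exp {Φ : ℝ → C3} (hm : AEStronglyMeasurable Φ) {M k : ℝ} (hk : 0 < k)
    (h : ∀ ξ, ‖Φ ξ‖ ≤ M * Real.exp (-(k * |ξ|))) : Integrable Φ :=
  ((integrable_exp_neg_mul_abs hk).const_mul M).mono' hm (ae_of_all _ h)

theorem memLp_of_norm_le_exp {Φ : ℝ → C3} (hm : AEStronglyMeasurable Φ) {M k : ℝ} (hk : 0 < k)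
    (h : ∀ ξ, ‖Φ ξ‖ ≤ M * Real.exp (-(k * |ξ|))) : MemLp Φ 2 :=
  ((memLp_exp_neg_mul_abs hk).const_mul M).mono' hm (ae_of_all _ h)

theorem fourierInv_poleKernel_smul {p : ℂ} (hp : 0 < p.im) (a : C3) (y : ℝ) :
    𝓕⁻ (fun ξ => poleKernel p ξ • a) y = ((y : ℂ) - p)⁻¹ • a := by
  rw [Real.fourierInv_eq', ← integral_poleKernel hp y, ← integral_smul_const]
  refine integral_congr_ae (ae_of_all _ fun ξ => ?_)
  simp only [smul_smul]
  congr 3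
  simp
  ring

theorem integrable_poleKernel_smul {p : ℂ} (hp : 0 < p.im) (a : C3) :
    Integrable fun ξ => poleKernel p ξ • a := by
  have hk : 0 < Real.pi * p.im := mul_pos Real.pi_pos hp
  refine integrable_of_norm_le_exp ((measurable_poleKernel p).smul_const a).aestronglyMeasurable
    (M := 2 * Real.pi * ‖a‖) (k := 2 * (Real.pi * p.im)) (by positivity) fun ξ => ?_
  rw [norm_smul]
  refine (mul_le_mul_of_nonneg_right (norm_poleKernel_le (k := Real.pi * p.im) (by linarith) ξ)
    (norm_nonneg a)).trans_eq ?_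
  ring

theorem integrable_fourierInv_integrand {f : ℝ → C3} (hf : Integrable f) (y : ℝ) :
    Integrable fun ξ => Real.fourierChar (inner ℝ ξ y) • f ξ := by
  simpa using (Real.fourierIntegral_convergent_iff (-y)).2 hf

theorem fourierInv_add_apply {f g : ℝ → C3} (hf : Integrable f) (hg : Integrable g) (y : ℝ) :
    𝓕⁻ (fun ξ => f ξ + g ξ) y = 𝓕⁻ f y + 𝓕⁻ g y := by
  simp only [Real.fourierInv_eq, smul_add]
  exact integral_add (integrable_fourierInv_integrand hf y) (integrable_fourierInv_integrand hg y)

theorem fourierInv_sub_apply {f g : ℝ → C3} (hf : Integrable f) (hg : Integrable g) (y : ℝ) :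
    𝓕⁻ (fun ξ => f ξ - g ξ) y = 𝓕⁻ f y - 𝓕⁻ g y := by
  simp only [Real.fourierInv_eq, smul_sub]
  exact integral_sub (integrable_fourierInv_integrand hf y) (integrable_fourierInv_integrand hg y)

theorem fourierInv_sum_apply {ι : Type*} (S : Finset ι) {f : ι → ℝ → C3}
    (hf : ∀ i, Integrable (f i)) (y : ℝ) :
    𝓕⁻ (fun ξ => ∑ i ∈ S, f i ξ) y = ∑ i ∈ S, 𝓕⁻ (f i) y := by
  simp only [Real.fourierInv_eq, Finset.smul_sum]
  exact integral_finsetSum _ fun i _ => integrable_fourierInv_integrand (hf i) y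

/-- The conjugate poles are obtained by reflecting the frequencies and conjugating, so only upper
poles need a kernel. -/
theorem fourierInv_conjC_comp_neg (f : ℝ → C3) (y : ℝ) :
    𝓕⁻ (fun ξ => conjC (f (-ξ))) y = conjC (𝓕⁻ f y) := by
  have hanti : AntilipschitzWith 1 conjL := AddMonoidHomClass.antilipschitz_of_bound _ fun u => by
    rw [conjL_apply, norm_conjC, NNReal.coe_one, one_mul]
  rw [Real.fourierInv_eq', Real.fourierInv_eq', ← conjL_apply,
    ← conjL.integral_comp_comm' hanti, ← integral_neg_eq_self]
  refine integral_congr_ae (ae_of_all _ fun ξ => ?_)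
  ext i
  simp only [neg_neg, conjL_apply, conjC, PiLp.smul_apply, smul_eq_mul, map_mul, ← Complex.exp_conj,
    Complex.conj_ofReal, Complex.conj_I, inner_neg_left]
  congr 2
  push_cast
  ring

theorem conjC_sub (u w : C3) : conjC (u - w) = conjC u - conjC w := map_sub conjL u w

theorem conjC_sum {ι : Type*} (S : Finset ι) (f : ι → C3) :
    conjC (∑ i ∈ S, f i) = ∑ i ∈ S, conjC (f i) := map_sum conjL f S

theorem conjC_smul (c : ℂ) (u : C3) : conjC (c • u) = conj c • conjC u := by
  ext i
  simp [conjC]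

/-- The part at nonpositive frequencies of the Fourier transform of the difference of two rational
profiles with the same background. -/
def spectralDifference {N : ℕ} (s a : Fin N → C3) (p q : Fin N → ℂ) (ξ : ℝ) : C3 :=
  ∑ j, (poleKernel (p j) ξ • s j - poleKernel (q j) ξ • a j)

section

variable {N : ℕ} {s a : Fin N → C3} {p q : Fin N → ℂ}

theorem integrable_spectralDifference (hp : ∀ j, 0 < (p j).im) (hq : ∀ j, 0 < (q j).im) :
    Integrable (spectralDifference s a p q) :=
  integrable_finsetSum _ fun j _ =>
    (integrable_poleKernel_smul (hp j) (s j)).sub (integrable_poleKernel_smul (hq j) (a j))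

theorem measurable_spectralDifference : Measurable (spectralDifference s a p q) :=
  Finset.measurable_fun_sum _ fun j _ =>
    ((measurable_poleKernel (p j)).smul_const (s j)).sub ((measurable_poleKernel (q j)).smul_const _)

theorem fourierInv_spectralDifference (hp : ∀ j, 0 < (p j).im) (hq : ∀ j, 0 < (q j).im) (y : ℝ) :
    𝓕⁻ (spectralDifference s a p q) y =
      ∑ j, (((y : ℂ) - p j)⁻¹ • s j - ((y : ℂ) - q j)⁻¹ • a j) := by
  refine (fourierInv_sum_apply _ (fun j => (integrable_poleKernel_smul (hp j) (s j)).sub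
    (integrable_poleKernel_smul (hq j) (a j))) y).trans (Finset.sum_congr rfl fun j _ => ?_)
  refine (fourierInv_sub_apply (integrable_poleKernel_smul (hp j) (s j))
    (integrable_poleKernel_smul (hq j) (a j)) y).trans ?_
  rw [fourierInv_poleKernel_smul (hp j), fourierInv_poleKernel_smul (hq j)]

theorem measurable_conjC : Measurable conjC := conjL.continuous.measurable

theorem integrable_conjC_comp_neg {f : ℝ → C3} (hf : Integrable f) :
    Integrable fun ξ => conjC (f (-ξ)) :=
  conjL.integrable_comp hf.comp_neg

theorem fourierInv_eq_rationalProfile_sub (m₀ : R3) (hp : ∀ j, 0 < (p j).im)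
    (hq : ∀ j, 0 < (q j).im) (y : ℝ) :
    𝓕⁻ (fun ξ => spectralDifference s a p q ξ + conjC (spectralDifference s a p q (-ξ))) y =
      rationalProfile m₀ s p y - rationalProfile m₀ a q y := by
  have h := integrable_spectralDifference (s := s) (a := a) hp hq
  rw [fourierInv_add_apply h (integrable_conjC_comp_neg h), fourierInv_conjC_comp_neg,
    fourierInv_spectralDifference hp hq]
  simp only [conjC_sum, conjC_sub, conjC_smul, map_inv₀, map_sub, Complex.conj_ofReal,
    Finset.sum_sub_distrib, rationalProfile]
  abel

/-- The change of spin is separated from the change of pole, and each is estimated by its own kernel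
bound. -/
theorem norm_spectralDifference_le {k : ℝ} (hp : ∀ j, 2 * k ≤ 2 * Real.pi * (p j).im)
    (hq : ∀ j, 2 * k ≤ 2 * Real.pi * (q j).im) (ξ : ℝ) :
    ‖spectralDifference s a p q ξ‖ ≤ (∑ j, 2 * Real.pi * (‖s j - a j‖ + ‖p j - q j‖ * ‖a j‖)) *
      ((1 + 2 * Real.pi * |ξ|) * Real.exp (-(2 * k * |ξ|))) := by
  rw [Finset.sum_mul]
  refine (norm_sum_le _ _).trans (Finset.sum_le_sum fun j _ => ?_)
  have h1 : poleKernel (p j) ξ • s j - poleKernel (q j) ξ • a j =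
      poleKernel (p j) ξ • (s j - a j) + (poleKernel (p j) ξ - poleKernel (q j) ξ) • a j := by
    module
  have h2 := mul_le_mul_of_nonneg_right (norm_poleKernel_le (hp j) ξ) (norm_nonneg (s j - a j))
  have h3 := mul_le_mul_of_nonneg_right (norm_poleKernel_sub_le (hp j) (hq j) ξ)
    (norm_nonneg (a j))
  rw [h1]
  refine (norm_add_le _ _).trans ?_
  rw [norm_smul, norm_smul]
  refine (add_le_add h2 h3).trans ?_
  have h4 : 0 ≤ 2 * Real.pi * ‖s j - a j‖ * (2 * Real.pi * |ξ|) * Real.exp (-(2 * k * |ξ|)) := by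
    positivity
  have h5 : 0 ≤ 2 * Real.pi * (‖p j - q j‖ * ‖a j‖) * Real.exp (-(2 * k * |ξ|)) := by
    positivity
  linarith

end

theorem exists_sobolevNorm_rationalProfile_sub_le (σ : ℝ) {k : ℝ} (hk : 0 < k) :
    ∃ C : ℝ≥0∞, C ≠ ⊤ ∧ ∀ (N : ℕ) (m₀ : R3) (s a : Fin N → C3) (p q : Fin N → ℂ),
      (∀ j, 2 * k ≤ 2 * Real.pi * (p j).im) → (∀ j, 2 * k ≤ 2 * Real.pi * (q j).im) →
      sobolevNorm σ (fun y => rationalProfile m₀ s p y - rationalProfile m₀ a q y) ≤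
        ENNReal.ofReal (∑ j, 2 * Real.pi * (‖s j - a j‖ + ‖p j - q j‖ * ‖a j‖)) * C := by
  -- The case `σ = 0` places `Φ` in `L¹ ∩ L²`, as `sobolevNorm_fourierInv` requires.
  obtain ⟨M₀, hM₀, h₀⟩ := exists_sobolev_weight_le 0 hk
  obtain ⟨M, hM, hMw⟩ := exists_sobolev_weight_le σ hk
  refine ⟨ENNReal.ofReal (2 * M) *
    eLpNorm (fun ξ : ℝ => Real.exp (-(k * |ξ|))) 2 volume,
    ENNReal.mul_ne_top ENNReal.ofReal_ne_top (memLp_exp_neg_mul_abs hk).2.ne,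
    fun N m₀ s a p q hp hq => ?_⟩
  set δ := ∑ j, 2 * Real.pi * (‖s j - a j‖ + ‖p j - q j‖ * ‖a j‖)
  have hδ : 0 ≤ δ := Finset.sum_nonneg fun j _ => by positivity
  have him : ∀ {z : ℂ}, 2 * k ≤ 2 * Real.pi * z.im → 0 < z.im := fun h =>
    pos_of_mul_pos_right ((by positivity : 0 < 2 * k).trans_le h) Real.two_pi_pos.le
  set Φ := fun ξ => spectralDifference s a p q ξ + conjC (spectralDifference s a p q (-ξ))
  have hmeas : AEStronglyMeasurable Φ := (measurable_spectralDifference.add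
    (measurable_conjC.comp (measurable_spectralDifference.comp measurable_neg))).aestronglyMeasurable
  have hΦ : ∀ ξ, ‖Φ ξ‖ ≤ 2 * δ * ((1 + 2 * Real.pi * |ξ|) * Real.exp (-(2 * k * |ξ|))) := by
    intro ξ
    have h1 := norm_spectralDifference_le (s := s) (a := a) hp hq ξ
    have h2 := norm_spectralDifference_le (s := s) (a := a) hp hq (-ξ)
    rw [abs_neg] at h2
    have h3 := norm_add_le (spectralDifference s a p q ξ) (conjC (spectralDifference s a p q (-ξ)))
    rw [norm_conjC] at h3
    linarith
  have hΦ' : ∀ ξ, ‖Φ ξ‖ ≤ 2 * δ * M₀ * Real.exp (-(k * |ξ|)) := by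
    intro ξ
    have h1 := h₀ ξ
    rw [zero_div, Real.rpow_zero, one_mul] at h1
    refine (hΦ ξ).trans ?_
    rw [mul_assoc (2 * δ) M₀]
    gcongr
  have hrep : (fun y => rationalProfile m₀ s p y - rationalProfile m₀ a q y) = 𝓕⁻ Φ :=
    funext fun y => (fourierInv_eq_rationalProfile_sub m₀ (fun j => him (hp j))
      (fun j => him (hq j)) y).symm
  rw [hrep, sobolevNorm_fourierInv σ (integrable_of_norm_le_exp hmeas hk hΦ')
    (memLp_of_norm_le_exp hmeas hk hΦ'), ← mul_assoc, ← ENNReal.ofReal_mul hδ]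
  refine eLpNorm_le_mul_eLpNorm_of_ae_le_mul (ae_of_all _ fun ξ => ?_) 2
  have hw : 0 ≤ (1 + (2 * Real.pi * ξ) ^ 2) ^ (σ / 2) := by positivity
  rw [norm_smul, Real.norm_of_nonneg hw, Real.norm_of_nonneg (Real.exp_pos _).le]
  refine (mul_le_mul_of_nonneg_left (hΦ ξ) hw).trans ?_
  have := mul_le_mul_of_nonneg_left (hMw ξ) (mul_nonneg zero_le_two hδ)
  linarith

theorem IsRationalSolution.scattersTo {N : ℕ} {T : ℝ} {m : ℝ → ℝ → R3} {m₀ : R3}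
    {s : Fin N → ℝ → C3} {x : Fin N → ℝ → ℂ} (hm : IsRationalSolution (Set.Ioi T) m m₀ s x)
    {v : Fin N → ℝ} {a : Fin N → C3} {b : Fin N → ℂ} (hb : ∀ j, 0 < (b j).im)
    (hx : ∀ j, Tendsto (fun t : ℝ => x j t - (v j : ℂ) * (t : ℂ)) atTop (𝓝 (b j)))
    (hs : ∀ j, Tendsto (fun t : ℝ => s j t) atTop (𝓝 (a j))) :
    ScattersTo m (fun t => rationalProfile m₀ a (fun j => (v j : ℂ) * (t : ℂ) + b j)) := by
  intro σ _
  obtain ⟨β, hβ, hβb⟩ : ∃ β : ℝ, 0 < β ∧ ∀ j, β ≤ (b j).im := by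
    rcases isEmpty_or_nonempty (Fin N) with hN | hN
    · exact ⟨1, one_pos, fun j => hN.elim j⟩
    · obtain ⟨i, hi⟩ := Finite.exists_min fun j => (b j).im
      exact ⟨_, hb i, hi⟩
  obtain ⟨C, hC, hbound⟩ := exists_sobolevNorm_rationalProfile_sub_le σ
    -- `2k = πβ` is admissible as soon as all imaginary parts are at least `β / 2`, which holds for
    -- the limit profile and, at large times, for the poles of `m`.
    (k := Real.pi * (β / 2)) (by positivity)
  have him : ∀ᶠ t in atTop, ∀ j, β / 2 < (x j t).im := by
    refine eventually_all.2 fun j => ?_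
    filter_upwards [((Complex.continuous_im.tendsto _).comp (hx j)).eventually
      (lt_mem_nhds (show β / 2 < (b j).im by linarith [hβb j]))] with t ht
    simpa [Complex.im_mul_ofReal] using ht
  have hδ : Tendsto (fun t => ENNReal.ofReal (∑ j, 2 * Real.pi *
      (‖s j t - a j‖ + ‖x j t - ((v j : ℂ) * (t : ℂ) + b j)‖ * ‖a j‖)) * C) atTop (𝓝 0) := by
    have h1 : Tendsto (fun t => ∑ j, 2 * Real.pi *
        (‖s j t - a j‖ + ‖x j t - ((v j : ℂ) * (t : ℂ) + b j)‖ * ‖a j‖)) atTop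
        (𝓝 (∑ j : Fin N, 2 * Real.pi * (0 + 0 * ‖a j‖))) := by
      refine tendsto_finsetSum _ fun j _ => Tendsto.const_mul _ (Tendsto.add ?_
        (Tendsto.mul_const _ ?_))
      · simpa using ((hs j).sub_const (a j)).norm
      · simpa [sub_sub] using ((hx j).sub_const (b j)).norm
    simp only [zero_mul, add_zero, mul_zero, Finset.sum_const_zero] at h1
    have h2 := ENNReal.Tendsto.mul_const (ENNReal.tendsto_ofReal h1) (Or.inr hC)
    rwa [ENNReal.ofReal_zero, zero_mul] at h2
  refine tendsto_of_tendsto_of_tendsto_of_le_of_le' tendsto_const_nhds hδ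
    (Eventually.of_forall fun t => zero_le) ?_
  filter_upwards [him, eventually_gt_atTop T] with t ht hT
  have hrep : (fun y => toC (m t y) - rationalProfile m₀ a (fun j => (v j : ℂ) * (t : ℂ) + b j) y) =
      fun y => rationalProfile m₀ (fun j => s j t) (fun j => x j t) y -
        rationalProfile m₀ a (fun j => (v j : ℂ) * (t : ℂ) + b j) y :=
    funext fun y => by rw [hm.representation t hT y]
  rw [hrep]
  refine hbound N m₀ _ _ _ _ (fun j => ?_) (fun j => ?_)
  · nlinarith [ht j, Real.pi_pos]
  · rw [Complex.add_im, Complex.im_mul_ofReal, Complex.ofReal_im, zero_mul, zero_add]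
    nlinarith [hβb j, Real.pi_pos]

end HalfWave

end

theorem mainTheorem3 {N : ℕ} (T t₀ : ℝ) (hT : T < t₀) (m : ℝ → ℝ → HalfWave.R3)
    (m₀ : HalfWave.R3) (s : Fin N → ℝ → HalfWave.C3) (x : Fin N → ℝ → ℂ)
    (hm : HalfWave.IsRationalSolution (Set.Ioi T) m m₀ s x)
    (hα : 0 < HalfWave.alpha s x t₀) :
    ∃ (v : Fin N → ℝ) (a : Fin N → HalfWave.C3) (b : Fin N → ℂ),
      Function.Injective v ∧
      (∀ j, 0 < (b j).im) ∧
      HalfWave.ScattersTo m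
        (fun t => HalfWave.rationalProfile m₀ a (fun j => (v j : ℂ) * (t : ℂ) + b j)) ∧
      (∀ j, Tendsto (fun t : ℝ => x j t - (v j : ℂ) * (t : ℂ)) atTop (𝓝 (b j))) ∧
      (∀ j, Tendsto (fun t : ℝ => s j t) atTop (𝓝 (a j))) := by
  obtain ⟨v, a, b, hv, hb, hx, hs⟩ := HalfWave.IsRationalSolution.exists_asymptotics hT hm hα
  exact ⟨v, a, b, hv, hb, hm.scattersTo hb hx hs, hx, hs⟩
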